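/- **Setting.** Let $\mathbf q=\mathbf q(x,t)\in\mathbb C^2$, $x,t\in\mathbb R$, be a classical solution of the coupled mKdV equation $$\mathbf q_t+\mathbf q_{xxx}+3(\mathbf q^\dagger\mathbf q)\mathbf q_x+3(\mathbf q^\dagger\mathbf q_x)\mathbf q=0$$ ($\mathbf q$ is three times continuously differentiable in $x$, with $\mathbf q,\mathbf q_x,\mathbf q_{xx},\mathbf q_{xxx}$ jointly continuous in $(x,t)$, and differentiable in $t$). For real $u,v$ and $\mathbf q=(u,v)^T$ this is the system $u_t+u_{xxx}+6u^2u_x+3v^2u_x+3uvv_x=0$, $v_t+v_{xxx}+6v^2v_x+3u^2v_x+3uvu_x=0$. Let $\mathbf q\to\mathbf q_\pm=e^{i\theta^\pm}\mathbf q_0$ as $x\to\pm\infty$, where $\theta^\pm\in\mathbb R$, $\mathbf q_0\in\mathbb C^2$, $q_0=\|\mathbf q_0\|>0$; assume $\mathbf q(\cdot,t)-\mathbf q_+\in L^1(a,\infty)$ and $\mathbf q(\cdot,t)-\mathbf q_-\in L^1(-\infty,a)$ for all $a,t$, and that $\mathbf q\to\mathbf q_\pm$, $\mathbf q_x\to0$,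 $\mathbf q_{xx}\to0$ as $x\to\pm\infty$, uniformly for $t$ in compact sets. Put $\sigma_3=\mathrm{diag}(1,1,-1)$, $Q=\begin{pmatrix}0&\mathbf q\\-\mathbf q^\dagger&0\end{pmatrix}$, $U=ik\sigma_3+Q$, $V=4ik^3\sigma_3+4k^2Q-2ik\sigma_3(Q_x-Q^2)+2Q^3-Q_{xx}+[Q_x,Q]$, with $k=\frac12(z-q_0^2/z)$, $\lambda=\frac12(z+q_0^2/z)$, $\gamma=1+q_0^2/z^2$, $\hat z=-q_0^2/z$, and $$\theta_1=\lambda[x+2(2k^2-q_0^2)t],\quad\theta_2=k(x+4k^2t),\quad\theta=\mathrm{diag}(\theta_1,\theta_2,-\theta_1),\quad \Gamma_\pm=\begin{pmatrix}\mathbf q_\pm/q_0&\mathbf q_\pm^\perp/q_0&i\mathbf q_\pm/z\\ iq_0/z&0&1\end{pmatrix},$$ where $(w_1,w_2)^\perp=(w_2^*,-w_1^*)^T$. Let $D_1=\{|z|>q_0,\Im z>0\}$, $D_2=\{|z|>q_0,\Im z<0\}$, $D_3=\{|z|<q_0,\Im z<0\}$, $D_4=\{|z|<q_0,\Im z>0\}$,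 and $\Sigma_j=\bar D_j\cap\bar D_{j+1}$ (with $D_5=D_1$). Call $z$ regular if $z\ne0$ and $z\neq\pm iq_0$. The Jost column $\Phi_{\pm,j}$ is the simultaneous solution of $\Phi_x=U\Phi$, $\Phi_t=V\Phi$ with $\Phi_{\pm,j}e^{-i(\theta)_{jj}}\to\Gamma_{\pm,j}$ as $x\to\pm\infty$ for every $t$, and the adjoint column $\widetilde\Phi_{\pm,j}$ is the simultaneous solution of $\widetilde\Phi_x=\overline{U(\bar z)}\,\widetilde\Phi$, $\widetilde\Phi_t=\overline{V(\bar z)}\,\widetilde\Phi$ with $\widetilde\Phi_{\pm,j}e^{i(\theta)_{jj}}\to\overline{\Gamma_{\pm,j}(\bar z)}$. Put $\mu_{\pm,j}=\Phi_{\pm,j}e^{-i(\theta)_{jj}}$, $$\chi_1=e^{i\theta_2}\widetilde\Phi_{-,2}\times\widetilde\Phi_{+,3},\ \chi_2=e^{i\theta_2}\widetilde\Phi_{+,2}\times\widetilde\Phi_{-,3},\ \chi_3=e^{i\theta_2}\widetilde\Phi_{-,1}\times\widetilde\Phi_{+,2},\ \chi_4=e^{i\theta_2}\widetilde\Phi_{+,1}\times\widetilde\Phi_{-,2},$$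 $m_{1,2}=e^{-i\theta_1}\chi_{1,2}$ and $m_{3,4}=e^{i\theta_1}\chi_{3,4}$. The scattering coefficients are $a_{ij}=C_i^{-1}\widetilde\Phi_{+,i}^T\Phi_{-,j}$ and $b_{ij}=C_i^{-1}\widetilde\Phi_{-,i}^T\Phi_{+,j}$ (taken at $x=t=0$), $(C_1,C_2,C_3)=(\gamma,1,\gamma)$, for those $z$ at which both columns exist. Put $\rho_1=a_{21}/a_{11}$, $\rho_2=a_{31}/a_{11}$, $\rho_3=a_{32}/a_{22}$; $f^*(w^*)$ denotes $\overline{f(\bar w)}$. Define $$M^+=\begin{cases}M_1=\left(-\frac{m_1}{b_{22}},\ \mu_{+,2},\ \frac{\mu_{-,3}}{a_{33}}\right),& D_1,\\ M_3=\left(\mu_{+,1},\ \frac{\mu_{-,2}}{a_{22}},\ -\frac{m_3}{b_{11}}\right),& D_3,\end{cases}\qquad M^-=\begin{cases}M_2=\left(-\frac{m_2}{b_{33}},\ \frac{\mu_{-,2}}{a_{22}},\ \mu_{+,3}\right),& D_2,\\ M_4=\left(\frac{\mu_{-,1}}{a_{11}},\ \mu_{+,2},\ -\frac{m_4}{b_{22}}\right),&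 D_4.\end{cases}$$ **Theorem.** 1. At regular $z$, the columns $\Phi_{+,1},\Phi_{+,2},\Phi_{+,3},\Phi_{-,1},\Phi_{-,2},\Phi_{-,3}$ exist and are unique on, respectively, $\bar D_3\cup\mathbb R$, $\{\Im z\ge0\}$, $\bar D_2\cup\mathbb R$, $\bar D_4\cup\mathbb R$, $\{\Im z\le0\}$, $\bar D_1\cup\mathbb R$; the adjoint columns exist and are unique on the complex conjugates of these sets. For real $z\ne0$ and all $x,t$, $\Phi_+=(\Phi_{+,1},\Phi_{+,2},\Phi_{+,3})$ is invertible, $\Phi_-(x,t,z)=\Phi_+(x,t,z)A(z)$ with $A=(a_{ij})$, and $A^{-1}=B=(b_{ij})$. 2. The denominators ($b_{22},a_{33}$ on $D_1$; $b_{33},a_{22}$ on $D_2$; $b_{11},a_{22}$ on $D_3$; $b_{22},a_{11}$ on $D_4$) are analytic and not identically zero. For all $x,t$, $M_j$ is meromorphic in $D_j$, is analytic at all points of $D_j$ where its denominators do not vanish, and its limit from $D_j$ at each regular point of $\bar D_j$ where its denominators do not vanish is the value there of the formula that defines it. 3. At every regular $z\in\Sigma_j$ ($j=1,2,3,4$)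 at which the denominators of the two adjacent $M$'s do not vanish, and for all $x,t$, $$M^+(x,t,z)=M^-(x,t,z)\left[I-e^{i\theta(x,t,z)}L_j(z)e^{-i\theta(x,t,z)}\right],$$ where $M^+,M^-$ are the boundary values from the two adjacent regions ($M_1,M_2$ on $\Sigma_1$; $M_3,M_2$ on $\Sigma_2$; $M_3,M_4$ on $\Sigma_3$; $M_1,M_4$ on $\Sigma_4$), and $$L_1=\begin{pmatrix}-\frac{z^2}{q_0^2}\gamma\rho_3^*(\hat z^*)\rho_3(\hat z)&\frac z{iq_0}\rho_3(\hat z)&\rho_1(\hat z)\rho_3(\hat z)-\rho_2(\hat z)\\-\frac z{iq_0}\gamma\rho_3^*(\hat z^*)&0&-\frac{iq_0}z\rho_1(\hat z)\\ \ell_1&\ell_2&\ell_3\end{pmatrix},\qquad L_2=\begin{pmatrix}0&0&\rho_2^*(z^*)\\0&0&0\\-\rho_2^*(\hat z^*)&0&\rho_2^*(z^*)\rho_2^*(\hat z^*)\end{pmatrix},$$ $$L_3=\begin{pmatrix}0&-\frac z{iq_0}\rho_3(\hat z)&\rho_2^*(z^*)\\ \rho_1(z)+\gamma\rho_2(z)\rho_3^*(z^*)&\ell_4&\ell_5\\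 \rho_2(z)&\frac z{iq_0}\rho_3(\hat z)\rho_2(z)-\rho_3(z)&-\rho_2^*(z^*)\rho_2(z)\end{pmatrix},\qquad L_4=\begin{pmatrix}0&0&-\rho_2(\hat z)\\0&0&0\\ \rho_2(z)&0&\rho_2(z)\rho_2(\hat z)\end{pmatrix},$$ with $$\begin{aligned}\ell_1&=-\rho_2^*(\hat z^*)-\tfrac{z^2}{q_0^2}\gamma\rho_3^*(\hat z^*)\rho_3(\hat z)\rho_2^*(\hat z^*)+\gamma\tfrac z{iq_0}\rho_3^*(\hat z^*)\rho_3(z),\\ \ell_2&=\tfrac z{iq_0}\rho_3(\hat z)\rho_2^*(\hat z^*)+\rho_3(z),\\ \ell_3&=\rho_1(\hat z)\rho_3(\hat z)\rho_2^*(\hat z^*)+\tfrac{iq_0}z\rho_1(\hat z)\rho_3(z)-\rho_2(\hat z)\rho_2^*(\hat z^*),\\ \ell_4&=-\gamma\rho_3^*(z^*)\rho_3(z)+\tfrac z{iq_0}\rho_3(\hat z)\rho_1(z)+\tfrac z{iq_0}\rho_3(\hat z)\gamma\rho_3^*(z^*)\rho_2(z),\\ \ell_5&=-\gamma\rho_3^*(z^*)-\rho_2^*(z^*)\rho_1(z)-\gamma\rho_2^*(z^*)\rho_2(z)\rho_3^*(z^*).\end{aligned}$$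 4. For real $z\neq0$ with $a_{11}(z),a_{33}(z),b_{22}(z)\ne0$, the combinations $\rho_1(z)+\gamma\rho_3^*(z^*)\rho_2(z)-\frac z{iq_0}\gamma\rho_3^*(\hat z^*)$ and $-\frac{iq_0}z\rho_1(\hat z)-\gamma\rho_3^*(z^*)+\rho_1(z)\rho_2(\hat z)+\gamma\rho_3^*(z^*)\rho_2(\hat z)\rho_2(z)$ vanish. -/

import Mathlib

open Filter Topology MeasureTheory Matrix ComplexConjugate

noncomputable section

namespace CMKdV

/-- Values of the potential vector `𝐪 = (u, v*)ᵀ`, with the Euclidean norm. -/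
abbrev C2 := EuclideanSpace ℂ (Fin 2)

/-- The `n`-th derivative of `q(x,t)` with respect to `x`. -/
def dx (q : ℝ → ℝ → C2) (n : ℕ) (x t : ℝ) : C2 :=
  iteratedDeriv n (fun y => q y t) x

/-- A classical solution `𝐪(x,t)` of the coupled mKdV equation in vector form,
`𝐪ₜ + 𝐪ₓₓₓ + 3 (𝐪†𝐪) 𝐪ₓ + 3 (𝐪†𝐪ₓ) 𝐪 = 0`, with the nonzero parallel boundary values
`𝐪 → 𝐪± = e^{iθ±} 𝐪₀` as `x → ±∞`.  For `𝐪 = (u, v)` with real `u`, `v` the equation is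
`uₜ + uₓₓₓ + 6u²uₓ + 3v²uₓ + 3uvvₓ = 0`, `vₜ + vₓₓₓ + 6v²vₓ + 3u²vₓ + 3uvuₓ = 0`. -/
structure NZBCSolution where
  /-- the potential -/
  q : ℝ → ℝ → C2
  /-- the vector `𝐪₀` -/
  qvec : C2
  /-- the phase at `+∞` -/
  phasePlus : ℝ
  /-- the phase at `-∞` -/
  phaseMinus : ℝ
  qvec_ne : qvec ≠ 0
  contDiff_x : ∀ t, ContDiff ℝ 3 (fun x => q x t)
  continuous_dx : ∀ n ≤ 3, Continuous (fun p : ℝ × ℝ => dx q n p.1 p.2)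
  differentiable_t : ∀ x, Differentiable ℝ (fun t => q x t)
  equation : ∀ x t, deriv (fun s => q x s) t + dx q 3 x t
    + (3 * (‖q x t‖ : ℂ) ^ 2) • dx q 1 x t
    + (3 * inner ℂ (q x t) (dx q 1 x t)) • q x t = 0
  integrable_plus : ∀ t a, IntegrableOn
    (fun x => q x t - Complex.exp (Complex.I * phasePlus) • qvec) (Set.Ioi a)
  integrable_minus : ∀ t a, IntegrableOn
    (fun x => q x t - Complex.exp (Complex.I * phaseMinus) • qvec) (Set.Iio a)
  tendsto_plus : ∀ T : ℝ, TendstoUniformlyOn (fun x t => q x t)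
    (fun _ => Complex.exp (Complex.I * phasePlus) • qvec) atTop (Set.Icc (-T) T)
  tendsto_minus : ∀ T : ℝ, TendstoUniformlyOn (fun x t => q x t)
    (fun _ => Complex.exp (Complex.I * phaseMinus) • qvec) atBot (Set.Icc (-T) T)
  tendsto_dx_plus : ∀ n, n = 1 ∨ n = 2 → ∀ T : ℝ,
    TendstoUniformlyOn (fun x t => dx q n x t) (fun _ => 0) atTop (Set.Icc (-T) T)
  tendsto_dx_minus : ∀ n, n = 1 ∨ n = 2 → ∀ T : ℝ,
    TendstoUniformlyOn (fun x t => dx q n x t) (fun _ => 0) atBot (Set.Icc (-T) T)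

/-- `σ₃ = diag(1, 1, -1)`. -/
def sigma3 : Matrix (Fin 3) (Fin 3) ℂ := diagonal ![1, 1, -1]

/-- The block matrix `((0, w), (-w†, 0))`. -/
def Qmat (w : C2) : Matrix (Fin 3) (Fin 3) ℂ :=
  !![0, 0, w 0; 0, 0, w 1; -conj (w 0), -conj (w 1), 0]

/-- The conjugate `f*(z*)`. -/
def star' (f : ℂ → ℂ) (z : ℂ) : ℂ := conj (f (conj z))

/-- `φ` solves `φₓ = U φ`, `φₜ = V φ` and `φ ~ ξ e^{Θ}` as `x → ±∞` for every `t`, where the end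
is given by the filter `l`. -/
def IsJost (U V : ℝ → ℝ → Matrix (Fin 3) (Fin 3) ℂ) (Θ : ℝ → ℝ → ℂ) (ξ : Fin 3 → ℂ)
    (l : Filter ℝ) (φ : ℝ → ℝ → Fin 3 → ℂ) : Prop :=
  (∀ x t, HasDerivAt (fun y => φ y t) (U x t *ᵥ φ x t) x) ∧
  (∀ x t, HasDerivAt (fun s => φ x s) (V x t *ᵥ φ x t) t) ∧
  ∀ t, Tendsto (fun x => Complex.exp (-Θ x t) • φ x t) l (𝓝 ξ)

namespace NZBCSolution

variable (S : NZBCSolution)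

/-- The amplitude `q₀ = ‖𝐪₀‖`. -/
def q0 : ℝ := ‖S.qvec‖

/-- The boundary value `𝐪₊`. -/
def qPlus : C2 := Complex.exp (Complex.I * S.phasePlus) • S.qvec

/-- The boundary value `𝐪₋`. -/
def qMinus : C2 := Complex.exp (Complex.I * S.phaseMinus) • S.qvec

/-- `k(z) = (z - q₀²/z)/2`. -/
def k (z : ℂ) : ℂ := (z - (S.q0 : ℂ) ^ 2 / z) / 2

/-- `λ(z) = (z + q₀²/z)/2`, so that `λ² = k² + q₀²` and `z = k + λ`. -/
def lam (z : ℂ) : ℂ := (z + (S.q0 : ℂ) ^ 2 / z) / 2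

/-- `γ(z) = 1 + q₀²/z²`. -/
def gam (z : ℂ) : ℂ := 1 + (S.q0 : ℂ) ^ 2 / z ^ 2

/-- `ẑ = -q₀²/z`. -/
def hat (z : ℂ) : ℂ := -(S.q0 : ℂ) ^ 2 / z

/-- Points `z ≠ 0` that are not branch points `± i q₀`. -/
def Regular (z : ℂ) : Prop := z ≠ 0 ∧ S.gam z ≠ 0

def D1 : Set ℂ := {z | S.q0 < ‖z‖ ∧ 0 < z.im}
def D2 : Set ℂ := {z | S.q0 < ‖z‖ ∧ z.im < 0}
def D3 : Set ℂ := {z | ‖z‖ < S.q0 ∧ z.im < 0}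
def D4 : Set ℂ := {z | ‖z‖ < S.q0 ∧ 0 < z.im}

def Sigma1 : Set ℂ := closure S.D1 ∩ closure S.D2
def Sigma2 : Set ℂ := closure S.D2 ∩ closure S.D3
def Sigma3 : Set ℂ := closure S.D3 ∩ closure S.D4
def Sigma4 : Set ℂ := closure S.D4 ∩ closure S.D1

/-- `U = i k σ₃ + Q`. -/
def U (κ : ℂ) (x t : ℝ) : Matrix (Fin 3) (Fin 3) ℂ :=
  (Complex.I * κ) • sigma3 + Qmat (S.q x t)

/-- `V = 4ik³σ₃ + 4k²Q - 2ikσ₃(Qₓ - Q²) + 2Q³ - Qₓₓ + [Qₓ, Q]`. -/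
def V (κ : ℂ) (x t : ℝ) : Matrix (Fin 3) (Fin 3) ℂ :=
  let Q := Qmat (S.q x t)
  let Qx := Qmat (dx S.q 1 x t)
  let Qxx := Qmat (dx S.q 2 x t)
  (4 * Complex.I * κ ^ 3) • sigma3 + (4 * κ ^ 2) • Q
    - (2 * Complex.I * κ) • (sigma3 * (Qx - Q ^ 2)) + (2 : ℂ) • Q ^ 3 - Qxx + (Qx * Q - Q * Qx)

/-- `θ₁ = λ [x + 2(2k² - q₀²) t]`. -/
def theta1 (x t : ℝ) (z : ℂ) : ℂ :=
  S.lam z * (x + 2 * (2 * S.k z ^ 2 - (S.q0 : ℂ) ^ 2) * t)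

/-- `θ₂ = k (x + 4k² t)`. -/
def theta2 (x t : ℝ) (z : ℂ) : ℂ := S.k z * (x + 4 * S.k z ^ 2 * t)

/-- The diagonal entries of `θ = diag(θ₁, θ₂, -θ₁)`. -/
def theta (j : Fin 3) (x t : ℝ) (z : ℂ) : ℂ :=
  ![S.theta1 x t z, S.theta2 x t z, -S.theta1 x t z] j

/-- The eigenvector matrix `((w/q₀, w^⊥/q₀, iw/z), (iq₀/z, 0, 1))`, with
`w^⊥ = (w₂*, -w₁*)ᵀ`; it is `Γ±` for `w = 𝐪±`. -/
def Gam (w : C2) (z : ℂ) : Matrix (Fin 3) (Fin 3) ℂ :=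
  !![w 0 / S.q0, conj (w 1) / S.q0, Complex.I * w 0 / z;
     w 1 / S.q0, -conj (w 0) / S.q0, Complex.I * w 1 / z;
     Complex.I * S.q0 / z, 0, 1]

/-- The defining property of the Jost column `Φ₊,ⱼ(·,·,z)`: a simultaneous solution of the Lax
pair with `Φ₊,ⱼ ~ Γ₊,ⱼ e^{iθⱼ}` as `x → +∞`. -/
def IsPhiPlus (j : Fin 3) (z : ℂ) (φ : ℝ → ℝ → Fin 3 → ℂ) : Prop :=
  IsJost (S.U (S.k z)) (S.V (S.k z)) (fun x t => Complex.I * S.theta j x t z)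
    (fun i => S.Gam S.qPlus z i j) atTop φ

/-- The defining property of the Jost column `Φ₋,ⱼ(·,·,z)`. -/
def IsPhiMinus (j : Fin 3) (z : ℂ) (φ : ℝ → ℝ → Fin 3 → ℂ) : Prop :=
  IsJost (S.U (S.k z)) (S.V (S.k z)) (fun x t => Complex.I * S.theta j x t z)
    (fun i => S.Gam S.qMinus z i j) atBot φ

/-- The coefficient `Ũ = (U(z*))*` of the adjoint Lax pair. -/
def Uadj (z : ℂ) (x t : ℝ) : Matrix (Fin 3) (Fin 3) ℂ := (S.U (S.k (conj z)) x t).map conj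

/-- The coefficient `Ṽ = (V(z*))*` of the adjoint Lax pair. -/
def Vadj (z : ℂ) (x t : ℝ) : Matrix (Fin 3) (Fin 3) ℂ := (S.V (S.k (conj z)) x t).map conj

/-- The defining property of the adjoint Jost column `Φ̃₊,ⱼ ~ Γ̃₊,ⱼ e^{-iθⱼ}`, `x → +∞`, where
`Γ̃₊(z) = (Γ₊(z*))*`. -/
def IsPhiPlusAdj (j : Fin 3) (z : ℂ) (φ : ℝ → ℝ → Fin 3 → ℂ) : Prop :=
  IsJost (S.Uadj z) (S.Vadj z) (fun x t => -(Complex.I * S.theta j x t z))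
    (fun i => conj (S.Gam S.qPlus (conj z) i j)) atTop φ

/-- The defining property of the adjoint Jost column `Φ̃₋,ⱼ`. -/
def IsPhiMinusAdj (j : Fin 3) (z : ℂ) (φ : ℝ → ℝ → Fin 3 → ℂ) : Prop :=
  IsJost (S.Uadj z) (S.Vadj z) (fun x t => -(Complex.I * S.theta j x t z))
    (fun i => conj (S.Gam S.qMinus (conj z) i j)) atBot φ

/-- Where `Φ₊,ⱼ` is determined by its defining property (up to the exceptional points
`0`, `± i q₀`): the closure of its region of analyticity together with the real axis. -/
def domPlus (j : Fin 3) : Set ℂ :=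
  ![closure S.D3 ∪ {z | z.im = 0}, {z | 0 ≤ z.im}, closure S.D2 ∪ {z | z.im = 0}] j

/-- Where `Φ₋,ⱼ` is determined by its defining property. -/
def domMinus (j : Fin 3) : Set ℂ :=
  ![closure S.D4 ∪ {z | z.im = 0}, {z | z.im ≤ 0}, closure S.D1 ∪ {z | z.im = 0}] j

/-- The column `Φ₊,ⱼ(x,t,z)`. -/
def PhiPlus (j : Fin 3) (x t : ℝ) (z : ℂ) : Fin 3 → ℂ :=
  Classical.epsilon (S.IsPhiPlus j z) x t

/-- The column `Φ₋,ⱼ(x,t,z)`. -/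
def PhiMinus (j : Fin 3) (x t : ℝ) (z : ℂ) : Fin 3 → ℂ :=
  Classical.epsilon (S.IsPhiMinus j z) x t

/-- The adjoint column `Φ̃₊,ⱼ(x,t,z)`. -/
def PhiPlusAdj (j : Fin 3) (x t : ℝ) (z : ℂ) : Fin 3 → ℂ :=
  Classical.epsilon (S.IsPhiPlusAdj j z) x t

/-- The adjoint column `Φ̃₋,ⱼ(x,t,z)`. -/
def PhiMinusAdj (j : Fin 3) (x t : ℝ) (z : ℂ) : Fin 3 → ℂ :=
  Classical.epsilon (S.IsPhiMinusAdj j z) x t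

/-- The matrix with the given three columns. -/
def cols (c₁ c₂ c₃ : Fin 3 → ℂ) : Matrix (Fin 3) (Fin 3) ℂ :=
  Matrix.of fun i j => ![c₁ i, c₂ i, c₃ i] j

/-- The matrix `Φ₊(x,t,z)`. -/
def PhiPlusMat (x t : ℝ) (z : ℂ) : Matrix (Fin 3) (Fin 3) ℂ :=
  cols (S.PhiPlus 0 x t z) (S.PhiPlus 1 x t z) (S.PhiPlus 2 x t z)

/-- The matrix `Φ₋(x,t,z)`. -/
def PhiMinusMat (x t : ℝ) (z : ℂ) : Matrix (Fin 3) (Fin 3) ℂ :=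
  cols (S.PhiMinus 0 x t z) (S.PhiMinus 1 x t z) (S.PhiMinus 2 x t z)

/-- `μ₊,ⱼ = e^{-iθⱼ} Φ₊,ⱼ`. -/
def muPlus (j : Fin 3) (x t : ℝ) (z : ℂ) : Fin 3 → ℂ :=
  Complex.exp (-(Complex.I * S.theta j x t z)) • S.PhiPlus j x t z

/-- `μ₋,ⱼ = e^{-iθⱼ} Φ₋,ⱼ`. -/
def muMinus (j : Fin 3) (x t : ℝ) (z : ℂ) : Fin 3 → ℂ :=
  Complex.exp (-(Complex.I * S.theta j x t z)) • S.PhiMinus j x t z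

/-- `C(z) = diag(γ, 1, γ)`, for which `(Φ±(z*))† Φ±(z) = Φ̃±(z)ᵀ Φ±(z) = C(z)`. -/
def C (j : Fin 3) (z : ℂ) : ℂ := ![S.gam z, 1, S.gam z] j

/-- The scattering coefficients.  Since `Φ₊⁻¹ = C⁻¹ Φ̃₊ᵀ`, the matrix `A = Φ₊⁻¹ Φ₋` has the
entries `Cᵢ⁻¹ Φ̃₊,ᵢᵀ Φ₋,ⱼ`.  This formula also gives the extension of an entry to those
non-real `z` at which both columns exist. Indices start at `0`, so `a₁₁` is `S.a 0 0`. -/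
def a (i j : Fin 3) (z : ℂ) : ℂ :=
  (S.C i z)⁻¹ * (S.PhiPlusAdj i 0 0 z ⬝ᵥ S.PhiMinus j 0 0 z)

/-- The entries of `B = A⁻¹ = Φ₋⁻¹ Φ₊`, extended in the same way. -/
def b (i j : Fin 3) (z : ℂ) : ℂ :=
  (S.C i z)⁻¹ * (S.PhiMinusAdj i 0 0 z ⬝ᵥ S.PhiPlus j 0 0 z)

/-- The scattering matrix. -/
def A (z : ℂ) : Matrix (Fin 3) (Fin 3) ℂ := Matrix.of fun i j => S.a i j z

/-- The inverse scattering matrix. -/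
def B (z : ℂ) : Matrix (Fin 3) (Fin 3) ℂ := Matrix.of fun i j => S.b i j z

/-- Auxiliary eigenfunctions. -/
def chi1 (x t : ℝ) (z : ℂ) : Fin 3 → ℂ :=
  Complex.exp (Complex.I * S.theta2 x t z) •
    (crossProduct (S.PhiMinusAdj 1 x t z) (S.PhiPlusAdj 2 x t z))
def chi2 (x t : ℝ) (z : ℂ) : Fin 3 → ℂ :=
  Complex.exp (Complex.I * S.theta2 x t z) •
    (crossProduct (S.PhiPlusAdj 1 x t z) (S.PhiMinusAdj 2 x t z))
def chi3 (x t : ℝ) (z : ℂ) : Fin 3 → ℂ :=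
  Complex.exp (Complex.I * S.theta2 x t z) •
    (crossProduct (S.PhiMinusAdj 0 x t z) (S.PhiPlusAdj 1 x t z))
def chi4 (x t : ℝ) (z : ℂ) : Fin 3 → ℂ :=
  Complex.exp (Complex.I * S.theta2 x t z) •
    (crossProduct (S.PhiPlusAdj 0 x t z) (S.PhiMinusAdj 1 x t z))

/-- Modified auxiliary eigenfunctions. -/
def m1 (x t : ℝ) (z : ℂ) : Fin 3 → ℂ :=
  Complex.exp (-(Complex.I * S.theta1 x t z)) • S.chi1 x t z
def m2 (x t : ℝ) (z : ℂ) : Fin 3 → ℂ :=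
  Complex.exp (-(Complex.I * S.theta1 x t z)) • S.chi2 x t z
def m3 (x t : ℝ) (z : ℂ) : Fin 3 → ℂ :=
  Complex.exp (Complex.I * S.theta1 x t z) • S.chi3 x t z
def m4 (x t : ℝ) (z : ℂ) : Fin 3 → ℂ :=
  Complex.exp (Complex.I * S.theta1 x t z) • S.chi4 x t z

/-- The matrices `M₁, …, M₄`, used on `D₁, …, D₄` and their boundaries. -/
def M1 (x t : ℝ) (z : ℂ) : Matrix (Fin 3) (Fin 3) ℂ :=
  cols (-((S.b 1 1 z)⁻¹ • S.m1 x t z)) (S.muPlus 1 x t z) ((S.a 2 2 z)⁻¹ • S.muMinus 2 x t z)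
def M2 (x t : ℝ) (z : ℂ) : Matrix (Fin 3) (Fin 3) ℂ :=
  cols (-((S.b 2 2 z)⁻¹ • S.m2 x t z)) ((S.a 1 1 z)⁻¹ • S.muMinus 1 x t z) (S.muPlus 2 x t z)
def M3 (x t : ℝ) (z : ℂ) : Matrix (Fin 3) (Fin 3) ℂ :=
  cols (S.muPlus 0 x t z) ((S.a 1 1 z)⁻¹ • S.muMinus 1 x t z) (-((S.b 0 0 z)⁻¹ • S.m3 x t z))
def M4 (x t : ℝ) (z : ℂ) : Matrix (Fin 3) (Fin 3) ℂ :=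
  cols ((S.a 0 0 z)⁻¹ • S.muMinus 0 x t z) (S.muPlus 1 x t z) (-((S.b 1 1 z)⁻¹ • S.m4 x t z))

/-- Reflection coefficients. -/
def rho1 (z : ℂ) : ℂ := S.a 1 0 z / S.a 0 0 z
def rho2 (z : ℂ) : ℂ := S.a 2 0 z / S.a 0 0 z
def rho3 (z : ℂ) : ℂ := S.a 2 1 z / S.a 1 1 z

/-- `z / (i q₀)`. -/
def zq (z : ℂ) : ℂ := z / (Complex.I * S.q0)

/-- `i q₀ / z`. -/
def qz (z : ℂ) : ℂ := Complex.I * S.q0 / z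

/-- Entries of `L₁`. -/
def l1 (z : ℂ) : ℂ :=
  -star' S.rho2 (S.hat z)
    - z ^ 2 / (S.q0 : ℂ) ^ 2 * S.gam z * star' S.rho3 (S.hat z) * S.rho3 (S.hat z)
        * star' S.rho2 (S.hat z)
    + S.gam z * S.zq z * star' S.rho3 (S.hat z) * S.rho3 z
def l2 (z : ℂ) : ℂ :=
  S.zq z * S.rho3 (S.hat z) * star' S.rho2 (S.hat z) + S.rho3 z
def l3 (z : ℂ) : ℂ :=
  S.rho1 (S.hat z) * S.rho3 (S.hat z) * star' S.rho2 (S.hat z)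
    + S.qz z * S.rho1 (S.hat z) * S.rho3 z
    - S.rho2 (S.hat z) * star' S.rho2 (S.hat z)

/-- Entries of `L₃`. -/
def l4 (z : ℂ) : ℂ :=
  -(S.gam z * star' S.rho3 z * S.rho3 z) + S.zq z * S.rho3 (S.hat z) * S.rho1 z
    + S.zq z * S.rho3 (S.hat z) * S.gam z * star' S.rho3 z * S.rho2 z
def l5 (z : ℂ) : ℂ :=
  -(S.gam z * star' S.rho3 z) - star' S.rho2 z * S.rho1 z
    - S.gam z * star' S.rho2 z * S.rho2 z * star' S.rho3 z

/-- Combinations of reflection coefficients that vanish on the real axis. -/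
def l6 (z : ℂ) : ℂ :=
  S.rho1 z + S.gam z * star' S.rho3 z * S.rho2 z
    - S.zq z * S.gam z * star' S.rho3 (S.hat z)
def l7 (z : ℂ) : ℂ :=
  -(S.qz z * S.rho1 (S.hat z)) - S.gam z * star' S.rho3 z + S.rho1 z * S.rho2 (S.hat z)
    + S.gam z * star' S.rho3 z * S.rho2 (S.hat z) * S.rho2 z

/-- The matrices `L₁, …, L₄` of the jump conditions on `Σ₁, …, Σ₄`. -/
def L1 (z : ℂ) : Matrix (Fin 3) (Fin 3) ℂ :=
  !![-(z ^ 2 / (S.q0 : ℂ) ^ 2 * S.gam z * star' S.rho3 (S.hat z) * S.rho3 (S.hat z)),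
       S.zq z * S.rho3 (S.hat z),
       S.rho1 (S.hat z) * S.rho3 (S.hat z) - S.rho2 (S.hat z);
     -(S.zq z * S.gam z * star' S.rho3 (S.hat z)), 0, -(S.qz z * S.rho1 (S.hat z));
     S.l1 z, S.l2 z, S.l3 z]
def L2 (z : ℂ) : Matrix (Fin 3) (Fin 3) ℂ :=
  !![0, 0, star' S.rho2 z;
     0, 0, 0;
     -star' S.rho2 (S.hat z), 0, star' S.rho2 z * star' S.rho2 (S.hat z)]
def L3 (z : ℂ) : Matrix (Fin 3) (Fin 3) ℂ :=
  !![0, -(S.zq z * S.rho3 (S.hat z)), star' S.rho2 z;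
     S.rho1 z + S.gam z * S.rho2 z * star' S.rho3 z, S.l4 z, S.l5 z;
     S.rho2 z, S.zq z * S.rho3 (S.hat z) * S.rho2 z - S.rho3 z, -(star' S.rho2 z * S.rho2 z)]
def L4 (z : ℂ) : Matrix (Fin 3) (Fin 3) ℂ :=
  !![0, 0, -S.rho2 (S.hat z);
     0, 0, 0;
     S.rho2 z, 0, S.rho2 z * S.rho2 (S.hat z)]

/-- `e^{iθ}`. -/
def expTheta (x t : ℝ) (z : ℂ) : Matrix (Fin 3) (Fin 3) ℂ :=
  diagonal fun j => Complex.exp (Complex.I * S.theta j x t z)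

/-- `e^{-iθ}`. -/
def expNegTheta (x t : ℝ) (z : ℂ) : Matrix (Fin 3) (Fin 3) ℂ :=
  diagonal fun j => Complex.exp (-(Complex.I * S.theta j x t z))

/-- The jump matrix `I - e^{iθ} L e^{-iθ}`. -/
def jump (L : ℂ → Matrix (Fin 3) (Fin 3) ℂ) (x t : ℝ) (z : ℂ) : Matrix (Fin 3) (Fin 3) ℂ :=
  1 - S.expTheta x t z * L z * S.expNegTheta x t z

/-- `f` and `g` are analytic on `D` and neither vanishes identically there. -/
def GoodDenominators (f g : ℂ → ℂ) (D : Set ℂ) : Prop :=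
  AnalyticOnNhd ℂ f D ∧ AnalyticOnNhd ℂ g D ∧ (∃ z ∈ D, f z ≠ 0) ∧ ∃ z ∈ D, g z ≠ 0

/-- The function `M` built with the denominators `f` and `g` is meromorphic on `D`,
analytic wherever `f`, `g` do not vanish, and has the boundary value `M x t z` at every
regular boundary point `z` of `D` with `f z ≠ 0`, `g z ≠ 0`. -/
def SectionallyMeromorphic (M : ℝ → ℝ → ℂ → Matrix (Fin 3) (Fin 3) ℂ) (f g : ℂ → ℂ)
    (D : Set ℂ) : Prop :=
  ∀ x t,
    (∀ i j, MeromorphicOn (fun z => M x t z i j) D) ∧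
    (∀ i j, ∀ z ∈ D, f z ≠ 0 → g z ≠ 0 → AnalyticAt ℂ (fun z => M x t z i j) z) ∧
    ∀ z ∈ closure D, S.Regular z → f z ≠ 0 → g z ≠ 0 → Tendsto (M x t) (𝓝[D] z) (𝓝 (M x t z))

end NZBCSolution

end CMKdV

end

/-! The coupled mKdV equation is the zero-curvature condition `V_x = U_t + [U, V]`, so the two Lax
equations have simultaneous solutions with arbitrary value at the origin (`exists_lax_solution`,
`mder_V`). At each end `U` and `V` tend to constant matrices which `Γ±` diagonalises simultaneously,
with eigenvalues the derivatives of `iθ_j`. In the frame `Γ±⁻¹`, after division by the `j`-th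
exponential, the `x`-equation becomes a Volterra equation with an integrable kernel. Its propagators
are bounded exactly where the `j`-th exponential is the smallest at that end (`dom`), and these sets
contain the stated domains. A contraction in a weighted norm gives a solution continuous on `dom`
and holomorphic inside it; an energy estimate gives uniqueness. The solution at `t = 0` is then
extended in time by the Lax pair, and its asymptotics persist because the columns of `Γ±` are
eigenvectors of the limiting `V` (`exists_isPhi`).

The rest is algebra resting on uniqueness. The adjoint coefficients are minus the transposes of `U`
and `V`, so the pairing of an adjoint column with a column is constant in `x` and `t`; these
constants are the scattering coefficients. Since the traces of `U` and `V` are the derivatives of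
`iθ₂`, the factor `e^{iθ₂}` makes the cross product of two adjoint solutions a solution of the Lax
pair. Hence a middle adjoint column is a multiple of the cross product of two outer columns, and the
triple product formula writes each auxiliary function as a combination of two Jost columns
(`exp_cross_phiAdj`). The maps `z ↦ z̄` and `z ↦ ẑ` permute the Jost columns, which turns every
entry of the `L_j` into ratios of scattering coefficients at the single point `z`. The jump
conditions are then changes of basis: among all six columns on the real axis, and among the few that
survive on the circular arcs.

Denominators are shown not to vanish identically through their limits along the imaginary axis at
infinity. The Volterra equation extends continuously to `z = ∞`, where the fast propagators are set
to zero and the perturbation couples only the two blocks, so the columns tend to those of `Γ±(∞)`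
(`tendsto_mu_ray`). The limit of `b₂₂` is a phase because `𝐪₊` and `𝐪₋` are parallel, that of `a₃₃`
is one, and the two symmetries carry nonvanishing to the other denominators. -/

noncomputable section

/-! ### Volterra equations depending holomorphically on a parameter -/

namespace CMKdV

/-- A parametric integral of holomorphic functions with an integrable bound is holomorphic. -/
theorem differentiableOn_integral_of_bound {α : Type*} [MeasurableSpace α] {μ : Measure α}
    {F : ℂ → α → ℂ} {D : Set ℂ} (hD : IsOpen D) {b : α → ℝ} (hb : Integrable b μ)
    (hm : ∀ z ∈ D, AEStronglyMeasurable (F z) μ)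
    (hbd : ∀ z ∈ D, ∀ y, ‖F z y‖ ≤ b y)
    (hd : ∀ y, DifferentiableOn ℂ (fun z => F z y) D) :
    DifferentiableOn ℂ (fun z => ∫ y, F z y ∂μ) D := by
  intro z₀ hz₀
  obtain ⟨r, hr, hrD⟩ := Metric.isOpen_iff.1 hD z₀ hz₀
  have hr2 : (0 : ℝ) < r / 2 := by positivity
  have hderiv : ∀ y, ∀ z ∈ D, HasDerivAt (fun z => F z y) (deriv (fun z => F z y) z) z :=
    fun y z hz => ((hd y z hz).differentiableAt (hD.mem_nhds hz)).hasDerivAt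
  have hsub : ∀ z ∈ Metric.ball z₀ (r / 2), Metric.closedBall z (r / 4) ⊆ D := by
    intro z hz w hw
    apply hrD
    rw [Metric.mem_ball] at hz ⊢
    rw [Metric.mem_closedBall] at hw
    linarith [dist_triangle w z z₀]
  have hmeas' : AEStronglyMeasurable (fun y => deriv (fun z => F z y) z₀) μ := by
    -- The derivative is measurable in `y` as a pointwise limit of difference quotients; the
    -- increments `r / 2 / (n + 1)` keep the points inside `D`.
    have hseq : Tendsto (fun n : ℕ => z₀ + ((r / 2 / ((n : ℝ) + 1) : ℝ) : ℂ)) atTop (𝓝[≠] z₀) := by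
      refine tendsto_nhdsWithin_iff.2 ⟨?_, Eventually.of_forall fun n => ?_⟩
      · have h : Tendsto (fun n : ℕ => (r / 2 / ((n : ℝ) + 1) : ℝ)) atTop (𝓝 0) := by
          have := (tendsto_one_div_add_atTop_nhds_zero_nat (𝕜 := ℝ)).const_mul (r / 2)
          simpa [div_eq_mul_inv] using this
        have h2 := (Complex.continuous_ofReal.tendsto 0).comp h
        simpa using h2.const_add z₀
      · have h0 : (r / 2 / ((n : ℝ) + 1) : ℝ) ≠ 0 := by positivity
        have h1 : ((r / 2 / ((n : ℝ) + 1) : ℝ) : ℂ) ≠ 0 := Complex.ofReal_ne_zero.2 h0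
        exact fun h => h1 (by simpa using h)
    refine aestronglyMeasurable_of_tendsto_ae (u := atTop)
      (f := fun (n : ℕ) y => slope (fun z => F z y) z₀ (z₀ + ((r / 2 / ((n : ℝ) + 1) : ℝ) : ℂ)))
      (fun n => ?_) (Eventually.of_forall fun y => ?_)
    · have hmem : z₀ + ((r / 2 / ((n : ℝ) + 1) : ℝ) : ℂ) ∈ D := by
        apply hrD
        rw [Metric.mem_ball, dist_eq_norm]
        have h0 : (0 : ℝ) < r / 2 / ((n : ℝ) + 1) := by positivity
        have h1 : r / 2 / ((n : ℝ) + 1) ≤ r / 2 :=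
          div_le_self hr2.le (by linarith [Nat.cast_nonneg (α := ℝ) n])
        simp only [add_sub_cancel_left]
        rw [Complex.norm_real, Real.norm_of_nonneg h0.le]
        linarith
      simp only [slope_def_field]
      simp only [div_eq_mul_inv]
      exact ((hm _ hmem).sub (hm _ hz₀)).mul_const _
    · exact ((hasDerivAt_iff_tendsto_slope.1 (hderiv y z₀ hz₀))).comp hseq
  -- The dominating function for the derivative is Cauchy's estimate on circles of radius `r / 4`,
  -- which stay in `D` for centres within `r / 2` of `z₀`.
  have := hasDerivAt_integral_of_dominated_loc_of_deriv_le (μ := μ) (F := F)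
    (F' := fun z y => deriv (fun z => F z y) z) (bound := fun y => b y / (r / 4))
    (Metric.ball_mem_nhds z₀ hr2)
    (Filter.eventually_of_mem (hD.mem_nhds hz₀) hm)
    (hb.mono' (hm z₀ hz₀) (Eventually.of_forall (hbd z₀ hz₀))) hmeas'
    (Eventually.of_forall fun y z hz => by
      refine Complex.norm_deriv_le_of_forall_mem_sphere_norm_le (by positivity) ?_ ?_
      · refine ((hd y).mono ?_).diffContOnCl
        exact (Metric.closure_ball_subset_closedBall).trans (hsub z hz)
      · exact fun w hw => hbd w (hsub z hz (Metric.sphere_subset_closedBall hw)) y)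
    (hb.div_const _)
    (Eventually.of_forall fun y z hz =>
      hderiv y z (hsub z hz (Metric.mem_closedBall_self (by positivity))))
  exact this.2.differentiableAt.differentiableWithinAt

/-- Data of a linear Volterra-type equation `u(x,z) = ξ + ∫ K(x,y,z) u(y,z) dy` with a
weight `w` for which the integral operator is a contraction with factor `1/2`. -/
structure VolterraKernel (n : ℕ) where
  K : ℝ → ℝ → ℂ → Matrix (Fin n) (Fin n) ℂ
  k : ℝ → ℝ → ℝ
  w : ℝ → ℝ
  W : Set ℂ
  D : Set ℂ
  isOpen_D : IsOpen D
  D_subset : D ⊆ W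
  w_cont : Continuous w
  w_pos : ∀ x, 0 < w x
  k_nonneg : ∀ x y, 0 ≤ k x y
  bound : ∀ x y, ∀ z ∈ W, ∀ v, ‖K x y z *ᵥ v‖ ≤ k x y * ‖v‖
  meas : ∀ x, ∀ z ∈ W, ∀ i j, AEStronglyMeasurable (fun y => K x y z i j)
  int : ∀ x, Integrable (fun y => k x y * w y)
  int_le : ∀ x, ∫ y, k x y * w y ≤ w x / 2
  dom : ∀ x₀, ∃ b : ℝ → ℝ, Integrable b ∧ ∀ᶠ x in 𝓝 x₀, ∀ y, k x y * w y ≤ b y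
  cont : ∀ x₀, ∀ z₀ ∈ W, ∀ᵐ y, ∀ i j,
    ContinuousWithinAt (fun p : ℝ × ℂ => K p.1 y p.2 i j) (Set.univ ×ˢ W) (x₀, z₀)
  diff : ∀ x y i j, DifferentiableOn ℂ (fun z => K x y z i j) D

namespace VolterraKernel

variable {n : ℕ} (V : VolterraKernel n)

/-- The integral operator. -/
def op (f : ℝ → ℂ → Fin n → ℂ) (x : ℝ) (z : ℂ) : Fin n → ℂ :=
  fun i => ∫ y, (V.K x y z *ᵥ f y z) i

/-- Admissible functions: jointly continuous, bounded by `C w`, holomorphic in the parameter. -/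
structure Adm (f : ℝ → ℂ → Fin n → ℂ) (C : ℝ) : Prop where
  cont : ContinuousOn (fun p : ℝ × ℂ => f p.1 p.2) (Set.univ ×ˢ V.W)
  bound : ∀ x, ∀ z ∈ V.W, ‖f x z‖ ≤ C * V.w x
  diff : ∀ x, DifferentiableOn ℂ (f x) V.D

variable {V} {f g : ℝ → ℂ → Fin n → ℂ} {C C' : ℝ}

theorem Adm.continuous_x (hf : V.Adm f C) {z : ℂ} (hz : z ∈ V.W) : Continuous fun x => f x z := by
  rw [← continuousOn_univ]
  exact hf.cont.comp (f := fun x : ℝ => (x, z)) (by fun_prop) (fun x _ => ⟨trivial, hz⟩)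

theorem Adm.nonneg (hf : V.Adm f C) {z : ℂ} (hz : z ∈ V.W) : 0 ≤ C := by
  by_contra h
  have := (norm_nonneg _).trans (hf.bound 0 z hz)
  nlinarith [V.w_pos 0]

theorem Adm.meas (hf : V.Adm f C) {z : ℂ} (hz : z ∈ V.W) (x : ℝ) (i : Fin n) :
    AEStronglyMeasurable (fun y => (V.K x y z *ᵥ f y z) i) := by
  simp only [mulVec, dotProduct]
  refine Finset.aestronglyMeasurable_fun_sum _ fun j _ => ?_
  exact (V.meas x z hz i j).mul
    ((continuous_apply j).comp (hf.continuous_x hz)).aestronglyMeasurable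

theorem Adm.norm_le (hf : V.Adm f C) {z : ℂ} (hz : z ∈ V.W) (x y : ℝ) (i : Fin n) :
    ‖(V.K x y z *ᵥ f y z) i‖ ≤ C * (V.k x y * V.w y) := by
  refine (norm_le_pi_norm _ i).trans ((V.bound x y z hz _).trans ?_)
  have := mul_le_mul_of_nonneg_left (hf.bound y z hz) (V.k_nonneg x y)
  linarith

theorem Adm.integrable (hf : V.Adm f C) {z : ℂ} (hz : z ∈ V.W) (x : ℝ) (i : Fin n) :
    Integrable (fun y => (V.K x y z *ᵥ f y z) i) :=
  ((V.int x).const_mul C).mono' (hf.meas hz x i) (Eventually.of_forall fun y => hf.norm_le hz x y i)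

theorem Adm.op_bound (hf : V.Adm f C) {z : ℂ} (hz : z ∈ V.W) (x : ℝ) :
    ‖V.op f x z‖ ≤ C / 2 * V.w x := by
  have hC := hf.nonneg hz
  refine (pi_norm_le_iff_of_nonneg (mul_nonneg (by positivity) (V.w_pos x).le)).2 fun i => ?_
  refine (norm_integral_le_of_norm_le ((V.int x).const_mul C)
    (Eventually.of_forall fun y => hf.norm_le hz x y i)).trans ?_
  rw [integral_const_mul]
  nlinarith [mul_le_mul_of_nonneg_left (V.int_le x) hC]

/-- The halved constant is the contraction. Continuity is dominated convergence with a bound that is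
only local in `x`; holomorphy is the theorem on parametric integrals. -/
theorem Adm.op (hf : V.Adm f C) : V.Adm (V.op f) (C / 2) where
  cont := by
    rintro ⟨x₀, z₀⟩ ⟨-, hz₀⟩
    refine continuousWithinAt_pi.2 fun i => ?_
    obtain ⟨b, hb, hdom⟩ := V.dom x₀
    have hev : ∀ᶠ p : ℝ × ℂ in 𝓝[Set.univ ×ˢ V.W] (x₀, z₀), p.2 ∈ V.W :=
      eventually_nhdsWithin_of_forall fun p hp => hp.2
    have hev2 : ∀ᶠ p : ℝ × ℂ in 𝓝[Set.univ ×ˢ V.W] (x₀, z₀), ∀ y, V.k p.1 y * V.w y ≤ b y :=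
      (continuous_fst.tendsto (x₀, z₀)).eventually hdom |>.filter_mono nhdsWithin_le_nhds
    refine continuousWithinAt_of_dominated (bound := fun y => C * b y) ?_ ?_ (hb.const_mul C) ?_
    · exact hev.mono fun p hp => hf.meas hp p.1 i
    · filter_upwards [hev, hev2] with p hp hp2
      exact Eventually.of_forall fun y => (hf.norm_le hp p.1 y i).trans
        (mul_le_mul_of_nonneg_left (hp2 y) (hf.nonneg hp))
    · filter_upwards [V.cont x₀ z₀ hz₀] with y hy
      simp only [mulVec, dotProduct]
      refine tendsto_finsetSum _ fun j _ => Tendsto.mul (hy i j) ?_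
      have h1 : ContinuousOn (fun p : ℝ × ℂ => f y p.2) (Set.univ ×ˢ V.W) :=
        hf.cont.comp (f := fun p : ℝ × ℂ => (y, p.2)) (by fun_prop) (fun p hp => ⟨trivial, hp.2⟩)
      exact (continuousWithinAt_pi.1 (h1 (x₀, z₀) ⟨trivial, hz₀⟩)) j
  bound := fun x z hz => hf.op_bound hz x
  diff := by
    intro x
    refine differentiableOn_pi.2 fun i => ?_
    refine differentiableOn_integral_of_bound V.isOpen_D ((V.int x).const_mul C)
      (fun z hz => hf.meas (V.D_subset hz) x i) (fun z hz y => hf.norm_le (V.D_subset hz) x y i) ?_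
    intro y
    simp only [mulVec, dotProduct]
    exact DifferentiableOn.fun_sum fun j _ =>
      (V.diff x y i j).mul (differentiableOn_pi.1 (hf.diff y) j)

theorem Adm.sub (hf : V.Adm f C) (hg : V.Adm g C') : V.Adm (f - g) (C + C') where
  cont := hf.cont.sub hg.cont
  bound := fun x z hz => (norm_sub_le _ _).trans (by
    rw [add_mul]; exact add_le_add (hf.bound x z hz) (hg.bound x z hz))
  diff := fun x => (hf.diff x).sub (hg.diff x)

theorem Adm.op_sub (hf : V.Adm f C) (hg : V.Adm g C') {z : ℂ} (hz : z ∈ V.W) (x : ℝ) :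
    V.op f x z - V.op g x z = V.op (f - g) x z := by
  ext i
  simp only [VolterraKernel.op, Pi.sub_apply]
  rw [← integral_sub (hf.integrable hz x i) (hg.integrable hz x i)]
  simp [mulVec_sub]

/-- A difference of iterates comes with the crude constant `C + C'`; this installs its true
geometric bound before the operator is applied again. -/
theorem Adm.mono (hf : V.Adm f C) (h : ∀ x, ∀ z ∈ V.W, ‖f x z‖ ≤ C' * V.w x) : V.Adm f C' :=
  ⟨hf.cont, h, hf.diff⟩

variable (V)

/-- Successive approximations. -/
def iter (ξ : Fin n → ℂ) : ℕ → ℝ → ℂ → Fin n → ℂ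
  | 0 => fun _ _ => ξ
  | m + 1 => fun x z => ξ + V.op (iter ξ m) x z

variable {V}

/-- Neumann series: successive differences are halved in the weighted norm, so the iterates converge
geometrically, locally uniformly in `x` and uniformly in the parameter, and both continuity and
holomorphy survive. The condition `1 ≤ w` lets the constant `ξ` serve as starting point with
constant `‖ξ‖`. -/
theorem exists_solution (hw : ∀ x, 1 ≤ V.w x) (ξ : Fin n → ℂ) :
    ∃ u, V.Adm u (2 * ‖ξ‖) ∧ ∀ x, ∀ z ∈ V.W, u x z = ξ + V.op u x z := by
  have hadm0 : V.Adm (fun _ _ => ξ) ‖ξ‖ :=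
    ⟨continuousOn_const, fun x z _ => le_mul_of_one_le_right (norm_nonneg _) (hw x),
      fun x => differentiableOn_const _⟩
  -- The constant `2 * ‖ξ‖` is the fixed point of `C ↦ ‖ξ‖ + C / 2`.
  have hadm : ∀ m, V.Adm (V.iter ξ m) (2 * ‖ξ‖) := by
    intro m
    induction m with
    | zero =>
      refine hadm0.mono fun x z hz => ?_
      have h1 := hadm0.bound x z hz
      have h2 := mul_nonneg (norm_nonneg ξ) (V.w_pos x).le
      linarith
    | succ m ih =>
      refine ⟨hadm0.cont.add ih.op.cont, fun x z hz => ?_, fun x => (hadm0.diff x).add (ih.op.diff x)⟩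
      have h1 := hadm0.bound x z hz
      have h2 := ih.op_bound hz x
      refine (norm_add_le _ _).trans ?_
      linarith
  have hdiff : ∀ m, ∀ x, ∀ z ∈ V.W,
      ‖V.iter ξ (m + 1) x z - V.iter ξ m x z‖ ≤ ‖ξ‖ / 2 / 2 ^ m * V.w x := by
    intro m
    induction m with
    | zero =>
      intro x z hz
      simpa [iter] using hadm0.op_bound hz x
    | succ m ih =>
      intro x z hz
      have h := (((hadm (m + 1)).sub (hadm m)).mono ih).op_bound hz x
      have e : V.iter ξ (m + 1 + 1) x z - V.iter ξ (m + 1) x z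
          = V.op (V.iter ξ (m + 1) - V.iter ξ m) x z := by
        rw [← (hadm (m + 1)).op_sub (hadm m) hz x]
        simp [iter]
      rw [e]
      refine h.trans (le_of_eq ?_)
      rw [pow_succ]
      field_simp
  have hcau : ∀ x, ∀ z ∈ V.W, ∀ m, dist (V.iter ξ m x z) (V.iter ξ (m + 1) x z)
      ≤ ‖ξ‖ * V.w x / 2 / 2 ^ m := by
    intro x z hz m
    rw [dist_comm, dist_eq_norm]
    exact (hdiff m x z hz).trans (le_of_eq (by ring))
  have hlim : ∀ x z, ∃ l, z ∈ V.W → Tendsto (fun m => V.iter ξ m x z) atTop (𝓝 l) := by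
    intro x z
    by_cases hz : z ∈ V.W
    · obtain ⟨l, hl⟩ := cauchySeq_tendsto_of_complete (cauchySeq_of_le_geometric_two (hcau x z hz))
      exact ⟨l, fun _ => hl⟩
    · exact ⟨0, fun h => absurd h hz⟩
  choose u hu using hlim
  have herr : ∀ x, ∀ z ∈ V.W, ∀ m, ‖V.iter ξ m x z - u x z‖ ≤ ‖ξ‖ * V.w x / 2 ^ m := by
    intro x z hz m
    rw [← dist_eq_norm]
    exact dist_le_of_le_geometric_two_of_tendsto (hcau x z hz) (hu x z hz) m
  have hpow : Tendsto (fun m : ℕ => ((1 : ℝ) / 2) ^ m) atTop (𝓝 0) :=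
    tendsto_pow_atTop_nhds_zero_of_lt_one (by norm_num) (by norm_num)
  have hAdm : V.Adm u (2 * ‖ξ‖) := by
    refine ⟨?_, fun x z hz => ?_, fun x => ?_⟩
    · refine TendstoLocallyUniformlyOn.continuousOn (F := fun m (p : ℝ × ℂ) => V.iter ξ m p.1 p.2)
        (p := atTop) ?_ (Eventually.of_forall fun m => (hadm m).cont).frequently
      rw [Metric.tendstoLocallyUniformlyOn_iff]
      rintro ε hε ⟨x₀, z₀⟩ ⟨-, hz₀⟩
      have hwx : ∀ᶠ x in 𝓝 x₀, V.w x < V.w x₀ + 1 :=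
        V.w_cont.continuousAt.eventually_lt_const (by linarith)
      have h1 : Tendsto (fun m : ℕ => ‖ξ‖ * (V.w x₀ + 1) * ((1 : ℝ) / 2) ^ m) atTop (𝓝 0) := by
        simpa using hpow.const_mul (‖ξ‖ * (V.w x₀ + 1))
      -- The error bound carries the weight, which is bounded near `x₀` but need not be bounded
      -- globally.
      refine ⟨{p | V.w p.1 < V.w x₀ + 1} ∩ (Set.univ ×ˢ V.W), ?_, ?_⟩
      · exact Filter.inter_mem (mem_nhdsWithin_of_mem_nhds
          ((continuous_fst.tendsto (x₀, z₀)).eventually hwx)) self_mem_nhdsWithin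
      · filter_upwards [h1.eventually_lt_const hε] with m hm
        rintro ⟨x, z⟩ ⟨hx, -, hz⟩
        rw [dist_comm, dist_eq_norm]
        refine lt_of_le_of_lt (herr x z hz m) (lt_of_le_of_lt ?_ hm)
        rw [div_pow, one_pow, mul_one_div]
        gcongr
        exact hx.le
    · exact le_of_tendsto (hu x z hz).norm (Eventually.of_forall fun m => (hadm m).bound x z hz)
    · refine TendstoLocallyUniformlyOn.differentiableOn (F := fun m z => V.iter ξ m x z)
        (φ := atTop) (TendstoUniformlyOn.tendstoLocallyUniformlyOn ?_)
        (Eventually.of_forall fun m => (hadm m).diff x) V.isOpen_D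
      rw [Metric.tendstoUniformlyOn_iff]
      intro ε hε
      have h1 : Tendsto (fun m : ℕ => ‖ξ‖ * V.w x * ((1 : ℝ) / 2) ^ m) atTop (𝓝 0) := by
        simpa using hpow.const_mul (‖ξ‖ * V.w x)
      filter_upwards [h1.eventually_lt_const hε] with m hm z hz
      rw [dist_comm, dist_eq_norm]
      refine lt_of_le_of_lt (herr x z (V.D_subset hz) m) (lt_of_le_of_lt (le_of_eq ?_) hm)
      rw [div_pow, one_pow, mul_one_div]
  refine ⟨u, hAdm, fun x z hz => ?_⟩
  have h2 : Tendsto (fun m => V.iter ξ (m + 1) x z) atTop (𝓝 (ξ + V.op u x z)) := by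
    rw [tendsto_iff_norm_sub_tendsto_zero]
    have h1 : Tendsto (fun m : ℕ => ‖ξ‖ / 2 * V.w x * ((1 : ℝ) / 2) ^ m) atTop (𝓝 0) := by
      simpa using hpow.const_mul (‖ξ‖ / 2 * V.w x)
    refine squeeze_zero (fun _ => norm_nonneg _) (fun m => ?_) h1
    have e : V.iter ξ (m + 1) x z - (ξ + V.op u x z) = V.op (V.iter ξ m - u) x z := by
      rw [← (hadm m).op_sub hAdm hz x]
      simp [iter]
    have hb := (((hadm m).sub hAdm).mono (C' := ‖ξ‖ / 2 ^ m)
      fun x z hz => (herr x z hz m).trans (le_of_eq (by ring))).op_bound hz x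
    rw [e]
    refine hb.trans (le_of_eq ?_)
    rw [div_pow, one_pow]
    ring
  exact tendsto_nhds_unique ((tendsto_add_atTop_iff_nat 1).2 (hu x z hz)) h2

end VolterraKernel

end CMKdV

/-! ### Volterra equations on a half-line with integrable coefficient -/

namespace CMKdV

variable {n : ℕ}

/-- The sum of the absolute values of the entries. -/
def mnorm (M : Matrix (Fin n) (Fin n) ℂ) : ℝ := ∑ i, ∑ j, ‖M i j‖

theorem mnorm_nonneg (M : Matrix (Fin n) (Fin n) ℂ) : 0 ≤ mnorm M :=
  Finset.sum_nonneg fun _ _ => Finset.sum_nonneg fun _ _ => norm_nonneg _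

theorem norm_mulVec_le (M : Matrix (Fin n) (Fin n) ℂ) (v : Fin n → ℂ) :
    ‖M *ᵥ v‖ ≤ mnorm M * ‖v‖ := by
  refine (pi_norm_le_iff_of_nonneg (mul_nonneg (mnorm_nonneg M) (norm_nonneg v))).2 fun i => ?_
  have h1 : ‖(M *ᵥ v) i‖ ≤ (∑ j, ‖M i j‖) * ‖v‖ := by
    rw [Finset.sum_mul]
    have h : ∀ j ∈ Finset.univ, ‖M i j * v j‖ ≤ ‖M i j‖ * ‖v‖ := fun j _ => by
      rw [norm_mul]
      exact mul_le_mul_of_nonneg_left (norm_le_pi_norm v j) (norm_nonneg _)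
    exact (norm_sum_le _ _).trans (Finset.sum_le_sum h)
  refine h1.trans (mul_le_mul_of_nonneg_right ?_ (norm_nonneg v))
  exact Finset.single_le_sum (f := fun i => ∑ j, ‖M i j‖)
    (fun i _ => Finset.sum_nonneg fun _ _ => norm_nonneg _) (Finset.mem_univ i)

theorem mnorm_mul_le (M N : Matrix (Fin n) (Fin n) ℂ) : mnorm (M * N) ≤ mnorm M * mnorm N := by
  unfold mnorm
  rw [Finset.sum_mul]
  refine Finset.sum_le_sum fun i _ => ?_
  calc ∑ j, ‖(M * N) i j‖ ≤ ∑ j, ∑ k, ‖M i k‖ * ‖N k j‖ := by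
        refine Finset.sum_le_sum fun j _ => ?_
        rw [Matrix.mul_apply]
        exact (norm_sum_le _ _).trans (le_of_eq (by simp))
    _ = ∑ k, ‖M i k‖ * ∑ j, ‖N k j‖ := by
        rw [Finset.sum_comm]
        simp [Finset.mul_sum]
    _ ≤ (∑ k, ‖M i k‖) * ∑ k, ∑ j, ‖N k j‖ := by
        rw [Finset.sum_mul]
        refine Finset.sum_le_sum fun k _ => mul_le_mul_of_nonneg_left ?_ (norm_nonneg _)
        exact Finset.single_le_sum (f := fun k => ∑ j, ‖N k j‖)
          (fun i _ => Finset.sum_nonneg fun _ _ => norm_nonneg _) (Finset.mem_univ k)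

/-- A continuous nonnegative function that is integrable at `+∞`. -/
structure TailIntegrable (g : ℝ → ℝ) : Prop where
  cont : Continuous g
  nonneg : ∀ x, 0 ≤ g x
  int : ∀ a, IntegrableOn g (Set.Ioi a)

/-- The tail integral. -/
def tail (g : ℝ → ℝ) (x : ℝ) : ℝ := ∫ y in Set.Ioi x, g y

namespace TailIntegrable

variable {g : ℝ → ℝ}

theorem const_mul (hg : TailIntegrable g) {c : ℝ} (hc : 0 ≤ c) :
    TailIntegrable fun x => c * g x :=
  ⟨hg.cont.const_mul c, fun x => mul_nonneg hc (hg.nonneg x), fun a => (hg.int a).const_mul c⟩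

theorem tail_eq (hg : TailIntegrable g) (x : ℝ) : tail g x = tail g 0 - ∫ y in (0:ℝ)..x, g y := by
  have := intervalIntegral.integral_interval_add_Ioi (hg.int 0) (hg.int x)
  unfold tail
  linarith

theorem tail_nonneg (hg : TailIntegrable g) (x : ℝ) : 0 ≤ tail g x :=
  setIntegral_nonneg measurableSet_Ioi fun y _ => hg.nonneg y

theorem hasDerivAt_tail (hg : TailIntegrable g) (x : ℝ) : HasDerivAt (tail g) (-g x) x := by
  have h : HasDerivAt (fun x => ∫ y in (0:ℝ)..x, g y) (g x) x :=
    intervalIntegral.integral_hasDerivAt_right (hg.cont.intervalIntegrable _ _)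
      (hg.cont.stronglyMeasurableAtFilter _ _) hg.cont.continuousAt
  have h2 := (hasDerivAt_const x (tail g 0)).sub h
  rw [zero_sub] at h2
  exact h2.congr_of_eventuallyEq (Eventually.of_forall fun y => hg.tail_eq y)

theorem tendsto_tail (hg : TailIntegrable g) : Tendsto (tail g) atTop (𝓝 0) := by
  have h := intervalIntegral_tendsto_integral_Ioi 0 (hg.int 0) tendsto_id
  have h2 : Tendsto (fun x => tail g 0 - ∫ y in (0:ℝ)..x, g y) atTop (𝓝 (tail g 0 - tail g 0)) :=
    tendsto_const_nhds.sub h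
  rw [sub_self] at h2
  exact h2.congr fun x => (hg.tail_eq x).symm

/-- The weight `exp (2 ∫_x^∞ g)`. -/
def weight (g : ℝ → ℝ) (x : ℝ) : ℝ := Real.exp (2 * tail g x)

/-- The weight makes `g * weight g` an exact derivative, with tail integral `(weight - 1) / 2`. The
factor `2` in its exponent is what yields the contraction factor `1/2`. -/
theorem hasDerivAt_weight (hg : TailIntegrable g) (x : ℝ) :
    HasDerivAt (fun x => -(weight g x) / 2) (g x * weight g x) x := by
  have h := (((hg.hasDerivAt_tail x).const_mul 2).exp.neg).div_const 2
  refine h.congr_deriv ?_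
  unfold weight
  ring

theorem tendsto_weight (hg : TailIntegrable g) : Tendsto (weight g) atTop (𝓝 1) := by
  have h := (Real.continuous_exp.tendsto _).comp (hg.tendsto_tail.const_mul 2)
  rw [mul_zero, Real.exp_zero] at h
  exact h

theorem integrableOn_weight (hg : TailIntegrable g) (x : ℝ) :
    IntegrableOn (fun y => g y * weight g y) (Set.Ioi x) :=
  integrableOn_Ioi_deriv_of_nonneg' (fun y _ => hg.hasDerivAt_weight y)
    (fun y _ => mul_nonneg (hg.nonneg y) (Real.exp_pos _).le) ((hg.tendsto_weight.neg).div_const 2)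

theorem integral_weight (hg : TailIntegrable g) (x : ℝ) :
    ∫ y in Set.Ioi x, g y * weight g y = (weight g x - 1) / 2 := by
  rw [integral_Ioi_of_hasDerivAt_of_tendsto' (fun y _ => hg.hasDerivAt_weight y)
    (hg.integrableOn_weight x) ((hg.tendsto_weight.neg).div_const 2)]
  ring

theorem one_le_weight (hg : TailIntegrable g) (x : ℝ) : 1 ≤ weight g x :=
  Real.one_le_exp (by linarith [hg.tail_nonneg x])

theorem continuous_weight (hg : TailIntegrable g) : Continuous (weight g) := by
  have h : Continuous (tail g) :=
    continuous_iff_continuousAt.2 fun x => (hg.hasDerivAt_tail x).continuousAt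
  unfold weight
  fun_prop

end TailIntegrable

/-- Data of the integral equation `u(x) = ξ - ∫_x^∞ e(x-y) B(y) u(y) dy` with a diagonal
propagator `e` that is bounded by one for negative arguments. -/
structure TailKernel (n : ℕ) where
  g : ℝ → ℝ
  e : Fin n → ℝ → ℂ → ℂ
  B : ℝ → ℂ → Matrix (Fin n) (Fin n) ℂ
  W : Set ℂ
  D : Set ℂ
  isOpen_D : IsOpen D
  D_subset : D ⊆ W
  hg : TailIntegrable g
  e_le : ∀ l s, s < 0 → ∀ z ∈ W, ‖e l s z‖ ≤ 1
  e_cont : ∀ l s, s < 0 → ∀ z ∈ W,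
    ContinuousWithinAt (fun p : ℝ × ℂ => e l p.1 p.2) (Set.univ ×ˢ W) (s, z)
  e_diff : ∀ l s, DifferentiableOn ℂ (e l s) D
  B_le : ∀ y, ∀ z ∈ W, ∀ v, ‖B y z *ᵥ v‖ ≤ g y * ‖v‖
  B_cont : ∀ z ∈ W, ∀ i j, Continuous fun y => B y z i j
  B_contOn : ∀ y i j, ContinuousOn (fun z => B y z i j) W
  B_diff : ∀ y i j, DifferentiableOn ℂ (fun z => B y z i j) D

namespace TailKernel

variable (T : TailKernel n)

theorem mulVec_apply (x y : ℝ) (z : ℂ) (v : Fin n → ℂ) (i : Fin n) :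
    ((-(diagonal (fun l => T.e l (x - y) z) * T.B y z)) *ᵥ v) i
      = -(T.e i (x - y) z * (T.B y z *ᵥ v) i) := by
  rw [neg_mulVec, ← mulVec_mulVec, Pi.neg_apply, mulVec_diagonal]

open Classical in
/-- The associated Volterra kernel. -/
def toVolterra : VolterraKernel n where
  K x y z := if x < y then -(diagonal (fun l => T.e l (x - y) z) * T.B y z) else 0
  k x y := if x < y then T.g y else 0
  w := TailIntegrable.weight T.g
  W := T.W
  D := T.D
  isOpen_D := T.isOpen_D
  D_subset := T.D_subset
  w_cont := T.hg.continuous_weight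
  w_pos := fun x => Real.exp_pos _
  k_nonneg := fun x y => by split_ifs; exacts [T.hg.nonneg y, le_rfl]
  bound := fun x y z hz v => by
    split_ifs with h
    · refine (pi_norm_le_iff_of_nonneg (mul_nonneg (T.hg.nonneg y) (norm_nonneg v))).2 fun i => ?_
      rw [T.mulVec_apply, norm_neg, norm_mul]
      refine (mul_le_of_le_one_left (norm_nonneg _) (T.e_le i _ (by linarith) z hz)).trans ?_
      exact (norm_le_pi_norm _ i).trans (T.B_le y z hz v)
    · simp
  meas := fun x z hz i j => by
    have h : (fun y => (if x < y then -(diagonal (fun l => T.e l (x - y) z) * T.B y z) else 0) i j)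
        = Set.indicator (Set.Ioi x) (fun y => -(T.e i (x - y) z * T.B y z i j)) := by
      ext y
      simp only [Set.indicator_apply, Set.mem_Ioi]
      split_ifs <;> simp [diagonal_mul]
    rw [h]
    rw [aestronglyMeasurable_indicator_iff measurableSet_Ioi]
    refine ContinuousOn.aestronglyMeasurable ?_ measurableSet_Ioi
    refine ContinuousOn.neg (ContinuousOn.mul ?_ (T.B_cont z hz i j).continuousOn)
    intro y hy
    have hmap : Tendsto (fun y : ℝ => (x - y, z)) (𝓝[Set.Ioi x] y)
        (𝓝[Set.univ ×ˢ T.W] (x - y, z)) :=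
      tendsto_nhdsWithin_iff.2 ⟨(Continuous.tendsto (by fun_prop) y).mono_left nhdsWithin_le_nhds,
        Eventually.of_forall fun p => ⟨trivial, hz⟩⟩
    exact Tendsto.comp (T.e_cont i (x - y) (by linarith [Set.mem_Ioi.1 hy]) z hz) hmap
  int := fun x => by
    have h : (fun y => (if x < y then T.g y else 0) * TailIntegrable.weight T.g y)
        = Set.indicator (Set.Ioi x) (fun y => T.g y * TailIntegrable.weight T.g y) := by
      ext y
      simp only [Set.indicator_apply, Set.mem_Ioi]
      split_ifs <;> simp
    rw [h]
    exact (T.hg.integrableOn_weight x).integrable_indicator measurableSet_Ioi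
  int_le := fun x => by
    have h : (fun y => (if x < y then T.g y else 0) * TailIntegrable.weight T.g y)
        = Set.indicator (Set.Ioi x) (fun y => T.g y * TailIntegrable.weight T.g y) := by
      ext y
      simp only [Set.indicator_apply, Set.mem_Ioi]
      split_ifs <;> simp
    rw [h, integral_indicator measurableSet_Ioi, T.hg.integral_weight]
    linarith
  dom := fun x₀ => by
    refine ⟨_, (T.hg.integrableOn_weight (x₀ - 1)).integrable_indicator measurableSet_Ioi, ?_⟩
    filter_upwards [lt_mem_nhds (show x₀ - 1 < x₀ by linarith)] with x hx y
    have h0 : 0 ≤ T.g y * TailIntegrable.weight T.g y :=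
      mul_nonneg (T.hg.nonneg y) (Real.exp_pos _).le
    simp only [Set.indicator_apply, Set.mem_Ioi]
    split_ifs with h1 h2
    · exact le_rfl
    · exact absurd (hx.trans h1) h2
    · rw [zero_mul]; exact h0
    · rw [zero_mul]
  cont := fun x₀ z₀ hz₀ => by
    -- The cutoff `x < y` is discontinuous in `x` only at `x = y`, so only the null set `y = x₀` is
    -- lost. It also keeps the arguments of the propagators strictly negative.
    have hne : ∀ᵐ y : ℝ, y ≠ x₀ := by simp [ae_iff]
    filter_upwards [hne] with y hy i j
    rcases lt_or_gt_of_ne hy with h | h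
    · refine (continuousWithinAt_const (b := (0 : ℂ))).congr_of_eventuallyEq ?_ ?_
      · have h1 : ∀ᶠ p : ℝ × ℂ in 𝓝 (x₀, z₀), y < p.1 :=
          (continuous_fst.tendsto (x₀, z₀)).eventually (lt_mem_nhds h)
        filter_upwards [mem_nhdsWithin_of_mem_nhds h1] with p hp
        rw [if_neg (not_lt.2 hp.le)]
        rfl
      · rw [if_neg (not_lt.2 h.le)]
        rfl
    · have hform : ContinuousWithinAt (fun p : ℝ × ℂ => -(T.e i (p.1 - y) p.2 * T.B y p.2 i j))
          (Set.univ ×ˢ T.W) (x₀, z₀) := by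
        refine (ContinuousWithinAt.mul ?_ ?_).neg
        · have hmap : Tendsto (fun p : ℝ × ℂ => (p.1 - y, p.2)) (𝓝[Set.univ ×ˢ T.W] (x₀, z₀))
              (𝓝[Set.univ ×ˢ T.W] (x₀ - y, z₀)) := by
            refine tendsto_nhdsWithin_iff.2 ⟨?_, ?_⟩
            · exact (Continuous.tendsto (by fun_prop) (x₀, z₀)).mono_left nhdsWithin_le_nhds
            · exact eventually_nhdsWithin_of_forall fun p hp => ⟨trivial, hp.2⟩
          exact Tendsto.comp (T.e_cont i (x₀ - y) (by linarith) z₀ hz₀) hmap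
        · have hmap : Tendsto (fun p : ℝ × ℂ => p.2) (𝓝[Set.univ ×ˢ T.W] (x₀, z₀))
              (𝓝[T.W] z₀) := by
            refine tendsto_nhdsWithin_iff.2 ⟨?_, ?_⟩
            · exact (Continuous.tendsto (by fun_prop) (x₀, z₀)).mono_left nhdsWithin_le_nhds
            · exact eventually_nhdsWithin_of_forall fun p hp => hp.2
          exact Tendsto.comp (T.B_contOn y i j z₀ hz₀) hmap
      refine hform.congr_of_eventuallyEq ?_ ?_
      · have h1 : ∀ᶠ p : ℝ × ℂ in 𝓝 (x₀, z₀), p.1 < y :=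
          (continuous_fst.tendsto (x₀, z₀)).eventually (gt_mem_nhds h)
        filter_upwards [mem_nhdsWithin_of_mem_nhds h1] with p hp
        rw [if_pos hp]
        simp [diagonal_mul]
      · rw [if_pos h]
        simp [diagonal_mul]
  diff := fun x y i j => by
    by_cases h : x < y
    · simp only [if_pos h, Matrix.neg_apply, diagonal_mul]
      exact ((T.e_diff i _).mul (T.B_diff y i j)).neg
    · simp only [if_neg h]
      exact differentiableOn_const 0

variable {T}

/-- Solutions of the integral equation. -/
structure IsSol (u : ℝ → ℂ → Fin n → ℂ) (ξ : Fin n → ℂ) : Prop where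
  cont : ContinuousOn (fun p : ℝ × ℂ => u p.1 p.2) (Set.univ ×ˢ T.W)
  diff : ∀ x, DifferentiableOn ℂ (u x) T.D
  cont_x : ∀ z ∈ T.W, Continuous fun x => u x z
  integrable : ∀ z ∈ T.W, ∀ x i,
    IntegrableOn (fun y => T.e i (x - y) z * (T.B y z *ᵥ u y z) i) (Set.Ioi x)
  eq : ∀ z ∈ T.W, ∀ x i,
    u x z i = ξ i - ∫ y in Set.Ioi x, T.e i (x - y) z * (T.B y z *ᵥ u y z) i
  tendsto : ∀ z ∈ T.W, Tendsto (fun x => u x z) atTop (𝓝 ξ)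

/-- The value at `+∞` follows from the explicit tail integral of the weight: `‖u - ξ‖ ≤ 2 ‖ξ‖
(weight - 1) / 2`, which tends to zero. -/
theorem exists_isSol (ξ : Fin n → ℂ) : ∃ u, T.IsSol u ξ := by
  obtain ⟨u, hu, heq⟩ := VolterraKernel.exists_solution (V := T.toVolterra) T.hg.one_le_weight ξ
  have hform : ∀ x z i, (fun y => (T.toVolterra.K x y z *ᵥ u y z) i)
      = Set.indicator (Set.Ioi x) (fun y => -(T.e i (x - y) z * (T.B y z *ᵥ u y z) i)) := by
    intro x z i
    ext y
    simp only [Set.indicator_apply, Set.mem_Ioi, toVolterra]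
    split_ifs
    · rw [T.mulVec_apply]
    · simp
  refine ⟨u, hu.cont, hu.diff, fun z hz => hu.continuous_x hz, fun z hz x i => ?_,
    fun z hz x i => ?_, fun z hz => ?_⟩
  · have h := hu.integrable hz x i
    rw [hform, integrable_indicator_iff measurableSet_Ioi] at h
    simpa using h.neg
  · rw [heq x z hz, Pi.add_apply, VolterraKernel.op, hform, integral_indicator measurableSet_Ioi,
      integral_neg, sub_eq_add_neg]
  · have hlim : Tendsto (fun x => 2 * ‖ξ‖ * ((TailIntegrable.weight T.g x - 1) / 2)) atTop (𝓝 0) := by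
      have := ((T.hg.tendsto_weight.sub_const 1).div_const 2).const_mul (2 * ‖ξ‖)
      simpa using this
    rw [tendsto_iff_norm_sub_tendsto_zero]
    refine squeeze_zero (fun _ => norm_nonneg _) (fun x => ?_) hlim
    have e : u x z - ξ = T.toVolterra.op u x z := by rw [heq x z hz]; simp
    rw [e]
    have hw := T.hg.one_le_weight x
    refine (pi_norm_le_iff_of_nonneg (mul_nonneg (by positivity) (by linarith))).2 fun i => ?_
    rw [VolterraKernel.op, hform, integral_indicator measurableSet_Ioi,
      ← T.hg.integral_weight x, ← integral_const_mul]
    refine norm_integral_le_of_norm_le ((T.hg.integrableOn_weight x).const_mul _) ?_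
    filter_upwards [ae_restrict_mem measurableSet_Ioi] with y hy
    rw [norm_neg, norm_mul]
    refine (mul_le_of_le_one_left (norm_nonneg _)
      (T.e_le i _ (by linarith [Set.mem_Ioi.1 hy]) z hz)).trans ?_
    refine (norm_le_pi_norm _ i).trans ((T.B_le y z hz _).trans ?_)
    have := mul_le_mul_of_nonneg_left (hu.bound y z hz) (T.hg.nonneg y)
    refine this.trans (le_of_eq ?_)
    simp only [toVolterra]
    ring

/-- A genuine exponential propagator splits as `e^{dx} e^{-dy}`, so the integral becomes a function
of its lower limit alone and can be differentiated. The condition `d l * ξ l = 0` removes the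
leftover term `d ξ`. -/
theorem IsSol.hasDerivAt {u : ℝ → ℂ → Fin n → ℂ} {ξ : Fin n → ℂ} (hu : T.IsSol u ξ) {z : ℂ}
    (hz : z ∈ T.W) {d : Fin n → ℂ} (hd : ∀ l s, T.e l s z = Complex.exp (d l * s))
    (hξ : ∀ l, d l * ξ l = 0) (x : ℝ) :
    HasDerivAt (fun x => u x z) ((diagonal d + T.B x z) *ᵥ u x z) x := by
  refine hasDerivAt_pi.2 fun i => ?_
  set f : ℝ → ℂ := fun y => Complex.exp (-(d i * y)) * (T.B y z *ᵥ u y z) i with hf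
  have hfc : Continuous f := by
    refine Continuous.mul (by fun_prop) ?_
    simp only [mulVec, dotProduct]
    exact continuous_finsetSum _ fun j _ =>
      (T.B_cont z hz i j).mul ((continuous_apply j).comp (hu.cont_x z hz))
  have hsplit : ∀ x y : ℝ, T.e i (x - y) z * (T.B y z *ᵥ u y z) i
      = Complex.exp (d i * x) * f y := by
    intro x y
    rw [hd, hf, ← mul_assoc, ← Complex.exp_add]
    congr 2
    push_cast
    ring
  have hint : ∀ x, IntegrableOn f (Set.Ioi x) := by
    intro x
    have h := (hu.integrable z hz x i).const_mul (Complex.exp (-(d i * x)))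
    refine h.congr (Eventually.of_forall fun y => ?_)
    simp only [hsplit]
    rw [← mul_assoc, ← Complex.exp_add]
    simp
  have hI : ∀ x, u x z i = ξ i - Complex.exp (d i * x)
      * ((∫ y in Set.Ioi 0, f y) - ∫ y in (0 : ℝ)..x, f y) := by
    intro x
    rw [hu.eq z hz x i, ← intervalIntegral.integral_interval_add_Ioi (hint 0) (hint x),
      add_sub_cancel_left, ← integral_const_mul]
    simp only [hsplit]
  have h1 : HasDerivAt (fun x => ∫ y in (0:ℝ)..x, f y) (f x) x :=
    intervalIntegral.integral_hasDerivAt_right (hfc.intervalIntegrable _ _)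
      (hfc.stronglyMeasurableAtFilter _ _) hfc.continuousAt
  have h2 : HasDerivAt (fun x : ℝ => Complex.exp (d i * x)) (Complex.exp (d i * x) * (d i * 1)) x :=
    ((hasDerivAt_id x).ofReal_comp.const_mul (d i)).cexp
  have h3 := (h2.mul (h1.const_sub (∫ y in Set.Ioi 0, f y))).const_sub (ξ i)
  refine (h3.congr_of_eventuallyEq (Eventually.of_forall hI)).congr_deriv ?_
  rw [add_mulVec, Pi.add_apply, mulVec_diagonal, hI x, hf]
  have h4 : Complex.exp (d i * x) * Complex.exp (-(d i * x)) = 1 := by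
    rw [← Complex.exp_add]; simp
  linear_combination (-1 : ℂ) * hξ i + (T.B x z *ᵥ u x z) i * h4

end TailKernel

end CMKdV

namespace CMKdV

variable {n : ℕ}

/-! ### Energy estimates and uniqueness for linear systems -/

section Energy

/-- The squared Euclidean norm. -/
def energy (v : Fin n → ℂ) : ℝ := ∑ i, ‖v i‖ ^ 2

theorem energy_nonneg (v : Fin n → ℂ) : 0 ≤ energy v := Finset.sum_nonneg fun _ _ => sq_nonneg _

theorem norm_sq_le_energy (v : Fin n → ℂ) : ‖v‖ ^ 2 ≤ energy v := by
  have h : ‖v‖ ≤ √(energy v) := by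
    refine (pi_norm_le_iff_of_nonneg (Real.sqrt_nonneg _)).2 fun i => Real.le_sqrt_of_sq_le ?_
    exact Finset.single_le_sum (f := fun i => ‖v i‖ ^ 2) (fun _ _ => sq_nonneg _)
      (Finset.mem_univ i)
  calc ‖v‖ ^ 2 ≤ √(energy v) ^ 2 := pow_le_pow_left₀ (norm_nonneg v) h 2
    _ = energy v := Real.sq_sqrt (energy_nonneg v)

theorem eq_zero_of_energy_nonpos {v : Fin n → ℂ} (h : energy v ≤ 0) : v = 0 := by
  have h1 := (norm_sq_le_energy v).trans h
  have h2 : ‖v‖ = 0 := by nlinarith [norm_nonneg v]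
  exact norm_eq_zero.1 h2

theorem continuous_energy : Continuous (energy (n := n)) := by
  unfold energy
  fun_prop

theorem hasDerivAt_energy {u : ℝ → Fin n → ℂ} {u' : Fin n → ℂ} {x : ℝ} (hu : HasDerivAt u u' x) :
    HasDerivAt (fun x => energy (u x)) (∑ i, 2 * inner ℝ (u x i) (u' i)) x := by
  unfold energy
  exact HasDerivAt.fun_sum fun i _ => (hasDerivAt_pi.1 hu i).norm_sq

/-- Grönwall's inequality with a variable rate: `exp I` is an integrating factor for the lower bound
on the derivative of the energy. -/
theorem monotone_energy_mul_exp {u u' : ℝ → Fin n → ℂ} {c I : ℝ → ℝ}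
    (hu : ∀ x, HasDerivAt u (u' x) x) (hI : ∀ x, HasDerivAt I (c x) x)
    (h : ∀ x, -(c x) * energy (u x) ≤ ∑ i, 2 * inner ℝ (u x i) (u' x i)) :
    Monotone fun x => energy (u x) * Real.exp (I x) := by
  have hd := fun x => (hasDerivAt_energy (hu x)).fun_mul (hI x).exp
  refine monotone_of_deriv_nonneg (fun x => (hd x).differentiableAt) fun x => ?_
  rw [(hd x).deriv]
  have h1 := h x
  have h2 := Real.exp_pos (I x)
  nlinarith

/-- The factor `n` counts coordinates: each term is estimated by the square of the sup norm, itself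
at most the energy. -/
theorem sum_inner_ge {B : Matrix (Fin n) (Fin n) ℂ} {c : ℝ} (hc : 0 ≤ c) {v : Fin n → ℂ}
    (h : ‖B *ᵥ v‖ ≤ c * ‖v‖) :
    -(2 * n * c) * energy v ≤ ∑ i, 2 * inner ℝ (v i) ((B *ᵥ v) i) := by
  have h1 : ∀ i ∈ Finset.univ, -(2 * c * energy v) ≤ 2 * inner ℝ (v i) ((B *ᵥ v) i) := by
    intro i _
    have h2 := abs_le.1 (abs_real_inner_le_norm (v i) ((B *ᵥ v) i))
    have h3 := norm_le_pi_norm v i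
    have h4 := (norm_le_pi_norm (B *ᵥ v) i).trans h
    have h5 := norm_sq_le_energy v
    have h6 : ‖v i‖ * ‖(B *ᵥ v) i‖ ≤ ‖v‖ * (c * ‖v‖) :=
      mul_le_mul h3 h4 (norm_nonneg _) (norm_nonneg _)
    nlinarith [mul_le_mul_of_nonneg_left h5 hc]
  have h2 := Finset.sum_le_sum h1
  simp only [Finset.sum_const, Finset.card_univ, Fintype.card_fin, nsmul_eq_mul] at h2
  linarith

/-- A solution of `u' = (d + B) u` with `Re d ≥ 0` and `B` integrable at `+∞` that tends to zero
vanishes. -/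
theorem eq_zero_of_tendsto_zero {u : ℝ → Fin n → ℂ} {d : Fin n → ℂ}
    {B : ℝ → Matrix (Fin n) (Fin n) ℂ} {g : ℝ → ℝ} (hg : TailIntegrable g)
    (hu : ∀ x, HasDerivAt u ((diagonal d + B x) *ᵥ u x) x) (hd : ∀ l, 0 ≤ (d l).re)
    (hB : ∀ x v, ‖B x *ᵥ v‖ ≤ g x * ‖v‖) (hlim : Tendsto u atTop (𝓝 0)) : u = 0 := by
  -- The diagonal part can only increase the energy and the perturbation costs the integrable rate
  -- `2 n g`. The corrected energy is therefore nondecreasing; being nonnegative with limit zero at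
  -- `+∞`, it vanishes.
  have hmono := monotone_energy_mul_exp (u := u) (c := fun x => 2 * n * g x)
    (I := fun x => -(2 * n * tail g x)) hu
    (fun x => (((hg.hasDerivAt_tail x).const_mul (2 * (n : ℝ))).neg).congr_deriv (by ring)) (by
      intro x
      refine (sum_inner_ge (hg.nonneg x) (hB x (u x))).trans (Finset.sum_le_sum fun i _ => ?_)
      rw [add_mulVec, Pi.add_apply, mulVec_diagonal, inner_add_right]
      have : inner ℝ (u x i) (d i * u x i) = (d i).re * ‖u x i‖ ^ 2 := by
        rw [Complex.inner, ← Complex.normSq_eq_norm_sq, Complex.normSq_apply]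
        simp [Complex.mul_re, Complex.mul_im]
        ring
      have h2 := mul_nonneg (hd i) (sq_nonneg ‖u x i‖)
      linarith)
  have hlim' : Tendsto (fun x => energy (u x) * Real.exp (-(2 * n * tail g x))) atTop (𝓝 0) := by
    have h1 := (continuous_energy.tendsto 0).comp hlim
    have h2 := (Real.continuous_exp.tendsto _).comp ((hg.tendsto_tail.const_mul (2 * (n : ℝ))).neg)
    have h3 := h1.mul h2
    simpa [energy] using h3
  funext x
  refine eq_zero_of_energy_nonpos ?_
  have h1 := ge_of_tendsto hlim' (eventually_ge_atTop x |>.mono fun y hy => hmono hy)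
  have h2 := Real.exp_pos (-(2 * n * tail g x))
  by_contra h3
  nlinarith [mul_pos (not_le.1 h3) h2]

/-- Energy times the exponential of `2 n ∫ mnorm A` is nondecreasing, so a zero at `x₀` forces zeros
at all points to its left. -/
theorem linear_ode_forward {u : ℝ → Fin n → ℂ} {A : ℝ → Matrix (Fin n) (Fin n) ℂ}
    (hA : ∀ i j, Continuous fun x => A x i j) (hu : ∀ x, HasDerivAt u (A x *ᵥ u x) x) {x₀ x : ℝ}
    (h0 : u x₀ = 0) (hx : x ≤ x₀) : u x = 0 := by
  have ha : Continuous fun x => mnorm (A x) := by unfold mnorm; fun_prop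
  have hmono := monotone_energy_mul_exp (u := u) (c := fun x => 2 * n * mnorm (A x))
    (I := fun x => 2 * n * ∫ y in (0 : ℝ)..x, mnorm (A y)) hu
    (fun x => (intervalIntegral.integral_hasDerivAt_right (ha.intervalIntegrable _ _)
      (ha.stronglyMeasurableAtFilter _ _) ha.continuousAt).const_mul _)
    (fun x => sum_inner_ge (mnorm_nonneg _) (norm_mulVec_le _ _))
  have h1 := hmono hx
  simp only [h0] at h1
  refine eq_zero_of_energy_nonpos ?_
  have h2 := Real.exp_pos (2 * n * ∫ y in (0 : ℝ)..x, mnorm (A y))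
  have h4 : energy (0 : Fin n → ℂ) = 0 := by simp [energy]
  rw [h4, zero_mul] at h1
  by_contra h3
  nlinarith [mul_pos (not_le.1 h3) h2]

theorem linear_ode_unique {u v : ℝ → Fin n → ℂ} {A : ℝ → Matrix (Fin n) (Fin n) ℂ}
    (hA : ∀ i j, Continuous fun x => A x i j) (hu : ∀ x, HasDerivAt u (A x *ᵥ u x) x)
    (hv : ∀ x, HasDerivAt v (A x *ᵥ v x) x) {x₀ : ℝ} (h0 : u x₀ = v x₀) : u = v := by
  have hd : ∀ x, HasDerivAt (fun x => u x - v x) (A x *ᵥ (u x - v x)) x := fun x => by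
    rw [mulVec_sub]; exact (hu x).sub (hv x)
  -- Reflecting `x` reduces points to the right of `x₀` to points on the left.
  have hd' : ∀ x, HasDerivAt (fun x => u (-x) - v (-x)) ((-A (-x)) *ᵥ (u (-x) - v (-x))) x := by
    intro x
    have := (hd (-x)).scomp x (hasDerivAt_neg x)
    rw [neg_mulVec]
    simpa [Function.comp_def] using this
  funext x
  rw [← sub_eq_zero]
  rcases le_total x x₀ with h | h
  · exact linear_ode_forward hA hd (by simp [h0]) h
  · have := linear_ode_forward (u := fun x => u (-x) - v (-x)) (A := fun x => -A (-x))
      (fun i j => ((hA i j).comp continuous_neg).neg) hd' (x₀ := -x₀) (x := -x)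
      (by simp [h0]) (by linarith)
    simpa using this

end Energy

/-! ### Grönwall bounds on a symmetric interval -/

section Gronwall

variable {E : Type*} [NormedAddCommGroup E] [NormedSpace ℝ E]

/-- Assuming `1 ≤ K` allows `ε / K` to be replaced by `ε`, which gives a bound linear in `δ + ε`. -/
theorem norm_le_of_norm_deriv_le_right {f f' : ℝ → E} {δ ε K T : ℝ} (hK : 1 ≤ K) (hδ : 0 ≤ δ)
    (hε : 0 ≤ ε) (hf : ∀ s, HasDerivAt f (f' s) s) (h0 : ‖f 0‖ ≤ δ)
    (hb : ∀ s ∈ Set.Icc 0 T, ‖f' s‖ ≤ K * ‖f s‖ + ε) :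
    ∀ s ∈ Set.Icc 0 T, ‖f s‖ ≤ (δ + ε) * Real.exp (K * T) := by
  intro s hs
  have h := norm_le_gronwallBound_of_norm_deriv_right_le (f := f) (f' := f') (δ := δ) (K := K)
    (ε := ε) (a := 0) (b := T) (fun x _ => (hf x).continuousAt.continuousWithinAt)
    (fun x _ => (hf x).hasDerivWithinAt) h0 (fun x hx => hb x ⟨hx.1, hx.2.le⟩) s hs
  refine h.trans ?_
  rw [gronwallBound_of_K_ne_0 (by linarith), sub_zero]
  have h1 : Real.exp (K * s) ≤ Real.exp (K * T) :=
    Real.exp_le_exp.2 (mul_le_mul_of_nonneg_left hs.2 (by linarith))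
  have h2 : ε / K ≤ ε := div_le_self hε hK
  have h3 : 1 ≤ Real.exp (K * s) := Real.one_le_exp (mul_nonneg (by linarith) hs.1)
  have h4 : ε / K * (Real.exp (K * s) - 1) ≤ ε * Real.exp (K * T) :=
    mul_le_mul h2 (by linarith) (by linarith) hε
  nlinarith [mul_le_mul_of_nonneg_left h1 hδ]

/-- A two-sided Grönwall inequality. -/
theorem norm_le_of_norm_deriv_le {f f' : ℝ → E} {δ ε K T : ℝ} (hK : 1 ≤ K) (hδ : 0 ≤ δ)
    (hε : 0 ≤ ε) (hf : ∀ s, HasDerivAt f (f' s) s) (h0 : ‖f 0‖ ≤ δ)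
    (hb : ∀ s ∈ Set.Icc (-T) T, ‖f' s‖ ≤ K * ‖f s‖ + ε) :
    ∀ s ∈ Set.Icc (-T) T, ‖f s‖ ≤ (δ + ε) * Real.exp (K * T) := by
  intro s hs
  rcases le_total 0 s with h | h
  · exact norm_le_of_norm_deriv_le_right hK hδ hε hf h0
      (fun r hr => hb r ⟨by linarith [hr.1, hs.1, hs.2], hr.2⟩) s ⟨h, hs.2⟩
  · have h1 := norm_le_of_norm_deriv_le_right (f := fun s => f (-s)) (f' := fun s => -f' (-s))
      (T := T) hK hδ hε (fun s => by
        have := (hf (-s)).scomp s (hasDerivAt_neg s)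
        simpa [Function.comp_def] using this) (by simpa using h0)
      (fun r hr => by
        rw [norm_neg]
        exact hb (-r) ⟨by linarith [hr.2], by linarith [hr.1, hr.2]⟩) (-s)
      ⟨by linarith, by linarith [hs.1]⟩
    simpa using h1

end Gronwall

/-! ### Global solutions of linear initial value problems -/

section InitialValue

variable {A : ℝ → Matrix (Fin n) (Fin n) ℂ}

theorem hasDerivAt_primitive_mnorm (hA : ∀ i j, Continuous fun x => A x i j) (x : ℝ) :
    HasDerivAt (fun x => ∫ y in (0 : ℝ)..x, mnorm (A y)) (mnorm (A x)) x := by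
  have ha : Continuous fun x => mnorm (A x) := by unfold mnorm; fun_prop
  exact intervalIntegral.integral_hasDerivAt_right (ha.intervalIntegrable _ _)
      (ha.stronglyMeasurableAtFilter _ _) ha.continuousAt

/-- The weight for the initial value problem. -/
def ivpWeight (A : ℝ → Matrix (Fin n) (Fin n) ℂ) (x : ℝ) : ℝ :=
  Real.exp (2 * |∫ y in (0 : ℝ)..x, mnorm (A y)|)

theorem continuous_ivpWeight (hA : ∀ i j, Continuous fun x => A x i j) :
    Continuous (ivpWeight A) := by
  have h : Continuous fun x => ∫ y in (0 : ℝ)..x, mnorm (A y) :=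
    continuous_iff_continuousAt.2 fun x => (hasDerivAt_primitive_mnorm hA x).continuousAt
  unfold ivpWeight
  fun_prop

/-- On either side of `0` the absolute value has a fixed sign, and the integrand is again an exact
derivative. -/
theorem setIntegral_ivpWeight_le (hA : ∀ i j, Continuous fun x => A x i j) (x : ℝ) :
    ∫ y in Set.uIoc 0 x, mnorm (A y) * ivpWeight A y ≤ ivpWeight A x / 2 := by
  have ha : Continuous fun x => mnorm (A x) := by unfold mnorm; fun_prop
  have hc : Continuous fun x => ∫ y in (0 : ℝ)..x, mnorm (A y) :=
    continuous_iff_continuousAt.2 fun x => (hasDerivAt_primitive_mnorm hA x).continuousAt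
  rcases le_total 0 x with h | h
  · rw [Set.uIoc_of_le h]
    have h1 : ∫ y in (0 : ℝ)..x, mnorm (A y) * Real.exp (2 * ∫ s in (0 : ℝ)..y, mnorm (A s))
        = Real.exp (2 * ∫ s in (0 : ℝ)..x, mnorm (A s)) / 2
          - Real.exp (2 * ∫ s in (0 : ℝ)..0, mnorm (A s)) / 2 := by
      refine intervalIntegral.integral_eq_sub_of_hasDerivAt
        (f := fun x => Real.exp (2 * ∫ s in (0 : ℝ)..x, mnorm (A s)) / 2) (fun y _ => ?_)
        (Continuous.intervalIntegrable (by fun_prop) _ _)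
      exact (((hasDerivAt_primitive_mnorm hA y).const_mul 2).exp.div_const 2).congr_deriv (by ring)
    have h2 : ∀ y : ℝ, 0 ≤ y → |∫ s in (0 : ℝ)..y, mnorm (A s)| = ∫ s in (0 : ℝ)..y, mnorm (A s) :=
      fun y hy => abs_of_nonneg (intervalIntegral.integral_nonneg hy fun s _ => mnorm_nonneg _)
    have h3 : ∫ y in Set.Ioc 0 x, mnorm (A y) * ivpWeight A y
        = ∫ y in Set.Ioc 0 x, mnorm (A y) * Real.exp (2 * ∫ s in (0 : ℝ)..y, mnorm (A s)) :=
      setIntegral_congr_fun measurableSet_Ioc fun y hy => by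
        simp only [ivpWeight]; rw [h2 y hy.1.le]
    rw [h3, ← intervalIntegral.integral_of_le h, h1, ivpWeight, h2 x h]
    have := Real.exp_pos (2 * ∫ s in (0 : ℝ)..0, mnorm (A s))
    linarith
  · rw [Set.uIoc_of_ge h]
    have h1 : ∫ y in x..(0 : ℝ), mnorm (A y) * Real.exp (-(2 * ∫ s in (0 : ℝ)..y, mnorm (A s)))
        = -Real.exp (-(2 * ∫ s in (0 : ℝ)..0, mnorm (A s))) / 2
          - -Real.exp (-(2 * ∫ s in (0 : ℝ)..x, mnorm (A s))) / 2 := by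
      refine intervalIntegral.integral_eq_sub_of_hasDerivAt
        (f := fun x => -Real.exp (-(2 * ∫ s in (0 : ℝ)..x, mnorm (A s))) / 2) (fun y _ => ?_)
        (Continuous.intervalIntegrable (by fun_prop) _ _)
      refine (((hasDerivAt_primitive_mnorm hA y).const_mul 2).fun_neg.exp.fun_neg.div_const
        2).congr_deriv ?_
      ring
    have h2 : ∀ y : ℝ, y ≤ 0 →
        |∫ s in (0 : ℝ)..y, mnorm (A s)| = -∫ s in (0 : ℝ)..y, mnorm (A s) := by
      intro y hy
      rw [intervalIntegral.integral_symm, abs_neg, neg_neg]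
      exact abs_of_nonneg (intervalIntegral.integral_nonneg hy fun s _ => mnorm_nonneg _)
    have h3 : ∫ y in Set.Ioc x 0, mnorm (A y) * ivpWeight A y
        = ∫ y in Set.Ioc x 0, mnorm (A y) * Real.exp (-(2 * ∫ s in (0 : ℝ)..y, mnorm (A s))) :=
      setIntegral_congr_fun measurableSet_Ioc fun y hy => by
        simp only [ivpWeight]; rw [h2 y hy.2, mul_neg]
    rw [h3, ← intervalIntegral.integral_of_le h, h1, ivpWeight, h2 x h, mul_neg]
    have := Real.exp_pos (-(2 * ∫ s in (0 : ℝ)..0, mnorm (A s)))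
    linarith

open Classical in
/-- The Volterra kernel of the initial value problem `u' = A u`. -/
def ivpKernel (A : ℝ → Matrix (Fin n) (Fin n) ℂ) (hA : ∀ i j, Continuous fun x => A x i j) :
    VolterraKernel n where
  K x y _ := if y ∈ Set.Ioc 0 x then A y else if y ∈ Set.Ioc x 0 then -A y else 0
  k x y := Set.indicator (Set.uIoc 0 x) (fun y => mnorm (A y)) y
  w := ivpWeight A
  W := Set.univ
  -- The parameter is a dummy here, so holomorphy is requested nowhere.
  D := ∅
  isOpen_D := isOpen_empty
  D_subset := Set.empty_subset _
  w_cont := continuous_ivpWeight hA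
  w_pos := fun x => Real.exp_pos _
  k_nonneg := fun x y => Set.indicator_nonneg (fun _ _ => mnorm_nonneg _) _
  bound := fun x y z hz v => by
    rw [Set.indicator_apply]
    have hu : y ∈ Set.uIoc 0 x ↔ y ∈ Set.Ioc 0 x ∨ y ∈ Set.Ioc x 0 := Set.mem_uIoc
    by_cases h1 : y ∈ Set.Ioc 0 x
    · rw [if_pos h1, if_pos (hu.2 (Or.inl h1))]
      exact norm_mulVec_le _ _
    · rw [if_neg h1]
      by_cases h2 : y ∈ Set.Ioc x 0
      · rw [if_pos h2, if_pos (hu.2 (Or.inr h2)), neg_mulVec, norm_neg]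
        exact norm_mulVec_le _ _
      · rw [if_neg h2, if_neg (fun h => not_or.2 ⟨h1, h2⟩ (hu.1 h))]
        simp
  meas := fun x z hz i j => by
    have h : (fun y => (if y ∈ Set.Ioc 0 x then A y else if y ∈ Set.Ioc x 0 then -A y else 0) i j)
        = fun y => if y ∈ Set.Ioc 0 x then A y i j else if y ∈ Set.Ioc x 0 then -A y i j else 0 := by
      funext y
      split_ifs <;> rfl
    rw [h]
    have hm := (hA i j).measurable
    exact (Measurable.ite measurableSet_Ioc hm
      (Measurable.ite measurableSet_Ioc hm.neg measurable_const)).aestronglyMeasurable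
  int := fun x => by
    have ha : Continuous fun x => mnorm (A x) := by unfold mnorm; fun_prop
    have hc := (ha.mul (continuous_ivpWeight hA)).intervalIntegrable (μ := volume) 0 x
    have h1 := (intervalIntegrable_iff.1 hc).integrable_indicator measurableSet_uIoc
    refine h1.congr (Eventually.of_forall fun y => ?_)
    simp only [Set.indicator_apply]
    split_ifs <;> simp
  int_le := fun x => by
    have h : (fun y => Set.indicator (Set.uIoc 0 x) (fun y => mnorm (A y)) y * ivpWeight A y)
        = Set.indicator (Set.uIoc 0 x) (fun y => mnorm (A y) * ivpWeight A y) := by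
      funext y
      simp only [Set.indicator_apply]
      split_ifs <;> simp
    rw [h, integral_indicator measurableSet_uIoc]
    exact setIntegral_ivpWeight_le hA x
  dom := fun x₀ => by
    have ha : Continuous fun x => mnorm (A x) := by unfold mnorm; fun_prop
    have hc := (ha.mul (continuous_ivpWeight hA)).integrableOn_Icc (μ := volume)
      (a := -(|x₀| + 1)) (b := |x₀| + 1)
    refine ⟨_, hc.integrable_indicator measurableSet_Icc, ?_⟩
    filter_upwards [Metric.ball_mem_nhds x₀ one_pos] with x hx y
    have hx' : |x| ≤ |x₀| + 1 := by
      rw [Metric.mem_ball, Real.dist_eq] at hx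
      linarith [abs_sub_abs_le_abs_sub x x₀]
    have h0 : 0 ≤ mnorm (A y) * ivpWeight A y := mul_nonneg (mnorm_nonneg _) (Real.exp_pos _).le
    simp only [Set.indicator_apply]
    split_ifs with h1 h2
    · exact le_rfl
    · exfalso
      apply h2
      rw [Set.mem_uIoc] at h1
      have := abs_le.1 hx'
      rcases h1 with h1 | h1
      · exact ⟨by linarith [h1.1, abs_nonneg x₀], by linarith [h1.2]⟩
      · exact ⟨by linarith [h1.1], by linarith [h1.2, abs_nonneg x₀]⟩
    · rw [zero_mul]; exact h0
    · rw [zero_mul]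
  cont := fun x₀ z₀ hz₀ => by
    have hne : ∀ᵐ y : ℝ, y ≠ x₀ := by simp [ae_iff]
    filter_upwards [hne] with y hy i j
    refine (continuousWithinAt_const (b := (if y ∈ Set.Ioc 0 x₀ then A y else
      if y ∈ Set.Ioc x₀ 0 then -A y else 0) i j)).congr_of_eventuallyEq ?_ rfl
    have h1 : ∀ᶠ p : ℝ × ℂ in 𝓝 (x₀, z₀), (y ≤ p.1 ↔ y ≤ x₀) ∧ (p.1 < y ↔ x₀ < y) := by
      refine (continuous_fst.tendsto (x₀, z₀)).eventually
        (p := fun x => (y ≤ x ↔ y ≤ x₀) ∧ (x < y ↔ x₀ < y)) ?_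
      rcases lt_or_gt_of_ne hy with h | h
      · filter_upwards [lt_mem_nhds h] with x hx
        exact ⟨iff_of_true hx.le h.le, iff_of_false (not_lt.2 hx.le) (not_lt.2 h.le)⟩
      · filter_upwards [gt_mem_nhds h] with x hx
        exact ⟨iff_of_false (not_le.2 hx) (not_le.2 h), iff_of_true hx h⟩
    filter_upwards [mem_nhdsWithin_of_mem_nhds h1] with p hp
    simp only [Set.mem_Ioc, hp.1, hp.2]
  diff := fun x y i j => by simp

theorem exists_linear_ode (hA : ∀ i j, Continuous fun x => A x i j) (v : Fin n → ℂ) :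
    ∃ u : ℝ → Fin n → ℂ, u 0 = v ∧ ∀ x, HasDerivAt u (A x *ᵥ u x) x := by
  obtain ⟨u, hu, heq⟩ := VolterraKernel.exists_solution (V := ivpKernel A hA)
    (fun x => Real.one_le_exp (by positivity)) v
  have huc : Continuous fun x => u x 0 := hu.continuous_x (Set.mem_univ _)
  have hI : ∀ x i, u x 0 i = v i + ∫ y in (0 : ℝ)..x, (A y *ᵥ u y 0) i := by
    intro x i
    rw [heq x 0 (Set.mem_univ _), Pi.add_apply, VolterraKernel.op]
    congr 1
    rcases le_total 0 x with h | h
    · rw [intervalIntegral.integral_of_le h, ← integral_indicator measurableSet_Ioc]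
      congr 1
      funext y
      simp only [ivpKernel, Set.indicator_apply]
      have : y ∉ Set.Ioc x 0 := fun hy => by linarith [hy.1, hy.2]
      split_ifs <;> simp
    · rw [intervalIntegral.integral_of_ge h, ← integral_indicator measurableSet_Ioc, ← integral_neg]
      congr 1
      funext y
      simp only [ivpKernel, Set.indicator_apply]
      have : y ∉ Set.Ioc 0 x := fun hy => by linarith [hy.1, hy.2]
      rw [if_neg this]
      split_ifs <;> simp [neg_mulVec]
  refine ⟨fun x => u x 0, ?_, fun x => hasDerivAt_pi.2 fun i => ?_⟩
  · funext i
    simpa using hI 0 i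
  · have hc : Continuous fun y => (A y *ᵥ u y 0) i := by
      simp only [mulVec, dotProduct]
      exact continuous_finsetSum _ fun j _ => (hA i j).mul ((continuous_apply j).comp huc)
    have h1 : HasDerivAt (fun x => ∫ y in (0:ℝ)..x, (A y *ᵥ u y 0) i) ((A x *ᵥ u x 0) i) x :=
      intervalIntegral.integral_hasDerivAt_right (hc.intervalIntegrable _ _)
        (hc.stronglyMeasurableAtFilter _ _) hc.continuousAt
    exact (h1.const_add (v i)).congr_of_eventuallyEq (Eventually.of_forall fun y => hI y i)

end InitialValue

end CMKdV

/-! ### Compatible pairs of linear systems and persistence of asymptotics -/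

namespace CMKdV

variable {n : ℕ}

/-- Compactness of the interval upgrades joint continuity to continuity in `t` uniform in `x`. -/
theorem eventually_forall_norm_sub_lt {E : Type*} [NormedAddCommGroup E] {f : ℝ → ℝ → E}
    (hf : Continuous fun p : ℝ × ℝ => f p.1 p.2) (R t : ℝ) {ε : ℝ} (hε : 0 < ε) :
    ∀ᶠ s in 𝓝 t, ∀ x ∈ Set.Icc (-R) R, ‖f x s - f x t‖ < ε := by
  refine isCompact_Icc.eventually_forall_of_forall_eventually
    (P := fun (s x : ℝ) => ‖f x s - f x t‖ < ε) fun x _ => ?_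
  have hc : Continuous fun z : ℝ × ℝ => ‖f z.2 z.1 - f z.2 t‖ := by
    have h1 : Continuous fun z : ℝ × ℝ => f z.2 z.1 := hf.comp (by fun_prop : Continuous
      fun z : ℝ × ℝ => (z.2, z.1))
    have h2 : Continuous fun z : ℝ × ℝ => f z.2 t := hf.comp (by fun_prop : Continuous
      fun z : ℝ × ℝ => (z.2, t))
    exact (h1.sub h2).norm
  exact hc.continuousAt.eventually_lt_const (by simpa using hε)

/-- The mean value inequality for `s ↦ f x s - s f' x t`, whose derivative is uniformly small near
`t`. -/
theorem eventually_forall_norm_sub_sub_le {f f' : ℝ → ℝ → ℂ}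
    (hf' : Continuous fun p : ℝ × ℝ => f' p.1 p.2)
    (hd : ∀ x t, HasDerivAt (fun s => f x s) (f' x t) t) (R t : ℝ) {ε : ℝ} (hε : 0 < ε) :
    ∀ᶠ s in 𝓝 t, ∀ x ∈ Set.Icc (-R) R, ‖f x s - f x t - (s - t) * f' x t‖ ≤ ε * |s - t| := by
  obtain ⟨r, hr, hb⟩ := Metric.eventually_nhds_iff.1 (eventually_forall_norm_sub_lt hf' R t hε)
  refine Metric.eventually_nhds_iff.2 ⟨r, hr, fun s hs x hx => ?_⟩
  have hder : ∀ y ∈ Metric.ball t r, HasDerivWithinAt (fun s : ℝ => f x s - s * f' x t)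
      (f' x y - f' x t) (Metric.ball t r) y := fun y _ => by
    have h1 := (hd x y).sub ((hasDerivAt_id y).ofReal_comp.mul_const (f' x t))
    simp only [Complex.ofReal_one, one_mul] at h1
    exact h1.hasDerivWithinAt
  have := (convex_ball t r).norm_image_sub_le_of_norm_hasDerivWithin_le hder
    (fun y hy => (hb hy x hx).le) (Metric.mem_ball_self hr) (Metric.mem_ball.2 hs)
  rw [Real.norm_eq_abs] at this
  refine le_trans (le_of_eq ?_) this
  congr 1
  ring

theorem mnorm_le_of_entries {M : Matrix (Fin n) (Fin n) ℂ} {c : ℝ} (h : ∀ i j, ‖M i j‖ ≤ c) :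
    mnorm M ≤ n * n * c := by
  have h1 : mnorm M ≤ ∑ _i : Fin n, ∑ _j : Fin n, c :=
    Finset.sum_le_sum fun i _ => Finset.sum_le_sum fun j _ => h i j
  simpa [mul_assoc] using h1

theorem continuous_mulVec_entries {X : Type*} [TopologicalSpace X]
    {M : X → Matrix (Fin n) (Fin n) ℂ} {v : X → Fin n → ℂ}
    (hM : ∀ i j, Continuous fun x => M x i j) (hv : Continuous v) :
    Continuous fun x => M x *ᵥ v x := by
  refine continuous_pi fun i => ?_
  simp only [mulVec, dotProduct]
  exact continuous_finsetSum _ fun j _ => (hM i j).mul ((continuous_apply j).comp hv)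

theorem hasDerivAt_mulVec {M : ℝ → Matrix (Fin n) (Fin n) ℂ} {M' : Matrix (Fin n) (Fin n) ℂ}
    {v : ℝ → Fin n → ℂ} {v' : Fin n → ℂ} {x : ℝ}
    (hM : ∀ i j, HasDerivAt (fun x => M x i j) (M' i j) x) (hv : HasDerivAt v v' x) :
    HasDerivAt (fun x => M x *ᵥ v x) (M' *ᵥ v x + M x *ᵥ v') x := by
  refine hasDerivAt_pi.2 fun i => ?_
  simp only [mulVec, dotProduct, Pi.add_apply, ← Finset.sum_add_distrib]
  exact HasDerivAt.fun_sum fun j _ => (hM i j).mul (hasDerivAt_pi.1 hv j)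

/-- Simultaneous solvability of a compatible pair of linear systems. -/
theorem exists_lax_solution {U V Ut : ℝ → ℝ → Matrix (Fin n) (Fin n) ℂ}
    (hU : ∀ i j, Continuous fun p : ℝ × ℝ => U p.1 p.2 i j)
    (hV : ∀ i j, Continuous fun p : ℝ × ℝ => V p.1 p.2 i j)
    (hUt : ∀ i j, Continuous fun p : ℝ × ℝ => Ut p.1 p.2 i j)
    (hUd : ∀ x t i j, HasDerivAt (fun s => U x s i j) (Ut x t i j) t)
    (hVd : ∀ x t i j, HasDerivAt (fun y => V y t i j)
      ((Ut x t + U x t * V x t - V x t * U x t) i j) x) (v : Fin n → ℂ) :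
    ∃ E : ℝ → ℝ → Fin n → ℂ, E 0 0 = v ∧
      (∀ x t, HasDerivAt (fun y => E y t) (U x t *ᵥ E x t) x) ∧
      ∀ x t, HasDerivAt (fun s => E x s) (V x t *ᵥ E x t) t := by
  have hUx : ∀ t i j, Continuous fun x => U x t i j := fun t i j =>
    (hU i j).comp (by fun_prop : Continuous fun x : ℝ => (x, t))
  have hVx : ∀ t i j, Continuous fun x => V x t i j := fun t i j =>
    (hV i j).comp (by fun_prop : Continuous fun x : ℝ => (x, t))
  have hUtx : ∀ t i j, Continuous fun x => Ut x t i j := fun t i j =>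
    (hUt i j).comp (by fun_prop : Continuous fun x : ℝ => (x, t))
  -- The solution is carried first in `t` along `x = 0`, then in `x` at each fixed time. What
  -- remains is the `t`-equation away from `x = 0`.
  obtain ⟨c, hc0, hc⟩ := exists_linear_ode (A := fun t => V 0 t)
    (fun i j => (hV i j).comp (by fun_prop : Continuous fun t : ℝ => ((0 : ℝ), t))) v
  choose E hE0 hEx using fun t => exists_linear_ode (hUx t) (c t)
  refine ⟨fun x t => E t x, (hE0 0).trans hc0, fun x t => hEx t x, fun x t => ?_⟩
  set R := |x| with hR
  have hxR : x ∈ Set.Icc (-R) R := abs_le.1 le_rfl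
  have hEc : ∀ t, Continuous (E t) := fun t =>
    continuous_iff_continuousAt.2 fun x => (hEx t x).continuousAt
  have bdd : ∀ f : ℝ → ℝ, Continuous f → ∃ C, 1 ≤ C ∧ ∀ y ∈ Set.Icc (-R) R, f y ≤ C := by
    intro f hf
    obtain ⟨C, hC⟩ := (isCompact_Icc (a := -R) (b := R)).bddAbove_image hf.continuousOn
    exact ⟨max C 1, le_max_right _ _, fun y hy => (hC ⟨y, hy, rfl⟩).trans (le_max_left _ _)⟩
  obtain ⟨K, hK1, hK⟩ := bdd (fun y => mnorm (U y t)) (by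
    have := hUx t; unfold mnorm; fun_prop)
  obtain ⟨K', hK'1, hK'⟩ := bdd (fun y => mnorm (Ut y t)) (by
    have := hUtx t; unfold mnorm; fun_prop)
  obtain ⟨M, hM1, hM⟩ := bdd (fun y => ‖E t y‖) (hEc t).norm
  have hKpos : (0 : ℝ) < Real.exp (K * R) := Real.exp_pos _
  have hK1pos : (0 : ℝ) < Real.exp ((K + 1) * R) := Real.exp_pos _
  have hUunif : ∀ ε > 0, ∀ᶠ s in 𝓝 t, ∀ y ∈ Set.Icc (-R) R, mnorm (U y s - U y t) ≤ ε := by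
    intro ε hε
    have hε' : 0 < ε / (n * n + 1) := by positivity
    have h := eventually_all.2 fun i => eventually_all.2 fun j =>
      eventually_forall_norm_sub_lt (f := fun x t => U x t i j) (hU i j) R t hε'
    filter_upwards [h] with s hs y hy
    refine (mnorm_le_of_entries fun i j => (hs i j y hy).le).trans ?_
    rw [mul_div_assoc', div_le_iff₀ (by positivity)]
    nlinarith
  have hUdiff : ∀ ε > 0, ∀ᶠ s in 𝓝 t, ∀ y ∈ Set.Icc (-R) R,
      mnorm (U y s - U y t - ((s - t : ℝ) : ℂ) • Ut y t) ≤ ε * |s - t| := by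
    intro ε hε
    have hε' : 0 < ε / (n * n + 1) := by positivity
    have h := eventually_all.2 fun i => eventually_all.2 fun j =>
      eventually_forall_norm_sub_sub_le (f := fun x t => U x t i j) (hUt i j)
        (fun x t => hUd x t i j) R t hε'
    filter_upwards [h] with s hs y hy
    refine (mnorm_le_of_entries (c := ε / (n * n + 1) * |s - t|) fun i j => ?_).trans ?_
    · simpa using hs i j y hy
    · rw [← mul_assoc, mul_div_assoc']
      refine mul_le_mul_of_nonneg_right ?_ (abs_nonneg _)
      rw [div_le_iff₀ (by positivity)]
      nlinarith
  -- Uniform continuity in time is needed before differentiability. The growth rate `K + 1` bounds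
  -- `U` at the nearby time `s`, thanks to `η ≤ 1`; `1 ≤ M` absorbs `η + η M` into `2 M η`.
  have hEcont : ∀ ε > 0, ∀ᶠ s in 𝓝 t, ∀ y ∈ Set.Icc (-R) R, ‖E s y - E t y‖ ≤ ε := by
    intro ε hε
    set η : ℝ := min 1 (ε / (2 * M * Real.exp ((K + 1) * R))) with hη
    have hηpos : 0 < η := lt_min one_pos (by positivity)
    have hcc : ∀ᶠ s in 𝓝 t, ‖c s - c t‖ < η := by
      have h1 : Continuous fun s => ‖c s - c t‖ :=
        ((continuous_iff_continuousAt.2 fun s => (hc s).continuousAt).sub continuous_const).norm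
      exact h1.continuousAt.eventually_lt_const (by simpa using hηpos)
    filter_upwards [hcc, hUunif η hηpos] with s hs1 hs2 y hy
    have h := norm_le_of_norm_deriv_le (f := fun y => E s y - E t y)
      (f' := fun y => U y s *ᵥ E s y - U y t *ᵥ E t y) (δ := η) (ε := η * M) (K := K + 1) (T := R)
      (by linarith) hηpos.le (by positivity) (fun y => (hEx s y).sub (hEx t y))
      (by simpa [hE0] using hs1.le) (fun y hy => by
        have e : U y s *ᵥ E s y - U y t *ᵥ E t y
            = U y t *ᵥ (E s y - E t y) + (U y s - U y t) *ᵥ (E s y - E t y)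
              + (U y s - U y t) *ᵥ E t y := by
          simp only [mulVec_sub, sub_mulVec]
          abel
        rw [e]
        have h1 := norm_mulVec_le (U y t) (E s y - E t y)
        have h2 := norm_mulVec_le (U y s - U y t) (E s y - E t y)
        have h3 := norm_mulVec_le (U y s - U y t) (E t y)
        have h4 := hs2 y hy
        have h5 : mnorm (U y s - U y t) ≤ 1 := h4.trans (min_le_left _ _)
        have h6 := mul_le_mul_of_nonneg_right (hK y hy) (norm_nonneg (E s y - E t y))
        have h7 := mul_le_mul_of_nonneg_right h5 (norm_nonneg (E s y - E t y))
        have h8 : mnorm (U y s - U y t) * ‖E t y‖ ≤ η * M :=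
          mul_le_mul h4 (hM y hy) (norm_nonneg _) hηpos.le
        have h9 := norm_add₃_le (a := U y t *ᵥ (E s y - E t y))
          (b := (U y s - U y t) *ᵥ (E s y - E t y)) (c := (U y s - U y t) *ᵥ E t y)
        linarith) y hy
    refine h.trans ?_
    have h1 : η ≤ ε / (2 * M * Real.exp ((K + 1) * R)) := min_le_right _ _
    rw [le_div_iff₀ (by positivity)] at h1
    have h2 : (η + η * M) ≤ 2 * M * η := by nlinarith
    calc (η + η * M) * Real.exp ((K + 1) * R) ≤ (2 * M * η) * Real.exp ((K + 1) * R) :=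
          mul_le_mul_of_nonneg_right h2 hK1pos.le
      _ ≤ ε := by linarith
  rw [hasDerivAt_iff_isLittleO, Asymptotics.isLittleO_iff]
  intro ε hε
  -- The constant `2 + M + K'` collects the initial error `1`, the bound `M + 1` for `E s`, and the
  -- bound `K'` for `Ut`.
  set η : ℝ := min 1 (ε / ((2 + M + K') * Real.exp (K * R))) with hη
  have hηpos : 0 < η := lt_min one_pos (by positivity)
  have hcd := (Asymptotics.isLittleO_iff.1 (hasDerivAt_iff_isLittleO.1 (hc t))) hηpos
  filter_upwards [hcd, hUdiff η hηpos, hEcont η hηpos] with s hs1 hs2 hs3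
  -- The first-order remainder in time solves the `x`-equation up to terms of size `o(s - t)`:
  -- compatibility cancels the commutator of `U` and `V`, leaving only the remainder of `U` in time
  -- and `Ut` times a small difference. Grönwall in `x` then bounds it.
  have hder : ∀ y, HasDerivAt (fun y => E s y - E t y - ((s - t : ℝ) : ℂ) • (V y t *ᵥ E t y))
      (U y s *ᵥ E s y - U y t *ᵥ E t y - ((s - t : ℝ) : ℂ) •
        ((Ut y t + U y t * V y t - V y t * U y t) *ᵥ E t y + V y t *ᵥ (U y t *ᵥ E t y))) y :=
    fun y => ((hEx s y).sub (hEx t y)).sub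
      ((hasDerivAt_mulVec (hVd y t) (hEx t y)).const_smul ((s - t : ℝ) : ℂ))
  have h := norm_le_of_norm_deriv_le (δ := η * |s - t|) (ε := η * (M + 1 + K') * |s - t|) (K := K)
    (T := R) hK1 (by positivity) (by positivity) hder (by
      rw [hE0, hE0]
      have e : c s - c t - ((s - t : ℝ) : ℂ) • (V 0 t *ᵥ c t)
          = c s - c t - (s - t) • (V 0 t *ᵥ c t) := rfl
      rw [e]
      exact hs1) (fun y hy => by
      have e : U y s *ᵥ E s y - U y t *ᵥ E t y - ((s - t : ℝ) : ℂ) •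
          ((Ut y t + U y t * V y t - V y t * U y t) *ᵥ E t y + V y t *ᵥ (U y t *ᵥ E t y))
          = U y t *ᵥ (E s y - E t y - ((s - t : ℝ) : ℂ) • (V y t *ᵥ E t y))
            + (U y s - U y t - ((s - t : ℝ) : ℂ) • Ut y t) *ᵥ E s y
            + ((s - t : ℝ) : ℂ) • (Ut y t *ᵥ (E s y - E t y)) := by
        simp only [mulVec_sub, sub_mulVec, add_mulVec, mulVec_smul, smul_mulVec, mulVec_mulVec,
          smul_add, smul_sub]
        abel
      rw [e]
      have h1 := norm_mulVec_le (U y t) (E s y - E t y - ((s - t : ℝ) : ℂ) • (V y t *ᵥ E t y))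
      have h2 := norm_mulVec_le (U y s - U y t - ((s - t : ℝ) : ℂ) • Ut y t) (E s y)
      have h3 := norm_mulVec_le (Ut y t) (E s y - E t y)
      have h4 := hs2 y hy
      have h5 := hs3 y hy
      have h6 : ‖E s y‖ ≤ M + 1 := by
        have := norm_sub_norm_le (E s y) (E t y)
        have := hM y hy
        have : η ≤ 1 := min_le_left _ _
        linarith
      have h7 := mul_le_mul_of_nonneg_right (hK y hy)
        (norm_nonneg (E s y - E t y - ((s - t : ℝ) : ℂ) • (V y t *ᵥ E t y)))
      have h8 : mnorm (U y s - U y t - ((s - t : ℝ) : ℂ) • Ut y t) * ‖E s y‖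
          ≤ η * |s - t| * (M + 1) := mul_le_mul h4 h6 (norm_nonneg _) (by positivity)
      have h9 : mnorm (Ut y t) * ‖E s y - E t y‖ ≤ K' * η :=
        mul_le_mul (hK' y hy) h5 (norm_nonneg _) (by linarith)
      have h10 : ‖((s - t : ℝ) : ℂ) • (Ut y t *ᵥ (E s y - E t y))‖ ≤ |s - t| * (K' * η) := by
        rw [norm_smul, Complex.norm_real, Real.norm_eq_abs]
        exact mul_le_mul_of_nonneg_left (h3.trans h9) (abs_nonneg _)
      refine (norm_add₃_le).trans ?_
      linarith) x hxR
  have h1 : η ≤ ε / ((2 + M + K') * Real.exp (K * R)) := min_le_right _ _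
  rw [le_div_iff₀ (by positivity)] at h1
  have h2 : ‖E s x - E t x - (s - t) • (V x t *ᵥ E t x)‖
      = ‖E s x - E t x - ((s - t : ℝ) : ℂ) • (V x t *ᵥ E t x)‖ := by
    congr 2
  rw [h2, Real.norm_eq_abs]
  refine h.trans ?_
  calc (η * |s - t| + η * (M + 1 + K') * |s - t|) * Real.exp (K * R)
      = η * ((2 + M + K') * Real.exp (K * R)) * |s - t| := by ring
    _ ≤ ε * |s - t| := mul_le_mul_of_nonneg_right h1 (abs_nonneg _)

/-- Propagation of an asymptotic value by `w' = N w` when `N ξ → 0` uniformly. -/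
theorem tendsto_of_evolution {w : ℝ → ℝ → Fin n → ℂ} {N : ℝ → ℝ → Matrix (Fin n) (Fin n) ℂ}
    {N₀ : Matrix (Fin n) (Fin n) ℂ} {ξ : Fin n → ℂ} {l : Filter ℝ}
    (hw : ∀ x t, HasDerivAt (fun s => w x s) (N x t *ᵥ w x t) t)
    (hN : ∀ T i j, Tendsto (fun p : ℝ × ℝ => N p.1 p.2 i j) (l ×ˢ 𝓟 (Set.Icc (-T) T))
      (𝓝 (N₀ i j))) (hξ : N₀ *ᵥ ξ = 0) (h0 : Tendsto (fun x => w x 0) l (𝓝 ξ)) (t : ℝ) :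
    Tendsto (fun x => w x t) l (𝓝 ξ) := by
  set T := |t|
  have hm : Tendsto (fun p : ℝ × ℝ => mnorm (N p.1 p.2)) (l ×ˢ 𝓟 (Set.Icc (-T) T))
      (𝓝 (mnorm N₀)) :=
    tendsto_finsetSum _ fun i _ => tendsto_finsetSum _ fun j _ => (hN T i j).norm
  have hv : Tendsto (fun p : ℝ × ℝ => N p.1 p.2 *ᵥ ξ) (l ×ˢ 𝓟 (Set.Icc (-T) T)) (𝓝 0) := by
    rw [← hξ]
    refine tendsto_pi_nhds.2 fun i => ?_
    simp only [mulVec, dotProduct]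
    exact tendsto_finsetSum _ fun j _ => (hN T i j).mul_const _
  set K := mnorm N₀ + 1
  have hK : 1 ≤ K := by have := mnorm_nonneg N₀; linarith
  rw [Metric.tendsto_nhds]
  intro ε hε
  set η := ε / (3 * Real.exp (K * T)) with hη
  have hηpos : 0 < η := by positivity
  have e1 := eventually_prod_principal_iff.1 (hm.eventually_lt_const (lt_add_one (mnorm N₀)))
  have e2 := eventually_prod_principal_iff.1
    (hv.norm.eventually_lt_const (by simpa using hηpos : ‖(0 : Fin n → ℂ)‖ < η))
  filter_upwards [e1, e2, (Metric.tendsto_nhds.1 h0) η hηpos] with x h1 h2 h3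
  rw [dist_eq_norm] at h3 ⊢
  -- The deviation `w - ξ` obeys the equation with forcing `N ξ`, uniformly small on `[-T, T]` near
  -- the end. Initial error and forcing, both below `η`, together give `2ε/3`.
  have h := norm_le_of_norm_deriv_le (f := fun s => w x s - ξ) (f' := fun s => N x s *ᵥ w x s)
    (δ := η) (ε := η) (K := K) (T := T) hK hηpos.le hηpos.le (fun s => (hw x s).sub_const ξ) h3.le
    (fun s hs => by
      have e : N x s *ᵥ w x s = N x s *ᵥ (w x s - ξ) + N x s *ᵥ ξ := by rw [mulVec_sub]; abel
      rw [e]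
      refine (norm_add_le _ _).trans (add_le_add ?_ (h2 s hs).le)
      exact (norm_mulVec_le _ _).trans (mul_le_mul_of_nonneg_right (h1 s hs).le (norm_nonneg _)))
    t (abs_le.1 le_rfl)
  refine h.trans_lt ?_
  have : (η + η) * Real.exp (K * T) = 2 / 3 * ε := by
    rw [hη]
    field_simp
    ring
  rw [this]
  linarith

end CMKdV

/-! ### The zero-curvature identity -/

namespace CMKdV

section MatrixDeriv

variable {n : ℕ}

/-- Entrywise differentiability of a matrix function. -/
def MDer (M : ℝ → Matrix (Fin n) (Fin n) ℂ) (M' : Matrix (Fin n) (Fin n) ℂ) (x : ℝ) : Prop :=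
  ∀ i j, HasDerivAt (fun y => M y i j) (M' i j) x

variable {M N : ℝ → Matrix (Fin n) (Fin n) ℂ} {M' N' : Matrix (Fin n) (Fin n) ℂ} {x : ℝ}

theorem MDer.const (A : Matrix (Fin n) (Fin n) ℂ) : MDer (fun _ => A) 0 x :=
  fun i j => hasDerivAt_const x (A i j)

theorem MDer.add (hM : MDer M M' x) (hN : MDer N N' x) : MDer (fun y => M y + N y) (M' + N') x :=
  fun i j => (hM i j).add (hN i j)

theorem MDer.sub (hM : MDer M M' x) (hN : MDer N N' x) : MDer (fun y => M y - N y) (M' - N') x :=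
  fun i j => (hM i j).sub (hN i j)

theorem MDer.const_smul (c : ℂ) (hM : MDer M M' x) : MDer (fun y => c • M y) (c • M') x :=
  fun i j => (hM i j).const_mul c

theorem MDer.mul (hM : MDer M M' x) (hN : MDer N N' x) :
    MDer (fun y => M y * N y) (M' * N x + M x * N') x := by
  intro i j
  simp only [Matrix.mul_apply, Matrix.add_apply, ← Finset.sum_add_distrib]
  exact HasDerivAt.fun_sum fun k _ => (hM i k).mul (hN k j)

end MatrixDeriv

section Qmat

/-- `Qmat` with independent entries. -/
def Qgen (a b c d : ℂ) : Matrix (Fin 3) (Fin 3) ℂ := !![0, 0, a; 0, 0, b; -c, -d, 0]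

theorem Qmat_eq_Qgen (w : C2) : Qmat w = Qgen (w 0) (w 1) (conj (w 0)) (conj (w 1)) := rfl

theorem sigma3_eq : sigma3 = !![1, 0, 0; 0, 1, 0; 0, 0, -1] := by
  ext i j
  fin_cases i <;> fin_cases j <;> simp [sigma3]

-- With the conjugates treated as independent variables, zero curvature is a polynomial identity.
-- The left side is `V_x`; the `Qgen` term on the right is `Q_t` after substitution of the evolution
-- equation.
set_option maxHeartbeats 1000000 in
theorem zero_curvature_Qgen (κ a b c d a1 b1 c1 d1 a2 b2 c2 d2 a3 b3 c3 d3 : ℂ) :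
    let Q := Qgen a b c d
    let Q1 := Qgen a1 b1 c1 d1
    let Q2 := Qgen a2 b2 c2 d2
    let Q3 := Qgen a3 b3 c3 d3
    let V := (4 * Complex.I * κ ^ 3) • sigma3 + (4 * κ ^ 2) • Q
      - (2 * Complex.I * κ) • (sigma3 * (Q1 - Q ^ 2)) + (2 : ℂ) • Q ^ 3 - Q2 + (Q1 * Q - Q * Q1)
    let U := (Complex.I * κ) • sigma3 + Q
    (4 * κ ^ 2) • Q1 - (2 * Complex.I * κ) • (sigma3 * (Q2 - (Q1 * Q + Q * Q1)))
        + (2 : ℂ) • ((Q1 * Q + Q * Q1) * Q + Q * Q * Q1) - Q3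
        + (Q2 * Q + Q1 * Q1 - (Q1 * Q1 + Q * Q2))
      = Qgen (-a3 - 3 * (a * c + b * d) * a1 - 3 * (c * a1 + d * b1) * a)
          (-b3 - 3 * (a * c + b * d) * b1 - 3 * (c * a1 + d * b1) * b)
          (-c3 - 3 * (a * c + b * d) * c1 - 3 * (a * c1 + b * d1) * c)
          (-d3 - 3 * (a * c + b * d) * d1 - 3 * (a * c1 + b * d1) * d) + U * V - V * U := by
  have hI : Complex.I ^ 2 = -1 := Complex.I_sq
  intro Q Q1 Q2 Q3 V U
  ext i j
  fin_cases i <;> fin_cases j <;>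
    (simp [V, U, Q, Q1, Q2, Q3, Qgen, sigma3_eq, pow_succ]
     ring_nf
     try simp only [hI]
     try ring)

end Qmat

end CMKdV

/-! ### The Lax pair of a solution: regularity, compatibility and limits -/

namespace CMKdV

namespace NZBCSolution

variable (S : NZBCSolution)

theorem dx_zero (x t : ℝ) : dx S.q 0 x t = S.q x t := by simp [dx]

theorem hasDerivAt_dx {n : ℕ} (hn : n < 3) (x t : ℝ) :
    HasDerivAt (fun y => dx S.q n y t) (dx S.q (n + 1) x t) x := by
  have h := (S.contDiff_x t).differentiable_iteratedDeriv n (by exact_mod_cast hn)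
  have h2 := (h x).hasDerivAt
  unfold dx
  rw [iteratedDeriv_succ]
  exact h2

theorem hasDerivAt_q_x (x t : ℝ) : HasDerivAt (fun y => S.q y t) (dx S.q 1 x t) x := by
  have h := S.hasDerivAt_dx (n := 0) (by norm_num) x t
  simpa only [dx_zero, zero_add] using h

/-- The time derivative, as given by the equation. -/
def qt (x t : ℝ) : C2 := -(dx S.q 3 x t) - (3 * (‖S.q x t‖ : ℂ) ^ 2) • dx S.q 1 x t
    - (3 * inner ℂ (S.q x t) (dx S.q 1 x t)) • S.q x t

theorem hasDerivAt_q_t (x t : ℝ) : HasDerivAt (fun s => S.q x s) (S.qt x t) t := by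
  have h := (S.differentiable_t x t).hasDerivAt
  have e : deriv (fun s => S.q x s) t = S.qt x t := by
    have h1 := S.equation x t
    rw [qt, ← sub_eq_zero, ← h1]
    abel
  rwa [e] at h

theorem hasDerivAt_apply {f : ℝ → C2} {f' : C2} {x : ℝ} (h : HasDerivAt f f' x) (i : Fin 2) :
    HasDerivAt (fun y => f y i) (f' i) x :=
  ((EuclideanSpace.proj (𝕜 := ℂ) i).restrictScalars ℝ).hasFDerivAt.comp_hasDerivAt x h

theorem mder_Qmat {f : ℝ → C2} {f' : C2} {x : ℝ} (h : HasDerivAt f f' x) :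
    MDer (fun y => Qmat (f y)) (Qmat f') x := by
  have h0 := hasDerivAt_apply h 0
  have h1 := hasDerivAt_apply h 1
  have h2 : HasDerivAt (fun y => conj (f y 0)) (conj (f' 0)) x := h0.star
  have h3 : HasDerivAt (fun y => conj (f y 1)) (conj (f' 1)) x := h1.star
  intro i j
  fin_cases i <;> fin_cases j <;> simp [Qmat] <;>
    first | exact hasDerivAt_const _ _ | exact h0 | exact h1 | exact h2.neg | exact h3.neg

theorem norm_sq_eq (w : C2) : ((‖w‖ : ℝ) : ℂ) ^ 2 = w 0 * conj (w 0) + w 1 * conj (w 1) := by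
  rw [← Complex.ofReal_pow, EuclideanSpace.norm_sq_eq, Fin.sum_univ_two, Complex.mul_conj,
    Complex.mul_conj, Complex.normSq_eq_norm_sq, Complex.normSq_eq_norm_sq]
  push_cast
  rfl

theorem inner_eq (w v : C2) : inner ℂ w v = conj (w 0) * v 0 + conj (w 1) * v 1 := by
  simp [PiLp.inner_apply, Fin.sum_univ_two, mul_comm]

theorem Qmat_qt (x t : ℝ) :
    let a := S.q x t 0
    let b := S.q x t 1
    let a1 := dx S.q 1 x t 0
    let b1 := dx S.q 1 x t 1
    let a3 := dx S.q 3 x t 0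
    let b3 := dx S.q 3 x t 1
    Qmat (S.qt x t) = Qgen (-a3 - 3 * (a * conj a + b * conj b) * a1 - 3 * (conj a * a1 + conj b * b1) * a)
          (-b3 - 3 * (a * conj a + b * conj b) * b1 - 3 * (conj a * a1 + conj b * b1) * b)
          (-conj a3 - 3 * (a * conj a + b * conj b) * conj a1 - 3 * (a * conj a1 + b * conj b1) * conj a)
          (-conj b3 - 3 * (a * conj a + b * conj b) * conj b1
            - 3 * (a * conj a1 + b * conj b1) * conj b) := by
  intro a b a1 b1 a3 b3
  have h0 : S.qt x t 0 = -a3 - 3 * (a * conj a + b * conj b) * a1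
      - 3 * (conj a * a1 + conj b * b1) * a := by
    simp [qt, norm_sq_eq, inner_eq, a, b, a1, b1, a3]
  have h1 : S.qt x t 1 = -b3 - 3 * (a * conj a + b * conj b) * b1
      - 3 * (conj a * a1 + conj b * b1) * b := by
    simp [qt, norm_sq_eq, inner_eq, a, b, a1, b1, b3]
  rw [Qmat_eq_Qgen, h0, h1]
  congr 1
  · simp only [map_sub, map_mul, map_neg, map_add, Complex.conj_conj, map_ofNat]
    ring
  · simp only [map_sub, map_mul, map_neg, map_add, Complex.conj_conj, map_ofNat]
    ring

theorem continuous_q : Continuous fun p : ℝ × ℝ => S.q p.1 p.2 := by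
  have h := S.continuous_dx 0 (by norm_num)
  simpa only [dx_zero] using h

theorem tendsto_apply {X : Type*} {l : Filter X} {f : X → C2} {w : C2} (h : Tendsto f l (𝓝 w))
    (i : Fin 2) : Tendsto (fun x => f x i) l (𝓝 (w i)) :=
  ((EuclideanSpace.proj (𝕜 := ℂ) i).continuous.tendsto w).comp h

theorem tendsto_Qmat {X : Type*} {l : Filter X} {f : X → C2} {w : C2} (h : Tendsto f l (𝓝 w)) :
    Tendsto (fun x => Qmat (f x)) l (𝓝 (Qmat w)) := by
  have h0 := tendsto_apply h 0
  have h1 := tendsto_apply h 1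
  have h2 := (Complex.continuous_conj.tendsto _).comp h0
  have h3 := (Complex.continuous_conj.tendsto _).comp h1
  refine tendsto_pi_nhds.2 fun i => tendsto_pi_nhds.2 fun j => ?_
  fin_cases i <;> fin_cases j <;> simp [Qmat] <;>
    first | exact tendsto_const_nhds | exact h0 | exact h1 | exact h2 | exact h3

theorem continuous_Qmat {X : Type*} [TopologicalSpace X] {f : X → C2} (h : Continuous f) :
    Continuous fun x => Qmat (f x) :=
  continuous_iff_continuousAt.2 fun _ => tendsto_Qmat h.continuousAt

/-- The time derivative `V` as a function of the jet of the potential. -/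
def Vgen (κ : ℂ) (Q Qx Qxx : Matrix (Fin 3) (Fin 3) ℂ) : Matrix (Fin 3) (Fin 3) ℂ :=
  (4 * Complex.I * κ ^ 3) • sigma3 + (4 * κ ^ 2) • Q
    - (2 * Complex.I * κ) • (sigma3 * (Qx - Q ^ 2)) + (2 : ℂ) • Q ^ 3 - Qxx + (Qx * Q - Q * Qx)

theorem V_eq_Vgen (κ : ℂ) (x t : ℝ) :
    S.V κ x t = Vgen κ (Qmat (S.q x t)) (Qmat (dx S.q 1 x t)) (Qmat (dx S.q 2 x t)) := rfl

theorem tendsto_Vgen (κ : ℂ) {X : Type*} {l : Filter X} {f g h : X → Matrix (Fin 3) (Fin 3) ℂ}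
    {a b c : Matrix (Fin 3) (Fin 3) ℂ} (hf : Tendsto f l (𝓝 a)) (hg : Tendsto g l (𝓝 b))
    (hh : Tendsto h l (𝓝 c)) :
    Tendsto (fun x => Vgen κ (f x) (g x) (h x)) l (𝓝 (Vgen κ a b c)) := by
  unfold Vgen
  exact ((((tendsto_const_nhds.add (hf.const_smul _)).sub
    ((tendsto_const_nhds.mul (hg.sub (hf.pow 2))).const_smul _)).add ((hf.pow 3).const_smul _)).sub
    hh).add ((hg.mul hf).sub (hf.mul hg))

theorem continuous_U (κ : ℂ) : Continuous fun p : ℝ × ℝ => S.U κ p.1 p.2 := by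
  unfold U
  exact continuous_const.add (continuous_Qmat S.continuous_q)

theorem continuous_V (κ : ℂ) : Continuous fun p : ℝ × ℝ => S.V κ p.1 p.2 := by
  simp only [V_eq_Vgen]
  exact continuous_iff_continuousAt.2 fun p =>
    tendsto_Vgen κ (continuous_Qmat S.continuous_q).continuousAt
      (continuous_Qmat (S.continuous_dx 1 (by norm_num))).continuousAt
      (continuous_Qmat (S.continuous_dx 2 (by norm_num))).continuousAt

theorem continuous_qt : Continuous fun p : ℝ × ℝ => S.qt p.1 p.2 := by
  have h0 := S.continuous_q
  have h1 := S.continuous_dx 1 (by norm_num)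
  have h3 := S.continuous_dx 3 (by norm_num)
  unfold qt
  fun_prop

/-- Differentiating `V` in `x` produces the third derivative of the potential, which the equation
exchanges for the time derivative. -/
theorem mder_V (κ : ℂ) (x t : ℝ) : MDer (fun y => S.V κ y t)
    (Qmat (S.qt x t) + S.U κ x t * S.V κ x t - S.V κ x t * S.U κ x t) x := by
  have hQ := mder_Qmat (S.hasDerivAt_q_x x t)
  have hQ1 := mder_Qmat (S.hasDerivAt_dx (n := 1) (by norm_num) x t)
  have hQ2 := mder_Qmat (S.hasDerivAt_dx (n := 2) (by norm_num) x t)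
  have hQQ := hQ.mul hQ
  have h := ((((((MDer.const ((4 * Complex.I * κ ^ 3) • sigma3)).add (hQ.const_smul (4 * κ ^ 2))).sub
    (((MDer.const sigma3).mul (hQ1.sub hQQ)).const_smul (2 * Complex.I * κ))).add
    ((hQQ.mul hQ).const_smul 2)).sub hQ2).add ((hQ1.mul hQ).sub (hQ.mul hQ1)))
  have hz := zero_curvature_Qgen κ (S.q x t 0) (S.q x t 1) (conj (S.q x t 0)) (conj (S.q x t 1))
    (dx S.q 1 x t 0) (dx S.q 1 x t 1) (conj (dx S.q 1 x t 0)) (conj (dx S.q 1 x t 1))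
    (dx S.q 2 x t 0) (dx S.q 2 x t 1) (conj (dx S.q 2 x t 0)) (conj (dx S.q 2 x t 1))
    (dx S.q 3 x t 0) (dx S.q 3 x t 1) (conj (dx S.q 3 x t 0)) (conj (dx S.q 3 x t 1))
  simp only [← Qmat_eq_Qgen] at hz
  have hqt := S.Qmat_qt x t
  simp only at hqt
  rw [← hqt] at hz
  have e : Qmat (S.qt x t) + S.U κ x t * S.V κ x t - S.V κ x t * S.U κ x t = _ := hz.symm
  rw [e]
  intro i j
  refine ((h i j).congr_of_eventuallyEq (Eventually.of_forall fun y => ?_)).congr_deriv ?_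
  · simp only [V, pow_succ, pow_zero, one_mul]
  · simp only [zero_add, zero_mul]

theorem exists_lax (κ : ℂ) (v : Fin 3 → ℂ) :
    ∃ E : ℝ → ℝ → Fin 3 → ℂ, E 0 0 = v ∧
      (∀ x t, HasDerivAt (fun y => E y t) (S.U κ x t *ᵥ E x t) x) ∧
      ∀ x t, HasDerivAt (fun s => E x s) (S.V κ x t *ᵥ E x t) t := by
  refine exists_lax_solution (Ut := fun x t => Qmat (S.qt x t))
    (fun i j => (S.continuous_U κ).matrix_elem i j) (fun i j => (S.continuous_V κ).matrix_elem i j)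
    (fun i j => (continuous_Qmat S.continuous_qt).matrix_elem i j) (fun x t i j => ?_)
    (fun x t => S.mder_V κ x t) v
  have := (MDer.const (x := t) ((Complex.I * κ) • sigma3)).add (mder_Qmat (S.hasDerivAt_q_t x t))
  rw [zero_add] at this
  exact this i j

/-- The boundary value at the end `+∞` (`true`) or `-∞` (`false`). -/
def qEnd (b : Bool) : C2 := bif b then S.qPlus else S.qMinus

/-- The filter of the end. -/
def endFilter (b : Bool) : Filter ℝ := bif b then atTop else atBot

theorem tendsto_q (b : Bool) (T : ℝ) : Tendsto (fun p : ℝ × ℝ => S.q p.1 p.2)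
    (endFilter b ×ˢ 𝓟 (Set.Icc (-T) T)) (𝓝 (S.qEnd b)) := by
  cases b
  · exact tendsto_prod_principal_iff.2 (S.tendsto_minus T)
  · exact tendsto_prod_principal_iff.2 (S.tendsto_plus T)

theorem tendsto_dx (b : Bool) {n : ℕ} (hn : n = 1 ∨ n = 2) (T : ℝ) :
    Tendsto (fun p : ℝ × ℝ => dx S.q n p.1 p.2)
    (endFilter b ×ˢ 𝓟 (Set.Icc (-T) T)) (𝓝 0) := by
  cases b
  · exact tendsto_prod_principal_iff.2 (S.tendsto_dx_minus n hn T)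
  · exact tendsto_prod_principal_iff.2 (S.tendsto_dx_plus n hn T)

theorem Qmat_zero : Qmat 0 = 0 := by
  ext i j
  fin_cases i <;> fin_cases j <;> simp [Qmat]

theorem tendsto_V (κ : ℂ) (b : Bool) (T : ℝ) : Tendsto (fun p : ℝ × ℝ => S.V κ p.1 p.2)
    (endFilter b ×ˢ 𝓟 (Set.Icc (-T) T)) (𝓝 (Vgen κ (Qmat (S.qEnd b)) 0 0)) := by
  have h1 := tendsto_Qmat (S.tendsto_dx b (Or.inl rfl) T)
  have h2 := tendsto_Qmat (S.tendsto_dx b (Or.inr rfl) T)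
  rw [Qmat_zero] at h1 h2
  simp only [V_eq_Vgen]
  exact tendsto_Vgen κ (tendsto_Qmat (S.tendsto_q b T)) h1 h2

end NZBCSolution

end CMKdV

/-! ### Diagonalisation of the limiting Lax pair -/

namespace CMKdV

section Algebra

/-- `Gam` with independent entries. -/
def Ggen (a b c d q z : ℂ) : Matrix (Fin 3) (Fin 3) ℂ :=
  !![a / q, d / q, Complex.I * a / z; b / q, -c / q, Complex.I * b / z; Complex.I * q / z, 0, 1]

/-- The inverse of `Ggen`. -/
def GgenInv (a b c d q z : ℂ) : Matrix (Fin 3) (Fin 3) ℂ :=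
  !![c / q / (1 + q ^ 2 / z ^ 2), d / q / (1 + q ^ 2 / z ^ 2),
      -(Complex.I * q / z) / (1 + q ^ 2 / z ^ 2);
     b / q, -a / q, 0;
     -(Complex.I * c / z) / (1 + q ^ 2 / z ^ 2), -(Complex.I * d / z) / (1 + q ^ 2 / z ^ 2),
      1 / (1 + q ^ 2 / z ^ 2)]

variable {a b c d q z : ℂ}

theorem GgenInv_mul_Ggen (hs : a * c + b * d = q ^ 2) (hq : q ≠ 0) (hz : z ≠ 0)
    (hg : z ^ 2 + q ^ 2 ≠ 0) : GgenInv a b c d q z * Ggen a b c d q z = 1 := by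
  have hI : Complex.I ^ 2 = -1 := Complex.I_sq
  have hgam : 1 + q ^ 2 / z ^ 2 = (z ^ 2 + q ^ 2) / z ^ 2 := by field_simp
  ext i j
  fin_cases i <;> fin_cases j <;> simp [GgenInv, Ggen, Matrix.mul_apply, Fin.sum_univ_three, hgam] <;>
    field_simp <;> first
      | ring1
      | linear_combination hs
      | linear_combination (z ^ 2) * hs - q ^ 4 * hI
      | linear_combination (z * Complex.I) * hs
      | linear_combination (-z * Complex.I) * hs
      | linear_combination hs - (a * c + b * d) * hI

theorem U_mul_Ggen (hs : a * c + b * d = q ^ 2) (hq : q ≠ 0) (hz : z ≠ 0) :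
    ((Complex.I * ((z - q ^ 2 / z) / 2)) • sigma3 + Qgen a b c d) * Ggen a b c d q z
      = Ggen a b c d q z * diagonal (fun j => Complex.I * (![(z + q ^ 2 / z) / 2,
        (z - q ^ 2 / z) / 2, -((z + q ^ 2 / z) / 2)] : Fin 3 → ℂ) j) := by
  have hI : Complex.I ^ 2 = -1 := Complex.I_sq
  ext i j
  fin_cases i <;> fin_cases j <;> simp [Ggen, Qgen, sigma3_eq, Matrix.mul_apply,
    Fin.sum_univ_three] <;>
    field_simp <;> first
      | ring1
      | linear_combination (2 * a * z ^ 2) * hI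
      | linear_combination (2 * b * z ^ 2) * hI
      | linear_combination (-2 * z ^ 2) * hs - (2 * z ^ 2 * q ^ 2) * hI
      | linear_combination (-2 : ℂ) * hs

/-- The eigenvectors of the limiting `U` also diagonalise the limiting `V`; the eigenvalues found
here are the `t`-coefficients of `iθ`. -/
theorem V_mul_Ggen (hs : a * c + b * d = q ^ 2) (hq : q ≠ 0) (hz : z ≠ 0) :
    (let κ := (z - q ^ 2 / z) / 2
     let l := (z + q ^ 2 / z) / 2
     let Q := Qgen a b c d
    ((4 * Complex.I * κ ^ 3) • sigma3 + (4 * κ ^ 2) • Q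
    - (2 * Complex.I * κ) • (sigma3 * (0 - Q ^ 2)) + (2 : ℂ) • Q ^ 3 - 0 + (0 * Q - Q * 0))
       * Ggen a b c d q z
      = Ggen a b c d q z * diagonal (fun j => Complex.I * (![2 * l * (2 * κ ^ 2 - q ^ 2),
        4 * κ ^ 3, -(2 * l * (2 * κ ^ 2 - q ^ 2))] : Fin 3 → ℂ) j)) := by
  have hI : Complex.I ^ 2 = -1 := Complex.I_sq
  intro κ l Q
  have hQ2 : Q ^ 2 = !![-a * c, -a * d, 0; -b * c, -b * d, 0; 0, 0, -q ^ 2] := by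
    ext i j
    fin_cases i <;> fin_cases j <;> simp [Q, Qgen, pow_two]
    linear_combination -hs
  -- Since `Q²` is block diagonal and acts as `-q²` on the range of `Q`, the cubic term of `V`
  -- reduces to a multiple of `Q`.
  have hQ3 : Q ^ 3 = -(q ^ 2) • Q := by
    rw [pow_succ, hQ2]
    ext i j
    fin_cases i <;> fin_cases j <;> simp [Q, Qgen] <;> first
      | ring1
      | linear_combination (-a) * hs
      | linear_combination (-b) * hs
  rw [hQ3, hQ2]
  ext i j
  fin_cases i <;> fin_cases j <;> simp [Q, κ, l, Ggen, Qgen, sigma3_eq, Matrix.mul_apply,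
    Fin.sum_univ_three] <;>
    field_simp <;> first
      | ring1
      | linear_combination (-8 * a * z ^ 2 * (z ^ 2 - q ^ 2)) * hs
      | linear_combination (-8 * b * z ^ 2 * (z ^ 2 - q ^ 2)) * hs
      | linear_combination (-8 * a * Complex.I ^ 2 * z ^ 2 * (z ^ 2 - q ^ 2)) * hs
          + (a * (4 * (z ^ 2 - q ^ 2) ^ 2 - 8 * z ^ 2 * q ^ 2) * 2 * z ^ 2) * hI
      | linear_combination (-8 * b * Complex.I ^ 2 * z ^ 2 * (z ^ 2 - q ^ 2)) * hs
          + (b * (4 * (z ^ 2 - q ^ 2) ^ 2 - 8 * z ^ 2 * q ^ 2) * 2 * z ^ 2) * hI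
      | linear_combination (-(4 * (z ^ 2 - q ^ 2) ^ 2 - 8 * z ^ 2 * q ^ 2) * 2 * z ^ 2) * hs
          - ((4 * (z ^ 2 - q ^ 2) ^ 2 - 8 * z ^ 2 * q ^ 2) * 2 * z ^ 2 * q ^ 2) * hI
      | linear_combination (-2 * (4 * (z ^ 2 - q ^ 2) ^ 2 - 8 * z ^ 2 * q ^ 2)) * hs

end Algebra

namespace NZBCSolution

variable (S : NZBCSolution)

theorem q0_pos : 0 < S.q0 := norm_pos_iff.2 S.qvec_ne

theorem q0_ne : (S.q0 : ℂ) ≠ 0 := Complex.ofReal_ne_zero.2 S.q0_pos.ne'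

theorem norm_exp_I_smul (r : ℝ) (w : C2) : ‖Complex.exp (Complex.I * r) • w‖ = ‖w‖ := by
  rw [norm_smul, mul_comm Complex.I, Complex.norm_exp_ofReal_mul_I, one_mul]

theorem norm_qEnd (b : Bool) : ‖S.qEnd b‖ = S.q0 := by
  cases b <;> exact norm_exp_I_smul _ _

theorem qEnd_sq (b : Bool) : S.qEnd b 0 * conj (S.qEnd b 0) + S.qEnd b 1 * conj (S.qEnd b 1)
    = (S.q0 : ℂ) ^ 2 := by
  rw [← norm_sq_eq, norm_qEnd]

/-- The exponents `(λ, k, -λ)`. -/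
def kap (j : Fin 3) (z : ℂ) : ℂ := ![S.lam z, S.k z, -S.lam z] j

/-- The coefficients of `t` in `θ`. -/
def om (j : Fin 3) (z : ℂ) : ℂ := ![2 * S.lam z * (2 * S.k z ^ 2 - (S.q0 : ℂ) ^ 2), 4 * S.k z ^ 3,
  -(2 * S.lam z * (2 * S.k z ^ 2 - (S.q0 : ℂ) ^ 2))] j

theorem theta_eq (j : Fin 3) (x t : ℝ) (z : ℂ) :
    S.theta j x t z = S.kap j z * x + S.om j z * t := by
  fin_cases j <;> simp [theta, kap, om, theta1, theta2] <;> ring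

/-- The inverse of `Gam`. -/
def GamInv (w : C2) (z : ℂ) : Matrix (Fin 3) (Fin 3) ℂ :=
  !![conj (w 0) / S.q0 / S.gam z, conj (w 1) / S.q0 / S.gam z, -(Complex.I * S.q0 / z) / S.gam z;
     w 1 / S.q0, -(w 0) / S.q0, 0;
     -(Complex.I * conj (w 0) / z) / S.gam z, -(Complex.I * conj (w 1) / z) / S.gam z, 1 / S.gam z]

variable {S}

theorem Regular.sq_ne {z : ℂ} (h : S.Regular z) : z ^ 2 + (S.q0 : ℂ) ^ 2 ≠ 0 := by
  intro h0
  apply h.2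
  have := h.1
  rw [gam]
  field_simp
  simpa using h0

variable {z : ℂ}

theorem GamInv_mul_Gam (b : Bool) (h : S.Regular z) :
    S.GamInv (S.qEnd b) z * S.Gam (S.qEnd b) z = 1 :=
  GgenInv_mul_Ggen (S.qEnd_sq b) S.q0_ne h.1 h.sq_ne

theorem Gam_mul_GamInv (b : Bool) (h : S.Regular z) :
    S.Gam (S.qEnd b) z * S.GamInv (S.qEnd b) z = 1 :=
  mul_eq_one_comm.1 (GamInv_mul_Gam b h)

theorem Uinf_mul_Gam (b : Bool) (h : S.Regular z) :
    ((Complex.I * S.k z) • sigma3 + Qmat (S.qEnd b)) * S.Gam (S.qEnd b) z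
      = S.Gam (S.qEnd b) z * diagonal (fun j => Complex.I * S.kap j z) :=
  U_mul_Ggen (S.qEnd_sq b) S.q0_ne h.1

theorem Vinf_mul_Gam (b : Bool) (h : S.Regular z) :
    Vgen (S.k z) (Qmat (S.qEnd b)) 0 0 * S.Gam (S.qEnd b) z
      = S.Gam (S.qEnd b) z * diagonal (fun j => Complex.I * S.om j z) :=
  V_mul_Ggen (S.qEnd_sq b) S.q0_ne h.1

/-- This is the condition `N₀ *ᵥ ξ = 0` under which `tendsto_of_evolution` carries the asymptotic
value through time. -/
theorem Vinf_mulVec_Gam (b : Bool) (h : S.Regular z) (j : Fin 3) :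
    (Vgen (S.k z) (Qmat (S.qEnd b)) 0 0 - (Complex.I * S.om j z) • 1) *ᵥ
      (fun i => S.Gam (S.qEnd b) z i j) = 0 := by
  have h1 := congrArg (fun M => M *ᵥ (Pi.single j 1 : Fin 3 → ℂ)) (Vinf_mul_Gam b h)
  have h2 : (fun i => S.Gam (S.qEnd b) z i j) = S.Gam (S.qEnd b) z *ᵥ Pi.single j 1 := by
    rw [mulVec_single_one]; rfl
  simp only [← mulVec_mulVec] at h1
  rw [h2, sub_mulVec, h1, smul_mulVec, one_mulVec, ← mulVec_smul, ← mulVec_sub]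
  have h3 : (diagonal fun j => Complex.I * S.om j z) *ᵥ (Pi.single j 1 : Fin 3 → ℂ)
      = (Complex.I * S.om j z) • Pi.single j 1 := by
    ext i
    rw [mulVec_diagonal]
    by_cases hij : i = j
    · subst hij; simp
    · simp [hij]
  rw [h3, sub_self, mulVec_zero]

end NZBCSolution

end CMKdV

/-! ### Jost solutions of the spatial equation at fixed time -/

namespace CMKdV

namespace NZBCSolution

variable (S : NZBCSolution)

/-- The sign of the end. -/
def sg (b : Bool) : ℝ := bif b then 1 else -1

theorem sg_mul_self (b : Bool) : sg b * sg b = 1 := by cases b <;> simp [sg]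

theorem sg_mul_sg_mul (b : Bool) (x : ℝ) : sg b * (sg b * x) = x := by
  rw [← mul_assoc, sg_mul_self, one_mul]

theorem tendsto_sg_mul (b : Bool) : Tendsto (fun x => sg b * x) (endFilter b) atTop := by
  cases b
  · simpa [sg, endFilter] using tendsto_neg_atBot_atTop
  · simp only [sg, endFilter, cond_true, one_mul]
    exact tendsto_id

theorem tendsto_sg_mul' (b : Bool) : Tendsto (fun x => sg b * x) atTop (endFilter b) := by
  cases b
  · simpa [sg, endFilter] using tendsto_neg_atTop_atBot
  · simp only [sg, endFilter, cond_true, one_mul]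
    exact tendsto_id

/-- The points at which the `j`-th exponential is the smallest one at the end `b`. -/
def dom (b : Bool) (j : Fin 3) : Set ℂ :=
  {z | S.Regular z ∧ ∀ l, sg b * (S.kap l z).im ≤ sg b * (S.kap j z).im}

section Regularity

theorem differentiableOn_k : DifferentiableOn ℂ S.k {z | S.Regular z} := by
  intro z hz
  have := hz.1
  exact DifferentiableAt.differentiableWithinAt (by unfold k; fun_prop (disch := assumption))

theorem differentiableOn_lam : DifferentiableOn ℂ S.lam {z | S.Regular z} := by
  intro z hz
  have := hz.1
  exact DifferentiableAt.differentiableWithinAt (by unfold lam; fun_prop (disch := assumption))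

theorem differentiableOn_kap (j : Fin 3) : DifferentiableOn ℂ (S.kap j) {z | S.Regular z} := by
  have h1 := S.differentiableOn_k
  have h2 := S.differentiableOn_lam
  fin_cases j
  · exact h2
  · exact h1
  · exact h2.neg

theorem differentiableOn_gam : DifferentiableOn ℂ S.gam {z | S.Regular z} := by
  intro z hz
  have := pow_ne_zero 2 hz.1
  exact DifferentiableAt.differentiableWithinAt (by unfold gam; fun_prop (disch := assumption))

theorem differentiableOn_Gam (w : C2) (i j : Fin 3) :
    DifferentiableOn ℂ (fun z => S.Gam w z i j) {z | S.Regular z} := by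
  intro z hz
  have := hz.1
  refine DifferentiableAt.differentiableWithinAt ?_
  fin_cases i <;> fin_cases j <;> simp [Gam] <;> fun_prop (disch := assumption)

theorem differentiableOn_GamInv (w : C2) (i j : Fin 3) :
    DifferentiableOn ℂ (fun z => S.GamInv w z i j) {z | S.Regular z} := by
  have hg := S.differentiableOn_gam
  have hne : ∀ z ∈ {z | S.Regular z}, S.gam z ≠ 0 := fun z hz => hz.2
  have hI : ∀ c : ℂ, DifferentiableOn ℂ (fun z : ℂ => -(c / z)) {z | S.Regular z} := by
    intro c z hz
    have := hz.1
    exact DifferentiableAt.differentiableWithinAt (by fun_prop (disch := assumption))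
  have hc : ∀ c : ℂ, DifferentiableOn ℂ (fun _ : ℂ => c) {z | S.Regular z} :=
    fun c => differentiableOn_const c
  fin_cases i <;> fin_cases j
  · exact (hc _).fun_div hg hne
  · exact (hc _).fun_div hg hne
  · exact (hI _).fun_div hg hne
  · exact hc _
  · exact hc _
  · exact hc _
  · exact (hI _).fun_div hg hne
  · exact (hI _).fun_div hg hne
  · exact (hc _).fun_div hg hne

theorem continuousOn_mnorm {X : Type*} [TopologicalSpace X] {s : Set X}
    {M : X → Matrix (Fin 3) (Fin 3) ℂ} (h : ∀ i j, ContinuousOn (fun x => M x i j) s) :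
    ContinuousOn (fun x => mnorm (M x)) s :=
  continuousOn_finsetSum _ fun i _ => continuousOn_finsetSum _ fun j _ => (h i j).norm

end Regularity

theorem mnorm_Qmat_le (w : C2) : mnorm (Qmat w) ≤ 4 * ‖w‖ := by
  have h0 : ‖w 0‖ ≤ ‖w‖ := PiLp.norm_apply_le w 0
  have h1 : ‖w 1‖ ≤ ‖w‖ := PiLp.norm_apply_le w 1
  simp [mnorm, Qmat, Fin.sum_univ_three]
  linarith

theorem tailIntegrable_q (b : Bool) (t : ℝ) :
    TailIntegrable fun y => ‖S.q (sg b * y) t - S.qEnd b‖ where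
  cont := by
    have h : Continuous fun y : ℝ => S.q (sg b * y) t :=
      S.continuous_q.comp (by fun_prop : Continuous fun y : ℝ => (sg b * y, t))
    fun_prop
  nonneg := fun x => norm_nonneg _
  int := fun a => by
    cases b
    · have h := (S.integrable_minus t (-a)).norm
      have h2 := (Measure.measurePreserving_neg (volume : Measure ℝ)).integrableOn_comp_preimage
        (Homeomorph.neg ℝ).measurableEmbedding |>.2 h
      simp only [sg, qEnd, qMinus, cond_false, neg_one_mul]
      rw [Set.neg_preimage, Set.neg_Iio, neg_neg] at h2
      exact h2
    · simp only [sg, qEnd, qPlus, cond_true, one_mul]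
      exact (S.integrable_plus t a).norm

/-- The perturbation in the diagonalizing frame, in the variable `y = ± x`. -/
def pert (b : Bool) (t y : ℝ) (z : ℂ) : Matrix (Fin 3) (Fin 3) ℂ :=
  (sg b : ℂ) • (S.GamInv (S.qEnd b) z * Qmat (S.q (sg b * y) t - S.qEnd b) * S.Gam (S.qEnd b) z)

theorem norm_sg (b : Bool) : ‖(sg b : ℂ)‖ = 1 := by cases b <;> simp [sg]

theorem norm_pert_mulVec_le (b : Bool) (t y : ℝ) (z : ℂ) (v : Fin 3 → ℂ) :
    ‖S.pert b t y z *ᵥ v‖ ≤ 4 * (mnorm (S.GamInv (S.qEnd b) z) * mnorm (S.Gam (S.qEnd b) z))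
      * ‖S.q (sg b * y) t - S.qEnd b‖ * ‖v‖ := by
  rw [pert, smul_mulVec, norm_smul, norm_sg, one_mul]
  refine (norm_mulVec_le _ _).trans (mul_le_mul_of_nonneg_right ?_ (norm_nonneg v))
  refine (mnorm_mul_le _ _).trans ?_
  have h1 := mnorm_mul_le (S.GamInv (S.qEnd b) z) (Qmat (S.q (sg b * y) t - S.qEnd b))
  have h2 := mul_le_mul_of_nonneg_left (mnorm_Qmat_le (S.q (sg b * y) t - S.qEnd b))
    (mnorm_nonneg (S.GamInv (S.qEnd b) z))
  calc _ ≤ mnorm (S.GamInv (S.qEnd b) z) * (4 * ‖S.q (sg b * y) t - S.qEnd b‖)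
        * mnorm (S.Gam (S.qEnd b) z) :=
        mul_le_mul_of_nonneg_right (h1.trans h2) (mnorm_nonneg _)
    _ = _ := by ring

theorem continuous_pert (b : Bool) (t : ℝ) (z : ℂ) (i j : Fin 3) :
    Continuous fun y => S.pert b t y z i j := by
  have h : Continuous fun y : ℝ => S.q (sg b * y) t :=
    S.continuous_q.comp (by fun_prop : Continuous fun y : ℝ => (sg b * y, t))
  have h2 := continuous_Qmat (h.sub (continuous_const (y := S.qEnd b)))
  have h3 : Continuous fun y => S.pert b t y z := by
    have h4 : Continuous fun y => S.GamInv (S.qEnd b) z * Qmat (S.q (sg b * y) t - S.qEnd b)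
      * S.Gam (S.qEnd b) z := (continuous_const.mul h2).mul continuous_const
    exact h4.const_smul (sg b : ℂ)
  exact h3.matrix_elem i j

theorem differentiableOn_pert (b : Bool) (t y : ℝ) (i j : Fin 3) :
    DifferentiableOn ℂ (fun z => S.pert b t y z i j) {z | S.Regular z} := by
  simp only [pert, Matrix.smul_apply, Matrix.mul_apply, smul_eq_mul]
  refine DifferentiableOn.const_mul ?_ _
  refine DifferentiableOn.fun_sum fun l _ => DifferentiableOn.mul ?_ (S.differentiableOn_Gam _ _ _)
  exact DifferentiableOn.fun_sum fun m _ => (S.differentiableOn_GamInv _ _ _).mul_const _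

/-- The exponent of the propagator in the frame of the `j`-th exponential. -/
def expo (b : Bool) (j l : Fin 3) (z : ℂ) : ℂ := sg b * (Complex.I * (S.kap l z - S.kap j z))

/-- Membership in `dom` is what bounds every propagator by one for negative arguments, and what
makes the energy argument for uniqueness work. -/
theorem expo_re_nonneg {b : Bool} {j : Fin 3} {z : ℂ} (hz : z ∈ S.dom b j) (l : Fin 3) :
    0 ≤ (S.expo b j l z).re := by
  have h := hz.2 l
  rw [expo, Complex.re_ofReal_mul, Complex.I_mul_re, Complex.sub_im]
  linarith

theorem differentiableOn_expo (b : Bool) (j l : Fin 3) :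
    DifferentiableOn ℂ (S.expo b j l) {z | S.Regular z} :=
  (((S.differentiableOn_kap l).sub (S.differentiableOn_kap j)).const_mul Complex.I).const_mul _

/-- The Volterra data of the `j`-th Jost column at the end `b` and time `t`. -/
def jostKernel (b : Bool) (j : Fin 3) (t : ℝ) (W D : Set ℂ) (hD : IsOpen D) (hDW : D ⊆ W)
    (hW : W ⊆ S.dom b j) (c : ℝ) (hc0 : 0 ≤ c)
    (hc : ∀ z ∈ W, 4 * (mnorm (S.GamInv (S.qEnd b) z) * mnorm (S.Gam (S.qEnd b) z)) ≤ c) :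
    TailKernel 3 where
  g y := c * ‖S.q (sg b * y) t - S.qEnd b‖
  e l s z := Complex.exp (S.expo b j l z * s)
  B := S.pert b t
  W := W
  D := D
  isOpen_D := hD
  D_subset := hDW
  hg := (S.tailIntegrable_q b t).const_mul hc0
  e_le l s hs z hz := by
    rw [Complex.norm_exp, Real.exp_le_one_iff, Complex.re_mul_ofReal]
    exact mul_nonpos_of_nonneg_of_nonpos (S.expo_re_nonneg (hW hz) l) hs.le
  e_cont l s hs z hz := by
    have h1 : ContinuousWithinAt (S.expo b j l) W z :=
      ((S.differentiableOn_expo b j l).continuousOn.mono fun w hw => (hW hw).1) z hz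
    have hmap : Tendsto (fun p : ℝ × ℂ => p.2) (𝓝[Set.univ ×ˢ W] (s, z)) (𝓝[W] z) :=
      tendsto_nhdsWithin_iff.2 ⟨(continuous_snd.tendsto (s, z)).mono_left nhdsWithin_le_nhds,
        eventually_nhdsWithin_of_forall fun p hp => hp.2⟩
    have h2 : ContinuousWithinAt (fun p : ℝ × ℂ => S.expo b j l p.2) (Set.univ ×ˢ W) (s, z) :=
      Tendsto.comp (g := S.expo b j l) h1 hmap
    have h3 : ContinuousWithinAt (fun p : ℝ × ℂ => (p.1 : ℂ)) (Set.univ ×ˢ W) (s, z) :=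
      (Complex.continuous_ofReal.comp continuous_fst).continuousWithinAt
    exact (h2.mul h3).cexp
  e_diff l s := by
    have h := (S.differentiableOn_expo b j l).mono fun w hw => (hW (hDW hw)).1
    exact (h.mul_const _).cexp
  B_le y z hz v := by
    refine (S.norm_pert_mulVec_le b t y z v).trans ?_
    gcongr
    exact hc z hz
  B_cont z hz i j := S.continuous_pert b t z i j
  B_contOn y i j := (S.differentiableOn_pert b t y i j).continuousOn.mono fun w hw => (hW hw).1
  B_diff y i j := (S.differentiableOn_pert b t y i j).mono fun w hw => (hW (hDW hw)).1

/-- Jost solutions of the spatial equation at a fixed time. -/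
structure IsJostAt (b : Bool) (j : Fin 3) (t : ℝ) (z : ℂ) (ξ : Fin 3 → ℂ) (f : ℝ → Fin 3 → ℂ) :
    Prop where
  deriv : ∀ x, HasDerivAt f (S.U (S.k z) x t *ᵥ f x) x
  lim : Tendsto (fun x : ℝ => Complex.exp (-(Complex.I * S.kap j z * x)) • f x) (endFilter b) (𝓝 ξ)

variable {S} {b : Bool} {j : Fin 3} {z : ℂ}

theorem U_split (x t : ℝ) : S.U (S.k z) x t
    = ((Complex.I * S.k z) • sigma3 + Qmat (S.qEnd b)) + Qmat (S.q x t - S.qEnd b) := by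
  have : Qmat (S.q x t) = Qmat (S.qEnd b) + Qmat (S.q x t - S.qEnd b) := by
    ext i j
    fin_cases i <;> fin_cases j <;> simp [Qmat] <;> ring
  rw [U, this, add_assoc]

theorem ofReal_sg_mul_self (b : Bool) : (sg b : ℂ) * sg b = 1 := by
  rw [← Complex.ofReal_mul, sg_mul_self, Complex.ofReal_one]

/-- In the eigenvector frame `U` becomes its limiting eigenvalues plus `pert`. Subtracting the
`j`-th eigenvalue makes the wanted column asymptotically constant, and the sign turns either end
into `+∞`. Existence and uniqueness both pass through this identity. -/
theorem frame_eq (h : S.Regular z) (b : Bool) (j : Fin 3) (t y : ℝ) :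
    S.GamInv (S.qEnd b) z * ((sg b : ℂ) • (S.U (S.k z) (sg b * y) t - (Complex.I * S.kap j z) • 1))
      = (diagonal (fun l => S.expo b j l z) + S.pert b t y z) * S.GamInv (S.qEnd b) z := by
  have h1 := Gam_mul_GamInv b h
  have h2 := GamInv_mul_Gam b h
  have hd : diagonal (fun l => S.expo b j l z)
      = (sg b : ℂ) • (diagonal (fun l => Complex.I * S.kap l z) - (Complex.I * S.kap j z) • 1) := by
    ext i l
    by_cases hil : i = l
    · subst hil
      simp only [diagonal_apply_eq, Matrix.smul_apply, Matrix.sub_apply, Matrix.one_apply_eq,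
        smul_eq_mul, expo]
      ring
    · simp [hil]
  have hU : S.GamInv (S.qEnd b) z * ((Complex.I * S.k z) • sigma3 + Qmat (S.qEnd b))
      = diagonal (fun l => Complex.I * S.kap l z) * S.GamInv (S.qEnd b) z := by
    have h3 := congrArg (fun M => S.GamInv (S.qEnd b) z * M * S.GamInv (S.qEnd b) z)
      (Uinf_mul_Gam b h)
    simp only [Matrix.mul_assoc, h1, Matrix.mul_one] at h3
    rw [h3, ← Matrix.mul_assoc, h2, Matrix.one_mul]
  rw [U_split (b := b), hd, pert, Matrix.add_mul, smul_mul_assoc, smul_mul_assoc, mul_smul_comm,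
    ← smul_add, Matrix.mul_assoc _ (S.Gam (S.qEnd b) z), h1, Matrix.mul_one, Matrix.mul_sub,
    Matrix.mul_add, hU, Matrix.sub_mul]
  congr 1
  rw [mul_smul_comm, smul_mul_assoc, Matrix.mul_one, Matrix.one_mul]
  abel

theorem IsJostAt.sub {t : ℝ} {ξ η : Fin 3 → ℂ} {f g : ℝ → Fin 3 → ℂ}
    (hf : S.IsJostAt b j t z ξ f) (hg : S.IsJostAt b j t z η g) :
    S.IsJostAt b j t z (ξ - η) (fun x => f x - g x) where
  deriv x := by rw [mulVec_sub]; exact (hf.deriv x).sub (hg.deriv x)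
  lim := by simpa only [smul_sub] using hf.lim.sub hg.lim

/-- In the eigenvector frame, normalised by the `j`-th exponential, the solution satisfies the
hypotheses of `eq_zero_of_tendsto_zero`. -/
theorem IsJostAt.eq_zero (hz : z ∈ S.dom b j) {t : ℝ} {f : ℝ → Fin 3 → ℂ}
    (hf : S.IsJostAt b j t z 0 f) : f = 0 := by
  set u : ℝ → Fin 3 → ℂ := fun y => S.GamInv (S.qEnd b) z *ᵥ
    (Complex.exp (-(Complex.I * S.kap j z * ((sg b * y : ℝ) : ℂ))) • f (sg b * y)) with hu
  have hder : ∀ y, HasDerivAt u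
      ((diagonal (fun l => S.expo b j l z) + S.pert b t y z) *ᵥ u y) y := by
    intro y
    have h1 : HasDerivAt (fun y => f (sg b * y)) (sg b • (S.U (S.k z) (sg b * y) t *ᵥ f (sg b * y)))
        y := by
      have := (hf.deriv (sg b * y)).scomp y ((hasDerivAt_id y).const_mul (sg b))
      simpa [Function.comp_def] using this
    have h2 : HasDerivAt (fun y : ℝ => Complex.exp (-(Complex.I * S.kap j z * ((sg b * y : ℝ) : ℂ))))
        (Complex.exp (-(Complex.I * S.kap j z * ((sg b * y : ℝ) : ℂ)))
          * -(Complex.I * S.kap j z * ((sg b * 1 : ℝ) : ℂ))) y :=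
      ((((hasDerivAt_id y).const_mul (sg b)).ofReal_comp).const_mul _).fun_neg.cexp
    have h3 := hasDerivAt_mulVec (M := fun _ => S.GamInv (S.qEnd b) z) (M' := 0)
      (fun i j => hasDerivAt_const y _) (h2.smul h1)
    refine h3.congr_deriv ?_
    rw [hu]
    simp only [mulVec_mulVec, ← frame_eq hz.1]
    rw [zero_mulVec, zero_add, ← mulVec_mulVec]
    congr 1
    rw [smul_mulVec, sub_mulVec, smul_mulVec, one_mulVec, mulVec_smul, mul_one]
    ext i
    simp only [Pi.add_apply, Pi.smul_apply, Pi.sub_apply, smul_eq_mul, Complex.real_smul]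
    ring
  have hlim : Tendsto u atTop (𝓝 0) := by
    have h1 := hf.lim.comp (tendsto_sg_mul' b)
    have h2 : Continuous fun v : Fin 3 → ℂ => S.GamInv (S.qEnd b) z *ᵥ v :=
      continuous_mulVec_entries (fun _ _ => continuous_const) continuous_id
    have h3 := (h2.tendsto 0).comp h1
    rw [mulVec_zero] at h3
    exact h3
  have hzero := eq_zero_of_tendsto_zero
    ((S.tailIntegrable_q b t).const_mul (c := 4 * (mnorm (S.GamInv (S.qEnd b) z)
      * mnorm (S.Gam (S.qEnd b) z))) (by have := mnorm_nonneg (S.GamInv (S.qEnd b) z)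
                                         have := mnorm_nonneg (S.Gam (S.qEnd b) z)
                                         positivity))
    hder (S.expo_re_nonneg hz) (fun y v => S.norm_pert_mulVec_le b t y z v) hlim
  funext x
  have h1 := congrFun hzero (sg b * x)
  rw [hu] at h1
  simp only [sg_mul_sg_mul] at h1
  have h2 := congrArg (fun v => S.Gam (S.qEnd b) z *ᵥ v) h1
  simp only [mulVec_mulVec, Gam_mul_GamInv b hz.1, one_mulVec, Pi.zero_apply, mulVec_zero] at h2
  exact (smul_eq_zero.1 h2).resolve_left (Complex.exp_ne_zero _)

theorem IsJostAt.unique (hz : z ∈ S.dom b j) {t : ℝ} {ξ : Fin 3 → ℂ} {f g : ℝ → Fin 3 → ℂ}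
    (hf : S.IsJostAt b j t z ξ f) (hg : S.IsJostAt b j t z ξ g) : f = g := by
  have h := hf.sub hg
  rw [sub_self] at h
  have h2 := h.eq_zero hz
  funext x
  exact sub_eq_zero.1 (congrFun h2 x)

/-- A solution of the Volterra equation yields a Jost solution at fixed time. -/
theorem isJostAt_of_isSol {t : ℝ} {W D : Set ℂ} {hD : IsOpen D} {hDW : D ⊆ W}
    {hW : W ⊆ S.dom b j} {c : ℝ} {hc0 : 0 ≤ c}
    {hc : ∀ z ∈ W, 4 * (mnorm (S.GamInv (S.qEnd b) z) * mnorm (S.Gam (S.qEnd b) z)) ≤ c}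
    {u : ℝ → ℂ → Fin 3 → ℂ} (hu : (S.jostKernel b j t W D hD hDW hW c hc0 hc).IsSol u (Pi.single j 1))
    (hz : z ∈ W) :
    S.IsJostAt b j t z (fun i => S.Gam (S.qEnd b) z i j)
      (fun x => Complex.exp (Complex.I * S.kap j z * x) •
        (S.Gam (S.qEnd b) z *ᵥ u (sg b * x) z)) where
  deriv x := by
    have hreg := (hW hz).1
    -- The normalised exponent vanishes at index `j`, and the boundary vector vanishes at all other
    -- indices.
    have hd := hu.hasDerivAt hz (d := fun l => S.expo b j l z) (fun l s => rfl) (fun l => by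
      by_cases hl : l = j
      · subst hl; simp [expo]
      · simp [hl]) (sg b * x)
    have h1 : HasDerivAt (fun x => u (sg b * x) z)
        (sg b • ((diagonal (fun l => S.expo b j l z) + S.pert b t (sg b * x) z) *ᵥ u (sg b * x) z))
        x := by
      have := hd.scomp x ((hasDerivAt_id x).const_mul (sg b))
      simpa [Function.comp_def, jostKernel] using this
    have h2 : HasDerivAt (fun x : ℝ => Complex.exp (Complex.I * S.kap j z * x))
        (Complex.exp (Complex.I * S.kap j z * x) * (Complex.I * S.kap j z * 1)) x :=
      ((hasDerivAt_id x).ofReal_comp.const_mul _).cexp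
    have h3 := h2.smul (hasDerivAt_mulVec (M := fun _ => S.Gam (S.qEnd b) z) (M' := 0)
      (fun i j => hasDerivAt_const x _) h1)
    refine h3.congr_deriv ?_
    have hfr := congrArg (fun M => (sg b : ℂ) • (S.Gam (S.qEnd b) z * M * S.Gam (S.qEnd b) z))
      (frame_eq hreg b j t (sg b * x))
    simp only [sg_mul_sg_mul, Matrix.mul_assoc, GamInv_mul_Gam b hreg, Matrix.mul_one,
      smul_mul_assoc, mul_smul_comm, smul_smul, ofReal_sg_mul_self, one_smul] at hfr
    rw [← Matrix.mul_assoc, Gam_mul_GamInv b hreg, Matrix.one_mul, Matrix.sub_mul, smul_mul_assoc,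
      Matrix.one_mul] at hfr
    have e : S.Gam (S.qEnd b) z *ᵥ (sg b • ((diagonal (fun l => S.expo b j l z)
        + S.pert b t (sg b * x) z) *ᵥ u (sg b * x) z))
        = S.U (S.k z) x t *ᵥ (S.Gam (S.qEnd b) z *ᵥ u (sg b * x) z)
          - (Complex.I * S.kap j z) • (S.Gam (S.qEnd b) z *ᵥ u (sg b * x) z) := by
      have e1 : sg b • ((diagonal (fun l => S.expo b j l z)
        + S.pert b t (sg b * x) z) *ᵥ u (sg b * x) z) = (sg b : ℂ) • ((diagonal
        (fun l => S.expo b j l z) + S.pert b t (sg b * x) z) *ᵥ u (sg b * x) z) := rfl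
      rw [e1, mulVec_smul, mulVec_mulVec, ← smul_mulVec, ← hfr, sub_mulVec, smul_mulVec,
        mulVec_mulVec]
    rw [zero_mulVec, zero_add, e, mulVec_smul]
    ext i
    simp only [Pi.add_apply, Pi.smul_apply, Pi.sub_apply, smul_eq_mul]
    ring
  lim := by
    have h1 := (hu.tendsto z hz).comp (tendsto_sg_mul b)
    have h2 : Continuous fun v : Fin 3 → ℂ => S.Gam (S.qEnd b) z *ᵥ v :=
      continuous_mulVec_entries (fun _ _ => continuous_const) continuous_id
    have h3 := (h2.tendsto _).comp h1
    rw [mulVec_single_one] at h3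
    refine h3.congr fun x => ?_
    rw [smul_smul, ← Complex.exp_add]
    simp

end NZBCSolution

end CMKdV

/-! ### Simultaneous Jost columns and their dependence on the spectral parameter -/

namespace CMKdV

namespace NZBCSolution

variable (S : NZBCSolution)

/-- The defining property of the Jost columns, for both ends. -/
def IsPhi (b : Bool) (j : Fin 3) (z : ℂ) (φ : ℝ → ℝ → Fin 3 → ℂ) : Prop :=
  IsJost (S.U (S.k z)) (S.V (S.k z)) (fun x t => Complex.I * S.theta j x t z)
    (fun i => S.Gam (S.qEnd b) z i j) (endFilter b) φ

/-- The Jost columns. -/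
def phi (b : Bool) (j : Fin 3) (x t : ℝ) (z : ℂ) : Fin 3 → ℂ :=
  Classical.epsilon (S.IsPhi b j z) x t

/-- The modified Jost columns. -/
def mu (b : Bool) (j : Fin 3) (x t : ℝ) (z : ℂ) : Fin 3 → ℂ :=
  Complex.exp (-(Complex.I * S.theta j x t z)) • S.phi b j x t z

variable {S} {b : Bool} {j : Fin 3} {z : ℂ}

theorem IsPhi.isJostAt {φ : ℝ → ℝ → Fin 3 → ℂ} (h : S.IsPhi b j z φ) (t : ℝ) :
    S.IsJostAt b j t z (fun i => S.Gam (S.qEnd b) z i j)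
      (fun x => Complex.exp (-(Complex.I * (S.om j z * t))) • φ x t) where
  deriv x := by
    rw [mulVec_smul]
    exact (h.1 x t).const_smul (Complex.exp (-(Complex.I * (S.om j z * t))))
  lim := by
    refine (h.2.2 t).congr fun x => ?_
    simp only [theta_eq]
    rw [smul_smul, ← Complex.exp_add]
    congr 2
    ring

theorem IsPhi.unique (hz : z ∈ S.dom b j) {φ ψ : ℝ → ℝ → Fin 3 → ℂ} (h : S.IsPhi b j z φ)
    (h' : S.IsPhi b j z ψ) : φ = ψ := by
  funext x t
  have h1 := congrFun ((h.isJostAt t).unique hz (h'.isJostAt t)) x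
  exact smul_right_injective _ (Complex.exp_ne_zero _) h1

theorem exists_isJostAt (hz : z ∈ S.dom b j) (t : ℝ) :
    ∃ f, S.IsJostAt b j t z (fun i => S.Gam (S.qEnd b) z i j) f := by
  have h0 : 0 ≤ 4 * (mnorm (S.GamInv (S.qEnd b) z) * mnorm (S.Gam (S.qEnd b) z)) := by
    have := mnorm_nonneg (S.GamInv (S.qEnd b) z)
    have := mnorm_nonneg (S.Gam (S.qEnd b) z)
    positivity
  obtain ⟨u, hu⟩ := TailKernel.exists_isSol (T := S.jostKernel b j t {z} ∅ isOpen_empty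
    (Set.empty_subset _) (Set.singleton_subset_iff.2 hz) _ h0 (by rintro w rfl; exact le_rfl))
    (Pi.single j 1)
  exact ⟨_, isJostAt_of_isSol hu (Set.mem_singleton z)⟩

/-- The Lax solution through the value at the origin of the fixed-time Jost solution agrees with it
on `t = 0` by uniqueness for linear equations. Its asymptotics then persist for all times because
the limiting `V` is diagonal in the same frame. -/
theorem exists_isPhi (hz : z ∈ S.dom b j) : ∃ φ, S.IsPhi b j z φ := by
  obtain ⟨f, hf⟩ := exists_isJostAt hz 0
  obtain ⟨E, hE0, hEx, hEt⟩ := S.exists_lax (S.k z) (f 0)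
  have hEf : (fun x => E x 0) = f :=
    linear_ode_unique (A := fun x => S.U (S.k z) x 0) (fun i j =>
      ((S.continuous_U (S.k z)).comp
        (by fun_prop : Continuous fun x : ℝ => (x, (0 : ℝ)))).matrix_elem i j)
      (fun x => hEx x 0) hf.deriv (x₀ := 0) hE0
  refine ⟨E, hEx, hEt, ?_⟩
  refine tendsto_of_evolution (w := fun x t => Complex.exp (-(Complex.I * S.theta j x t z)) • E x t)
    (N := fun x t => S.V (S.k z) x t - (Complex.I * S.om j z) • 1)
    (N₀ := Vgen (S.k z) (Qmat (S.qEnd b)) 0 0 - (Complex.I * S.om j z) • 1) ?_ ?_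
    (Vinf_mulVec_Gam b hz.1 j) ?_
  · intro x t
    have h1 : HasDerivAt (fun s : ℝ => Complex.exp (-(Complex.I * S.theta j x s z)))
        (Complex.exp (-(Complex.I * S.theta j x t z)) * -(Complex.I * (S.om j z * 1))) t := by
      simp only [theta_eq]
      exact ((((hasDerivAt_id t).ofReal_comp.const_mul _).const_add _).const_mul _).fun_neg.cexp
    refine (h1.smul (hEt x t)).congr_deriv ?_
    rw [sub_mulVec, smul_mulVec, one_mulVec, mulVec_smul]
    ext i
    simp only [Pi.add_apply, Pi.smul_apply, Pi.sub_apply, smul_eq_mul]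
    ring
  · intro T i l
    have h1 := (S.tendsto_V (S.k z) b T).sub
      (tendsto_const_nhds (x := (Complex.I * S.om j z) • (1 : Matrix (Fin 3) (Fin 3) ℂ)))
    exact tendsto_pi_nhds.1 (tendsto_pi_nhds.1 h1 i) l
  · refine hf.lim.congr fun x => ?_
    rw [← hEf, theta_eq]
    congr 3
    push_cast
    ring

theorem existsUnique_isPhi (hz : z ∈ S.dom b j) : ∃! φ, S.IsPhi b j z φ := by
  obtain ⟨φ, hφ⟩ := exists_isPhi hz
  exact ⟨φ, hφ, fun ψ hψ => hψ.unique hz hφ⟩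

theorem isPhi_phi (hz : z ∈ S.dom b j) : S.IsPhi b j z (fun x t => S.phi b j x t z) :=
  Classical.epsilon_spec (exists_isPhi hz)

theorem mu_eq_of_isSol {t : ℝ} {W D : Set ℂ} {hD : IsOpen D} {hDW : D ⊆ W}
    {hW : W ⊆ S.dom b j} {c : ℝ} {hc0 : 0 ≤ c}
    {hc : ∀ z ∈ W, 4 * (mnorm (S.GamInv (S.qEnd b) z) * mnorm (S.Gam (S.qEnd b) z)) ≤ c}
    {u : ℝ → ℂ → Fin 3 → ℂ} (hu : (S.jostKernel b j t W D hD hDW hW c hc0 hc).IsSol u (Pi.single j 1))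
    (hz : z ∈ W) (x : ℝ) : S.mu b j x t z = S.Gam (S.qEnd b) z *ᵥ u (sg b * x) z := by
  have h1 := congrFun (((isPhi_phi (hW hz)).isJostAt t).unique (hW hz) (isJostAt_of_isSol hu hz)) x
  have h2 := congrArg (fun v => Complex.exp (-(Complex.I * S.kap j z * x)) • v) h1
  simp only [smul_smul, ← Complex.exp_add, neg_add_cancel, Complex.exp_zero, one_smul] at h2
  rw [← h2, mu, theta_eq]
  congr 2
  ring

/-- The norms of `Γ` and its inverse are bounded only locally on the regular points, so the
parametric Volterra equation is solved near each `z` separately. Uniqueness identifies the local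
solutions with `mu`. -/
theorem exists_local (hz : z ∈ S.dom b j) (t : ℝ) (D₀ : Set ℂ) (hD₀ : IsOpen D₀)
    (hD₀W : D₀ ⊆ S.dom b j) : ∃ N ∈ 𝓝 z, ∀ x,
      ContinuousOn (S.mu b j x t) (S.dom b j ∩ N) ∧ DifferentiableOn ℂ (S.mu b j x t) (D₀ ∩ N) := by
  set F : ℂ → ℝ := fun z => 4 * (mnorm (S.GamInv (S.qEnd b) z) * mnorm (S.Gam (S.qEnd b) z)) with hF
  have hreg : IsOpen {z | S.Regular z} := by
    have e : {z | S.Regular z} = {z | z ≠ 0 ∧ z ^ 2 + (S.q0 : ℂ) ^ 2 ≠ 0} := by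
      ext z
      refine ⟨fun h => ⟨h.1, h.sq_ne⟩, fun h => ⟨h.1, fun h2 => h.2 ?_⟩⟩
      have := h.1
      rw [gam] at h2
      field_simp at h2
      simpa using h2
    rw [e]
    exact (isOpen_ne_fun continuous_id continuous_const).inter
      (isOpen_ne_fun (by fun_prop) continuous_const)
  have hFc : ContinuousOn F {z | S.Regular z} :=
    ((continuousOn_mnorm fun i j => (S.differentiableOn_GamInv _ i j).continuousOn).mul
      (continuousOn_mnorm fun i j => (S.differentiableOn_Gam _ i j).continuousOn)).const_mul 4
  set N : Set ℂ := {z | S.Regular z} ∩ F ⁻¹' Set.Iio (F z + 1) with hN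
  have hNo : IsOpen N := hFc.isOpen_inter_preimage hreg isOpen_Iio
  have hzN : z ∈ N := ⟨hz.1, by simp⟩
  have hc0 : 0 ≤ F z + 1 := by
    have := mnorm_nonneg (S.GamInv (S.qEnd b) z)
    have := mnorm_nonneg (S.Gam (S.qEnd b) z)
    positivity
  obtain ⟨u, hu⟩ := TailKernel.exists_isSol (T := S.jostKernel b j t (S.dom b j ∩ N) (D₀ ∩ N)
    (hD₀.inter hNo) (Set.inter_subset_inter_left _ hD₀W) Set.inter_subset_left (F z + 1) hc0
    (fun w hw => (show F w < F z + 1 from hw.2.2).le)) (Pi.single j 1)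
  refine ⟨N, hNo.mem_nhds hzN, fun x => ⟨?_, ?_⟩⟩
  · have hcx : ContinuousOn (fun w => u (sg b * x) w) (S.dom b j ∩ N) :=
      hu.cont.comp (f := fun w : ℂ => (sg b * x, w)) (by fun_prop) (fun w hw => ⟨trivial, hw⟩)
    refine ContinuousOn.congr (f := fun w => S.Gam (S.qEnd b) w *ᵥ u (sg b * x) w) ?_
      fun w hw => mu_eq_of_isSol hu hw x
    refine continuousOn_pi.2 fun i => ?_
    simp only [mulVec, dotProduct]
    exact continuousOn_finsetSum _ fun l _ => ((S.differentiableOn_Gam _ i l).continuousOn.mono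
      fun w hw => hw.1.1).mul (continuousOn_pi.1 hcx l)
  · refine DifferentiableOn.congr (f := fun w => S.Gam (S.qEnd b) w *ᵥ u (sg b * x) w) ?_
      fun w hw => mu_eq_of_isSol hu ⟨hD₀W hw.1, hw.2⟩ x
    refine differentiableOn_pi.2 fun i => ?_
    simp only [mulVec, dotProduct]
    exact DifferentiableOn.fun_sum fun l _ => ((S.differentiableOn_Gam _ i l).mono
      fun w hw => (hD₀W hw.1).1).mul (differentiableOn_pi.1 (hu.diff (sg b * x)) l)

theorem continuousOn_mu (b : Bool) (j : Fin 3) (x t : ℝ) :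
    ContinuousOn (S.mu b j x t) (S.dom b j) := by
  intro z hz
  obtain ⟨N, hN, h⟩ := exists_local hz t ∅ isOpen_empty (Set.empty_subset _)
  exact ((h x).1 z ⟨hz, mem_of_mem_nhds hN⟩).mono_of_mem_nhdsWithin
    (inter_mem self_mem_nhdsWithin (mem_nhdsWithin_of_mem_nhds hN))

theorem differentiableOn_mu (x t : ℝ) {D : Set ℂ} (hD : IsOpen D) (hDW : D ⊆ S.dom b j) :
    DifferentiableOn ℂ (S.mu b j x t) D := by
  intro z hz
  obtain ⟨N, hN, h⟩ := exists_local (hDW hz) t D hD hDW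
  exact ((h x).2 z ⟨hz, mem_of_mem_nhds hN⟩).mono_of_mem_nhdsWithin
    (inter_mem self_mem_nhdsWithin (mem_nhdsWithin_of_mem_nhds hN))

end NZBCSolution

end CMKdV

namespace CMKdV

namespace NZBCSolution

variable (S : NZBCSolution)

/-! ### Ordering of the exponentials in the four regions -/

section Domains

variable {S} {z : ℂ}

theorem im_q_div (z : ℂ) : ((S.q0 : ℂ) ^ 2 / z).im = -(z.im * (S.q0 ^ 2 / Complex.normSq z)) := by
  rw [← Complex.ofReal_pow, div_eq_mul_inv, Complex.im_ofReal_mul, Complex.inv_im]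
  ring

/-- With `r = q₀²/|z|²` one has `Im k = Im z (1 + r)/2` and `Im λ = Im z (1 - r)/2`. The order of
the three exponents therefore depends only on the sign of `Im z` and on the side of the circle,
which is the origin of the four regions. -/
theorem im_k (z : ℂ) : (S.k z).im = (z.im + z.im * (S.q0 ^ 2 / Complex.normSq z)) / 2 := by
  have h : S.k z = (z - (S.q0 : ℂ) ^ 2 / z) / ((2 : ℝ) : ℂ) := by simp [k]
  rw [h, Complex.div_ofReal_im, Complex.sub_im, im_q_div, sub_neg_eq_add]

theorem im_lam (z : ℂ) : (S.lam z).im = (z.im - z.im * (S.q0 ^ 2 / Complex.normSq z)) / 2 := by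
  have h : S.lam z = (z + (S.q0 : ℂ) ^ 2 / z) / ((2 : ℝ) : ℂ) := by simp [lam]
  rw [h, Complex.div_ofReal_im, Complex.add_im, im_q_div, sub_eq_add_neg]

variable (S) in
/-- `q₀² / |z|²`. -/
def ratio (z : ℂ) : ℝ := S.q0 ^ 2 / Complex.normSq z

theorem ratio_nonneg (z : ℂ) : 0 ≤ S.ratio z := div_nonneg (sq_nonneg _) (Complex.normSq_nonneg _)

theorem ratio_le_one (h : S.q0 ≤ ‖z‖) : S.ratio z ≤ 1 := by
  have h0 := S.q0_pos
  have hz := h0.trans_le h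
  rw [ratio, Complex.normSq_eq_norm_sq, div_le_one (by positivity)]
  exact pow_le_pow_left₀ h0.le h 2

theorem one_le_ratio (hz : z ≠ 0) (h : ‖z‖ ≤ S.q0) : 1 ≤ S.ratio z := by
  have h0 := norm_pos_iff.2 hz
  rw [ratio, Complex.normSq_eq_norm_sq, one_le_div (by positivity)]
  exact pow_le_pow_left₀ h0.le h 2

theorem mem_dom_true_0 (hr : S.Regular z) (h1 : ‖z‖ ≤ S.q0) (h2 : z.im ≤ 0) :
    z ∈ S.dom true 0 := by
  refine ⟨hr, fun l => ?_⟩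
  have := one_le_ratio hr.1 h1
  have e1 := im_k (S := S) z
  have e2 := im_lam (S := S) z
  rw [← ratio] at e1 e2
  fin_cases l <;> simp [sg, kap, e1, e2] <;> nlinarith

theorem mem_dom_true_1 (hr : S.Regular z) (h2 : 0 ≤ z.im) : z ∈ S.dom true 1 := by
  refine ⟨hr, fun l => ?_⟩
  have := ratio_nonneg (S := S) z
  have e1 := im_k (S := S) z
  have e2 := im_lam (S := S) z
  rw [← ratio] at e1 e2
  fin_cases l <;> simp [sg, kap, e1, e2] <;> nlinarith

theorem mem_dom_true_2 (hr : S.Regular z) (h1 : S.q0 ≤ ‖z‖) (h2 : z.im ≤ 0) :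
    z ∈ S.dom true 2 := by
  refine ⟨hr, fun l => ?_⟩
  have := ratio_nonneg (S := S) z
  have := ratio_le_one h1
  have e1 := im_k (S := S) z
  have e2 := im_lam (S := S) z
  rw [← ratio] at e1 e2
  fin_cases l <;> simp [sg, kap, e1, e2] <;> nlinarith

theorem mem_dom_false_0 (hr : S.Regular z) (h1 : ‖z‖ ≤ S.q0) (h2 : 0 ≤ z.im) :
    z ∈ S.dom false 0 := by
  refine ⟨hr, fun l => ?_⟩
  have := one_le_ratio hr.1 h1
  have e1 := im_k (S := S) z
  have e2 := im_lam (S := S) z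
  rw [← ratio] at e1 e2
  fin_cases l <;> simp [sg, kap, e1, e2] <;> nlinarith

theorem mem_dom_false_1 (hr : S.Regular z) (h2 : z.im ≤ 0) : z ∈ S.dom false 1 := by
  refine ⟨hr, fun l => ?_⟩
  have := ratio_nonneg (S := S) z
  have e1 := im_k (S := S) z
  have e2 := im_lam (S := S) z
  rw [← ratio] at e1 e2
  fin_cases l <;> simp [sg, kap, e1, e2] <;> nlinarith

theorem mem_dom_false_2 (hr : S.Regular z) (h1 : S.q0 ≤ ‖z‖) (h2 : 0 ≤ z.im) :
    z ∈ S.dom false 2 := by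
  refine ⟨hr, fun l => ?_⟩
  have := ratio_nonneg (S := S) z
  have := ratio_le_one h1
  have e1 := im_k (S := S) z
  have e2 := im_lam (S := S) z
  rw [← ratio] at e1 e2
  fin_cases l <;> simp [sg, kap, e1, e2] <;> nlinarith

theorem mem_dom_of_im_eq_zero (hr : S.Regular z) (h : z.im = 0) (b : Bool) (j : Fin 3) :
    z ∈ S.dom b j := by
  refine ⟨hr, fun l => ?_⟩
  have e1 := im_k (S := S) z
  have e2 := im_lam (S := S) z
  have : ∀ l, (S.kap l z).im = 0 := fun l => by
    fin_cases l <;> simp [kap, e1, e2, h]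
  rw [this, this]

theorem regular_of_im_eq_zero (h : z.im = 0) (hz : z ≠ 0) : S.Regular z := by
  refine ⟨hz, fun hg => ?_⟩
  obtain ⟨r, rfl⟩ : ∃ r : ℝ, z = r := ⟨z.re, Complex.ext (by simp) (by simp [h])⟩
  have hr : r ≠ 0 := by simpa using hz
  have : ((1 + S.q0 ^ 2 / r ^ 2 : ℝ) : ℂ) = 0 := by rw [← hg, gam]; push_cast; rfl
  have h1 : (1 + S.q0 ^ 2 / r ^ 2 : ℝ) = 0 := by exact_mod_cast this
  have : 0 ≤ S.q0 ^ 2 / r ^ 2 := by positivity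
  linarith

theorem regular_of_norm_ne (hz : z ≠ 0) (h : ‖z‖ ≠ S.q0) : S.Regular z := by
  refine ⟨hz, fun hg => h ?_⟩
  have h1 : z ^ 2 = -(S.q0 : ℂ) ^ 2 := by
    rw [gam] at hg
    field_simp at hg
    linear_combination hg
  have h2 : ‖z‖ ^ 2 = S.q0 ^ 2 := by
    rw [← norm_pow, h1, norm_neg, norm_pow, Complex.norm_real, Real.norm_of_nonneg S.q0_pos.le]
  exact (pow_left_inj₀ (norm_nonneg z) S.q0_pos.le two_ne_zero).1 h2

theorem D1_regular (h : z ∈ S.D1) : S.Regular z :=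
  regular_of_norm_ne (fun h0 => by simp [D1, h0] at h) h.1.ne'
theorem D2_regular (h : z ∈ S.D2) : S.Regular z :=
  regular_of_norm_ne (fun h0 => by simp [D2, h0] at h) h.1.ne'
theorem D3_regular (h : z ∈ S.D3) : S.Regular z :=
  regular_of_norm_ne (fun h0 => by simp [D3, h0] at h) h.1.ne
theorem D4_regular (h : z ∈ S.D4) : S.Regular z :=
  regular_of_norm_ne (fun h0 => by simp [D4, h0] at h) h.1.ne

theorem closure_D1 (h : z ∈ closure S.D1) : S.q0 ≤ ‖z‖ ∧ 0 ≤ z.im :=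
  closure_minimal (t := {z : ℂ | S.q0 ≤ ‖z‖ ∧ 0 ≤ z.im}) (fun _ hw => ⟨hw.1.le, hw.2.le⟩)
    ((isClosed_le continuous_const continuous_norm).inter
      (isClosed_le continuous_const Complex.continuous_im)) h
theorem closure_D2 (h : z ∈ closure S.D2) : S.q0 ≤ ‖z‖ ∧ z.im ≤ 0 :=
  closure_minimal (t := {z : ℂ | S.q0 ≤ ‖z‖ ∧ z.im ≤ 0}) (fun _ hw => ⟨hw.1.le, hw.2.le⟩)
    ((isClosed_le continuous_const continuous_norm).inter
      (isClosed_le Complex.continuous_im continuous_const)) h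
theorem closure_D3 (h : z ∈ closure S.D3) : ‖z‖ ≤ S.q0 ∧ z.im ≤ 0 :=
  closure_minimal (t := {z : ℂ | ‖z‖ ≤ S.q0 ∧ z.im ≤ 0}) (fun _ hw => ⟨hw.1.le, hw.2.le⟩)
    ((isClosed_le continuous_norm continuous_const).inter
      (isClosed_le Complex.continuous_im continuous_const)) h
theorem closure_D4 (h : z ∈ closure S.D4) : ‖z‖ ≤ S.q0 ∧ 0 ≤ z.im :=
  closure_minimal (t := {z : ℂ | ‖z‖ ≤ S.q0 ∧ 0 ≤ z.im}) (fun _ hw => ⟨hw.1.le, hw.2.le⟩)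
    ((isClosed_le continuous_norm continuous_const).inter
      (isClosed_le continuous_const Complex.continuous_im)) h

variable (S) in
theorem isOpen_D1 : IsOpen S.D1 :=
  (isOpen_lt continuous_const continuous_norm).inter
    (isOpen_lt continuous_const Complex.continuous_im)
variable (S) in
theorem isOpen_D2 : IsOpen S.D2 :=
  (isOpen_lt continuous_const continuous_norm).inter
    (isOpen_lt Complex.continuous_im continuous_const)
variable (S) in
theorem isOpen_D3 : IsOpen S.D3 :=
  (isOpen_lt continuous_norm continuous_const).inter
    (isOpen_lt Complex.continuous_im continuous_const)
variable (S) in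
theorem isOpen_D4 : IsOpen S.D4 :=
  (isOpen_lt continuous_norm continuous_const).inter
    (isOpen_lt continuous_const Complex.continuous_im)

theorem mem_dom_of_domPlus {j : Fin 3} (hr : S.Regular z) (h : z ∈ S.domPlus j) :
    z ∈ S.dom true j := by
  fin_cases j
  · rcases h with h | h
    · exact mem_dom_true_0 hr (closure_D3 h).1 (closure_D3 h).2
    · exact mem_dom_of_im_eq_zero hr h _ _
  · exact mem_dom_true_1 hr h
  · rcases h with h | h
    · exact mem_dom_true_2 hr (closure_D2 h).1 (closure_D2 h).2
    · exact mem_dom_of_im_eq_zero hr h _ _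

theorem mem_dom_of_domMinus {j : Fin 3} (hr : S.Regular z) (h : z ∈ S.domMinus j) :
    z ∈ S.dom false j := by
  fin_cases j
  · rcases h with h | h
    · exact mem_dom_false_0 hr (closure_D4 h).1 (closure_D4 h).2
    · exact mem_dom_of_im_eq_zero hr h _ _
  · exact mem_dom_false_1 hr h
  · rcases h with h | h
    · exact mem_dom_false_2 hr (closure_D1 h).1 (closure_D1 h).2
    · exact mem_dom_of_im_eq_zero hr h _ _

end Domains

/-! ### Adjoint columns by complex conjugation -/

section Adjoint

theorem k_conj (z : ℂ) : S.k (conj z) = conj (S.k z) := by simp [k, Complex.conj_ofNat]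
theorem lam_conj (z : ℂ) : S.lam (conj z) = conj (S.lam z) := by
  simp [lam, Complex.conj_ofNat]
theorem gam_conj (z : ℂ) : S.gam (conj z) = conj (S.gam z) := by simp [gam]

theorem theta_conj (j : Fin 3) (x t : ℝ) (z : ℂ) :
    S.theta j x t (conj z) = conj (S.theta j x t z) := by
  fin_cases j <;> simp [theta, theta1, theta2, k_conj, lam_conj, Complex.conj_ofNat]

theorem regular_conj {z : ℂ} (h : S.Regular z) : S.Regular (conj z) :=
  ⟨by simpa using h.1, by rw [gam_conj]; simpa using h.2⟩

/-- The defining property of the adjoint Jost columns, for both ends. -/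
def IsPhiAdj (b : Bool) (j : Fin 3) (z : ℂ) (φ : ℝ → ℝ → Fin 3 → ℂ) : Prop :=
  IsJost (S.Uadj z) (S.Vadj z) (fun x t => -(Complex.I * S.theta j x t z))
    (fun i => conj (S.Gam (S.qEnd b) (conj z) i j)) (endFilter b) φ

/-- The adjoint Jost columns. -/
def phiAdj (b : Bool) (j : Fin 3) (x t : ℝ) (z : ℂ) : Fin 3 → ℂ :=
  Classical.epsilon (S.IsPhiAdj b j z) x t

theorem map_conj_mulVec_star (M : Matrix (Fin 3) (Fin 3) ℂ) (v : Fin 3 → ℂ) :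
    M.map conj *ᵥ star v = star (M *ᵥ v) := by
  ext i
  simp [mulVec, dotProduct]

variable {S} {b : Bool} {j : Fin 3} {z : ℂ} {φ : ℝ → ℝ → Fin 3 → ℂ}

/-- Conjugation exchanges the Lax pair at `z̄` with the adjoint pair at `z`, so existence,
uniqueness and regularity of adjoint columns are inherited. -/
theorem IsPhi.adj (h : S.IsPhi b j (conj z) φ) : S.IsPhiAdj b j z (fun x t => star (φ x t)) := by
  refine ⟨fun x t => ?_, fun x t => ?_, fun t => ?_⟩
  · rw [Uadj, map_conj_mulVec_star]; exact (h.1 x t).star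
  · rw [Vadj, map_conj_mulVec_star]; exact (h.2.1 x t).star
  · have h1 := (continuous_star.tendsto _).comp (h.2.2 t)
    refine (h1.congr fun x => ?_)
    simp only [Function.comp_apply, star_smul, theta_conj]
    congr 1
    rw [Complex.star_def, ← Complex.exp_conj]
    simp

theorem IsPhiAdj.conj (h : S.IsPhiAdj b j z φ) :
    S.IsPhi b j (conj z) (fun x t => star (φ x t)) := by
  refine ⟨fun x t => ?_, fun x t => ?_, fun t => ?_⟩
  · have h1 := (h.1 x t).star
    rw [← star_star (φ x t), Uadj, map_conj_mulVec_star, star_star] at h1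
    exact h1
  · have h1 := (h.2.1 x t).star
    rw [← star_star (φ x t), Vadj, map_conj_mulVec_star, star_star] at h1
    exact h1
  · have h1 := (continuous_star.tendsto _).comp (h.2.2 t)
    have e : star (fun i => (starRingEnd ℂ) (S.Gam (S.qEnd b) ((starRingEnd ℂ) z) i j))
        = fun i => S.Gam (S.qEnd b) ((starRingEnd ℂ) z) i j := by
      ext i; simp
    rw [e] at h1
    refine (h1.congr fun x => ?_)
    simp only [Function.comp_apply, star_smul, theta_conj]
    congr 1
    rw [Complex.star_def, ← Complex.exp_conj]
    simp

theorem IsPhiAdj.unique (hz : conj z ∈ S.dom b j) {ψ : ℝ → ℝ → Fin 3 → ℂ}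
    (h : S.IsPhiAdj b j z φ) (h' : S.IsPhiAdj b j z ψ) : φ = ψ := by
  have h1 := h.conj.unique hz h'.conj
  funext x t
  exact star_injective (congrFun (congrFun h1 x) t)

theorem existsUnique_isPhiAdj (hz : conj z ∈ S.dom b j) : ∃! φ, S.IsPhiAdj b j z φ :=
  ⟨_, (isPhi_phi hz).adj, fun _ hψ => hψ.unique hz (isPhi_phi hz).adj⟩

theorem isPhiAdj_phiAdj (hz : conj z ∈ S.dom b j) :
    S.IsPhiAdj b j z (fun x t => S.phiAdj b j x t z) :=
  Classical.epsilon_spec (existsUnique_isPhiAdj hz).exists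

theorem phiAdj_eq (hz : conj z ∈ S.dom b j) (x t : ℝ) :
    S.phiAdj b j x t z = star (S.phi b j x t (conj z)) :=
  congrFun (congrFun ((isPhiAdj_phiAdj hz).unique hz (isPhi_phi hz).adj) x) t

end Adjoint

end NZBCSolution

end CMKdV

namespace CMKdV

/-! ### Invariant pairings and cross products -/

section Bilinear

/-- The derivative of the pairing is `f ⬝ᵥ ((Nᵀ + M) *ᵥ g)`, which vanishes. -/
theorem dotProduct_eq_of_adjoint {f g : ℝ → Fin 3 → ℂ} {M N : ℝ → Matrix (Fin 3) (Fin 3) ℂ}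
    (h : ∀ x, (N x)ᵀ = -M x) (hf : ∀ x, HasDerivAt f (N x *ᵥ f x) x)
    (hg : ∀ x, HasDerivAt g (M x *ᵥ g x) x) (x y : ℝ) : f x ⬝ᵥ g x = f y ⬝ᵥ g y := by
  have hd : ∀ x, HasDerivAt (fun x => f x ⬝ᵥ g x) 0 x := by
    intro x
    have h1 : HasDerivAt (fun x => f x ⬝ᵥ g x)
        (∑ i, ((N x *ᵥ f x) i * g x i + f x i * (M x *ᵥ g x) i)) x :=
      HasDerivAt.fun_sum fun i _ => (hasDerivAt_pi.1 (hf x) i).mul (hasDerivAt_pi.1 (hg x) i)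
    refine h1.congr_deriv ?_
    rw [Finset.sum_add_distrib]
    change (N x *ᵥ f x) ⬝ᵥ g x + f x ⬝ᵥ (M x *ᵥ g x) = 0
    rw [← vecMul_transpose, ← dotProduct_mulVec, h, neg_mulVec, dotProduct_neg, neg_add_cancel]
  exact is_const_of_deriv_eq_zero (fun x => (hd x).differentiableAt) (fun x => (hd x).deriv) x y

/-- The infinitesimal form of `(gu) × (gv) = det g · g⁻ᵀ (u × v)`. -/
theorem cross_mulVec_add (M : Matrix (Fin 3) (Fin 3) ℂ) (u v : Fin 3 → ℂ) :
    crossProduct (M *ᵥ u) v + crossProduct u (M *ᵥ v)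
      = M.trace • crossProduct u v - Mᵀ *ᵥ crossProduct u v := by
  ext i
  fin_cases i <;> simp [cross_apply, mulVec, dotProduct, Fin.sum_univ_three, trace] <;> ring

theorem hasDerivAt_cross {f g : ℝ → Fin 3 → ℂ} {f' g' : Fin 3 → ℂ} {x : ℝ}
    (hf : HasDerivAt f f' x) (hg : HasDerivAt g g' x) :
    HasDerivAt (fun x => crossProduct (f x) (g x))
      (crossProduct f' (g x) + crossProduct (f x) g') x := by
  have hf := hasDerivAt_pi.1 hf
  have hg := hasDerivAt_pi.1 hg
  refine hasDerivAt_pi.2 fun i => ?_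
  fin_cases i
  · refine (((hf 1).mul (hg 2)).sub ((hf 2).mul (hg 1))).congr_deriv ?_
    simp [cross_apply]; ring
  · refine (((hf 2).mul (hg 0)).sub ((hf 0).mul (hg 2))).congr_deriv ?_
    simp [cross_apply]; ring
  · refine (((hf 0).mul (hg 1)).sub ((hf 1).mul (hg 0))).congr_deriv ?_
    simp [cross_apply]; ring

/-- The cross product of two solutions of the adjoint equation solves the equation. -/
theorem hasDerivAt_exp_smul_cross {f g : ℝ → Fin 3 → ℂ} {M N : Matrix (Fin 3) (Fin 3) ℂ}
    {θ : ℝ → ℂ} {τ : ℂ} {x : ℝ} (h : Nᵀ = -M) (hτ : M.trace = τ)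
    (hθ : HasDerivAt θ τ x) (hf : HasDerivAt f (N *ᵥ f x) x) (hg : HasDerivAt g (N *ᵥ g x) x) :
    HasDerivAt (fun x => Complex.exp (θ x) • crossProduct (f x) (g x))
      (M *ᵥ (Complex.exp (θ x) • crossProduct (f x) (g x))) x := by
  refine (hθ.cexp.smul (hasDerivAt_cross hf hg)).congr_deriv ?_
  rw [cross_mulVec_add, h, ← trace_transpose, h, trace_neg, hτ, neg_mulVec, mulVec_smul]
  module

theorem star_cross (u v : Fin 3 → ℂ) :
    star (crossProduct u v) = crossProduct (star u) (star v) := by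
  ext i
  fin_cases i <;> simp [cross_apply]

theorem tendsto_cross {X : Type*} {l : Filter X} {f g : X → Fin 3 → ℂ} {u v : Fin 3 → ℂ}
    (hf : Tendsto f l (𝓝 u)) (hg : Tendsto g l (𝓝 v)) :
    Tendsto (fun x => crossProduct (f x) (g x)) l (𝓝 (crossProduct u v)) := by
  have hf := tendsto_pi_nhds.1 hf
  have hg := tendsto_pi_nhds.1 hg
  simp only [cross_apply]
  refine tendsto_pi_nhds.2 fun i => ?_
  fin_cases i
  · exact ((hf 1).mul (hg 2)).sub ((hf 2).mul (hg 1))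
  · exact ((hf 2).mul (hg 0)).sub ((hf 0).mul (hg 2))
  · exact ((hf 0).mul (hg 1)).sub ((hf 1).mul (hg 0))

end Bilinear

/-! ### Symmetry and trace of the Lax pair; cross products at the ends -/

section LaxSymmetry

theorem conjTranspose_Qmat (w : C2) : (Qmat w)ᴴ = -Qmat w := by
  ext i j
  fin_cases i <;> fin_cases j <;> simp [Qmat]

theorem conjTranspose_sigma3 : sigma3ᴴ = sigma3 := by
  rw [sigma3_eq]
  ext i j
  fin_cases i <;> fin_cases j <;> simp

theorem sigma3_mul_Qmat (w : C2) : sigma3 * Qmat w = -(Qmat w * sigma3) := by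
  rw [sigma3_eq]
  ext i j
  fin_cases i <;> fin_cases j <;> simp [Qmat, Matrix.mul_apply, Fin.sum_univ_three]

theorem trace_mul_sub_mul (M N : Matrix (Fin 3) (Fin 3) ℂ) : (M * N - N * M).trace = 0 := by
  rw [trace_sub, trace_mul_comm, sub_self]

theorem trace_Vgen (κ : ℂ) (w w1 w2 : C2) :
    (NZBCSolution.Vgen κ (Qmat w) (Qmat w1) (Qmat w2)).trace = 4 * Complex.I * κ ^ 3 := by
  rw [NZBCSolution.Vgen, trace_add, trace_mul_sub_mul, sigma3_eq]
  simp [Qmat, trace, Fin.sum_univ_three, pow_succ]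
  ring

/-- `Q` and its derivatives are anti-Hermitian and anticommute with `σ₃`, while `Q²` commutes with
it. The signs then match term by term. -/
theorem conjTranspose_Vgen (κ : ℂ) (w w1 w2 : C2) :
    (NZBCSolution.Vgen (conj κ) (Qmat w) (Qmat w1) (Qmat w2))ᴴ
      = -NZBCSolution.Vgen κ (Qmat w) (Qmat w1) (Qmat w2) := by
  have e1 : Qmat w1 * sigma3 = -(sigma3 * Qmat w1) := by rw [sigma3_mul_Qmat, neg_neg]
  have e2 : Qmat w * Qmat w * sigma3 = sigma3 * (Qmat w * Qmat w) := by
    rw [← Matrix.mul_assoc, sigma3_mul_Qmat, Matrix.mul_assoc, neg_mul, Matrix.mul_assoc,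
      sigma3_mul_Qmat, mul_neg, neg_neg]
  simp only [NZBCSolution.Vgen, conjTranspose_add, conjTranspose_sub, conjTranspose_smul,
    conjTranspose_mul, conjTranspose_pow, conjTranspose_Qmat, conjTranspose_sigma3, star_mul',
    Complex.star_def, map_pow, Complex.conj_conj, Complex.conj_I, Complex.conj_ofNat]
  have e3 : (-Qmat w1 - (-Qmat w) ^ 2) * sigma3 = sigma3 * (Qmat w1 - Qmat w ^ 2) := by
    rw [neg_sq, pow_two, Matrix.sub_mul, neg_mul, e1, e2, neg_neg, Matrix.mul_sub]
  have e4 : (-Qmat w) ^ 3 = -(Qmat w ^ 3) := Odd.neg_pow (by decide) _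
  rw [e3, e4, neg_mul_neg, neg_mul_neg]
  module

namespace NZBCSolution

variable (S : NZBCSolution)

theorem Uadj_transpose (z : ℂ) (x t : ℝ) : (S.Uadj z x t)ᵀ = -S.U (S.k z) x t := by
  have h : (S.Uadj z x t)ᵀ = (S.U (S.k (conj z)) x t)ᴴ := rfl
  rw [h, k_conj, U, conjTranspose_add, conjTranspose_smul, conjTranspose_sigma3,
    conjTranspose_Qmat, U]
  simp only [Complex.star_def, map_mul, Complex.conj_I, Complex.conj_conj]
  module

theorem Vadj_transpose (z : ℂ) (x t : ℝ) : (S.Vadj z x t)ᵀ = -S.V (S.k z) x t := by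
  have h : (S.Vadj z x t)ᵀ = (S.V (S.k (conj z)) x t)ᴴ := rfl
  rw [h, k_conj, V_eq_Vgen, conjTranspose_Vgen, V_eq_Vgen]

/-- Together with `trace_V`, this identifies the traces with the derivatives of `iθ₂`, whence the
factor `e^{iθ₂}` in the auxiliary functions. -/
theorem trace_U (κ : ℂ) (x t : ℝ) : (S.U κ x t).trace = Complex.I * κ := by
  rw [U, sigma3_eq]
  simp [Qmat, trace, Fin.sum_univ_three]

theorem trace_V (κ : ℂ) (x t : ℝ) : (S.V κ x t).trace = 4 * Complex.I * κ ^ 3 :=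
  trace_Vgen _ _ _ _

/-- The boundary values of the adjoint columns. -/
def GamAdj (b : Bool) (j : Fin 3) (z : ℂ) : Fin 3 → ℂ :=
  fun i => conj (S.Gam (S.qEnd b) (conj z) i j)

theorem GamAdj_zero (b : Bool) (z : ℂ) : S.GamAdj b 0 z
    = ![conj (S.qEnd b 0) / S.q0, conj (S.qEnd b 1) / S.q0, -(Complex.I * S.q0 / z)] := by
  ext i; fin_cases i <;> simp [GamAdj, Gam, neg_div]

theorem GamAdj_one (b : Bool) (z : ℂ) : S.GamAdj b 1 z
    = ![S.qEnd b 1 / S.q0, -(S.qEnd b 0) / S.q0, 0] := by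
  ext i; fin_cases i <;> simp [GamAdj, Gam]

theorem GamAdj_two (b : Bool) (z : ℂ) : S.GamAdj b 2 z
    = ![-(Complex.I * conj (S.qEnd b 0) / z), -(Complex.I * conj (S.qEnd b 1) / z), 1] := by
  ext i; fin_cases i <;> simp [GamAdj, Gam, neg_div]

variable {S} {z : ℂ} {b : Bool}

theorem GamAdj_dot_Gam (hz : S.Regular z) (i j : Fin 3) :
    S.GamAdj b i z ⬝ᵥ (fun r => S.Gam (S.qEnd b) z r j) = if i = j then S.C i z else 0 := by
  have hs := S.qEnd_sq b
  have hq := S.q0_ne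
  have hz0 := hz.1
  have hI := Complex.I_sq
  fin_cases i <;> fin_cases j <;>
    simp [GamAdj_zero, GamAdj_one, GamAdj_two, Gam, dotProduct, Fin.sum_univ_three, C, gam] <;>
    field_simp <;> (try simp only [hI]) <;> (try ring1) <;>
    first
      | linear_combination hs
      | linear_combination (z ^ 2) * hs
      | linear_combination Complex.I * hs
      | linear_combination (-Complex.I) * hs

/-- The constants `γ`, `-1`, `-1` of this and the next two cross products are those of the
identities between Jost columns, and they explain the minus signs in the `M_j`. -/
theorem GamAdj_cross_zero_two (hz : S.Regular z) :
    crossProduct (S.GamAdj b 0 z) (S.GamAdj b 2 z)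
      = S.gam z • fun r => S.Gam (S.qEnd b) z r 1 := by
  have hq := S.q0_ne
  have hz0 := hz.1
  have hI := Complex.I_sq
  rw [GamAdj_zero, GamAdj_two]
  ext i
  fin_cases i <;> simp [cross_apply, Gam, gam] <;> field_simp <;> (try simp only [hI]) <;> ring

theorem GamAdj_cross_one_two (hz : S.Regular z) :
    crossProduct (S.GamAdj b 1 z) (S.GamAdj b 2 z)
      = (-1 : ℂ) • fun r => S.Gam (S.qEnd b) z r 0 := by
  have hs := S.qEnd_sq b
  have hq := S.q0_ne
  have hz0 := hz.1
  rw [GamAdj_one, GamAdj_two]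
  ext i
  fin_cases i <;> simp [cross_apply, Gam] <;> field_simp <;>
    first | linear_combination hs | linear_combination -hs

theorem GamAdj_cross_zero_one (hz : S.Regular z) :
    crossProduct (S.GamAdj b 0 z) (S.GamAdj b 1 z)
      = (-1 : ℂ) • fun r => S.Gam (S.qEnd b) z r 2 := by
  have hs := S.qEnd_sq b
  have hq := S.q0_ne
  have hz0 := hz.1
  rw [GamAdj_zero, GamAdj_one]
  ext i
  fin_cases i <;> simp [cross_apply, Gam] <;> field_simp <;>
    first | linear_combination hs | linear_combination -hs

end NZBCSolution

end LaxSymmetry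

end CMKdV

/-! ### Scattering coefficients and cross products of Jost columns -/

namespace CMKdV

namespace NZBCSolution

variable (S : NZBCSolution)

/-- The scattering coefficients `a` (`b = true`) and `b` (`b = false`). -/
def sc (b : Bool) (i j : Fin 3) (z : ℂ) : ℂ :=
  (S.C i z)⁻¹ * (S.phiAdj b i 0 0 z ⬝ᵥ S.phi (!b) j 0 0 z)

theorem C_ne {z : ℂ} (hz : S.Regular z) (i : Fin 3) : S.C i z ≠ 0 := by
  fin_cases i
  · exact hz.2
  · exact one_ne_zero
  · exact hz.2

variable {S} {z : ℂ} {b b' : Bool}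

theorem phiAdj_dot_phi_eq {i j : Fin 3} (hi : conj z ∈ S.dom b i) (hj : z ∈ S.dom b' j)
    (x t y s : ℝ) : S.phiAdj b i x t z ⬝ᵥ S.phi b' j x t z
      = S.phiAdj b i y s z ⬝ᵥ S.phi b' j y s z := by
  have h1 := isPhiAdj_phiAdj hi
  have h2 := isPhi_phi hj
  rw [dotProduct_eq_of_adjoint (f := fun x => S.phiAdj b i x t z) (g := fun x => S.phi b' j x t z)
    (fun x => S.Uadj_transpose z x t) (fun x => h1.1 x t) (fun x => h2.1 x t) x y]
  exact dotProduct_eq_of_adjoint (f := fun t => S.phiAdj b i y t z) (g := fun t => S.phi b' j y t z)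
    (fun t => S.Vadj_transpose z y t) (fun t => h1.2.1 y t) (fun t => h2.2.1 y t) t s

theorem phiAdj_dot_phi {i j : Fin 3} (hi : conj z ∈ S.dom b i) (hj : z ∈ S.dom (!b) j)
    (x t : ℝ) : S.phiAdj b i x t z ⬝ᵥ S.phi (!b) j x t z = S.C i z * S.sc b i j z := by
  rw [sc, mul_inv_cancel_left₀ (S.C_ne hj.1 i)]
  exact phiAdj_dot_phi_eq hi hj _ _ _ _

theorem norm_exp_I_theta (h : z.im = 0) (i : Fin 3) (x t : ℝ) :
    ‖Complex.exp (Complex.I * S.theta i x t z)‖ = 1 := by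
  have hc : conj z = z := Complex.conj_eq_iff_im.2 h
  have h1 := S.theta_conj i x t z
  rw [hc] at h1
  have h2 := Complex.conj_eq_iff_im.1 h1.symm
  rw [Complex.norm_exp, Complex.I_mul_re, h2]
  simp

/-- On the real axis, the columns normalized at the same end are biorthogonal. -/
theorem phiAdj_dot_phi_self (h : z.im = 0) (hz : z ≠ 0) (i j : Fin 3) (x t : ℝ) :
    S.phiAdj b i x t z ⬝ᵥ S.phi b j x t z = if i = j then S.C i z else 0 := by
  have hr := regular_of_im_eq_zero (S := S) h hz
  have hc : conj z = z := Complex.conj_eq_iff_im.2 h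
  have hd := mem_dom_of_im_eq_zero hr h
  have hd' : ∀ b j, conj z ∈ S.dom b j := by rw [hc]; exact hd
  have h1 := (isPhiAdj_phiAdj (hd' b i)).2.2 t
  have h2 := (isPhi_phi (hd b j)).2.2 t
  have hne : (endFilter b).NeBot := by cases b <;> simp only [endFilter, cond] <;> infer_instance
  have hdot : Tendsto (fun x => (Complex.exp (- -(Complex.I * S.theta i x t z)) • S.phiAdj b i x t z)
      ⬝ᵥ (Complex.exp (-(Complex.I * S.theta j x t z)) • S.phi b j x t z)) (endFilter b)
      (𝓝 (if i = j then S.C i z else 0)) := by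
    rw [← GamAdj_dot_Gam (b := b) hr]
    exact tendsto_finsetSum _ fun r _ => (tendsto_pi_nhds.1 h1 r).mul (tendsto_pi_nhds.1 h2 r)
  set c := S.phiAdj b i x t z ⬝ᵥ S.phi b j x t z with hcdef
  have hconst : ∀ y, S.phiAdj b i y t z ⬝ᵥ S.phi b j y t z = c :=
    fun y => phiAdj_dot_phi_eq (hd' b i) (hd b j) y t x t
  simp only [neg_neg, smul_dotProduct, dotProduct_smul, hconst, smul_eq_mul] at hdot
  by_cases hij : i = j
  · subst hij
    rw [if_pos rfl] at hdot ⊢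
    refine tendsto_nhds_unique (tendsto_const_nhds.congr fun y => ?_) hdot
    rw [Complex.exp_neg, inv_mul_cancel_left₀ (Complex.exp_ne_zero _)]
  -- Off the diagonal the exponentials do not cancel, but for real `z` they have modulus one; the
  -- norm of the constant pairing thus equals its limit zero.
  · rw [if_neg hij] at hdot ⊢
    have h3 := hdot.norm
    simp only [norm_mul, Complex.exp_neg, norm_inv, norm_exp_I_theta h, one_mul, inv_one, norm_zero] at h3
    exact norm_eq_zero.1 (tendsto_nhds_unique tendsto_const_nhds h3)

/-- The factor `e^{iθ₂}` makes the product a solution, and `θ₂ - θ_i - θ_j = θ_l` gives it the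
exponential of column `l`; the constant `c` normalises the boundary value. -/
theorem isPhi_cross {i j l : Fin 3} (hi : conj z ∈ S.dom b i) (hj : conj z ∈ S.dom b j) {c : ℂ}
    (hc : c ≠ 0) (hΓ : crossProduct (S.GamAdj b i z) (S.GamAdj b j z)
      = c • fun r => S.Gam (S.qEnd b) z r l)
    (hθ : ∀ x t, S.theta 1 x t z = S.theta i x t z + S.theta j x t z + S.theta l x t z) :
    S.IsPhi b l z (fun x t => c⁻¹ • Complex.exp (Complex.I * S.theta2 x t z) •
      crossProduct (S.phiAdj b i x t z) (S.phiAdj b j x t z)) := by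
  have h1 := isPhiAdj_phiAdj hi
  have h2 := isPhiAdj_phiAdj hj
  have hk := fun x t => S.theta_eq 1 x t z
  have hk' : ∀ x t, S.theta 1 x t z = S.theta2 x t z := fun x t => rfl
  have e1 : S.kap 1 z = S.k z := rfl
  have e2 : S.om 1 z = 4 * S.k z ^ 3 := rfl
  refine ⟨fun x t => ?_, fun x t => ?_, fun t => ?_⟩
  · rw [mulVec_smul]
    refine (hasDerivAt_exp_smul_cross (S.Uadj_transpose z x t) (S.trace_U _ x t) ?_ (h1.1 x t)
      (h2.1 x t)).const_smul c⁻¹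
    simp only [← hk', hk, e1]
    have h3 := (((hasDerivAt_id x).ofReal_comp.const_mul (S.k z)).add_const
      (S.om 1 z * t)).const_mul Complex.I
    simpa using h3
  · rw [mulVec_smul]
    refine (hasDerivAt_exp_smul_cross (S.Vadj_transpose z x t) (S.trace_V _ x t) ?_ (h1.2.1 x t)
      (h2.2.1 x t)).const_smul c⁻¹
    simp only [← hk', hk, e2]
    have h3 := (((hasDerivAt_id t).ofReal_comp.const_mul (4 * S.k z ^ 3)).const_add
      (S.kap 1 z * x)).const_mul Complex.I
    refine h3.congr_deriv ?_
    push_cast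
    ring
  · have h3 := (tendsto_cross (h1.2.2 t) (h2.2.2 t)).const_smul c⁻¹
    change Tendsto _ _ (𝓝 (c⁻¹ • crossProduct (S.GamAdj b i z) (S.GamAdj b j z))) at h3
    rw [hΓ, smul_smul, inv_mul_cancel₀ hc, one_smul] at h3
    refine h3.congr fun x => ?_
    rw [smul_comm _ c⁻¹, map_smul, map_smul, LinearMap.smul_apply]
    congr 1
    simp only [smul_smul, ← Complex.exp_add]
    congr 2
    rw [← hk', hθ]
    ring

theorem exp_cross_zero_two (h0 : conj z ∈ S.dom b 0) (h2 : conj z ∈ S.dom b 2) (h1 : z ∈ S.dom b 1)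
    (x t : ℝ) : Complex.exp (Complex.I * S.theta2 x t z) •
      crossProduct (S.phiAdj b 0 x t z) (S.phiAdj b 2 x t z) = S.gam z • S.phi b 1 x t z := by
  have h := isPhi_cross h0 h2 h1.1.2 (GamAdj_cross_zero_two h1.1) (fun x t => by simp [theta])
  have h3 := congrFun (congrFun ((isPhi_phi h1).unique h1 h) x) t
  rw [h3, smul_smul, mul_inv_cancel₀ h1.1.2, one_smul]

theorem exp_cross_one_two (h1 : conj z ∈ S.dom b 1) (h2 : conj z ∈ S.dom b 2) (h0 : z ∈ S.dom b 0)
    (x t : ℝ) : Complex.exp (Complex.I * S.theta2 x t z) •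
      crossProduct (S.phiAdj b 1 x t z) (S.phiAdj b 2 x t z) = -S.phi b 0 x t z := by
  have h := isPhi_cross h1 h2 (by norm_num) (GamAdj_cross_one_two h0.1) (fun x t => by simp [theta])
  have h3 := congrFun (congrFun ((isPhi_phi h0).unique h0 h) x) t
  rw [h3, inv_neg, inv_one, neg_smul, one_smul, neg_neg]

theorem exp_cross_zero_one (h0 : conj z ∈ S.dom b 0) (h1 : conj z ∈ S.dom b 1) (h2 : z ∈ S.dom b 2)
    (x t : ℝ) : Complex.exp (Complex.I * S.theta2 x t z) •
      crossProduct (S.phiAdj b 0 x t z) (S.phiAdj b 1 x t z) = -S.phi b 2 x t z := by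
  have h := isPhi_cross h0 h1 (by norm_num) (GamAdj_cross_zero_one h2.1) (fun x t => by simp [theta])
  have h3 := congrFun (congrFun ((isPhi_phi h2).unique h2 h) x) t
  rw [h3, inv_neg, inv_one, neg_smul, one_smul, neg_neg]

/-- The conjugate of `exp_cross_zero_two` at `z̄`. It allows a middle adjoint column to be traded
for the two outer columns. -/
theorem exp_neg_cross_zero_two (h0 : z ∈ S.dom b 0) (h2 : z ∈ S.dom b 2)
    (h1 : conj z ∈ S.dom b 1) (x t : ℝ) :
    crossProduct (S.phi b 0 x t z) (S.phi b 2 x t z)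
      = (Complex.exp (Complex.I * S.theta2 x t z) * S.gam z) • S.phiAdj b 1 x t z := by
  have hcc : conj (conj z) = z := Complex.conj_conj z
  have h := exp_cross_zero_two (z := conj z) (by rwa [hcc]) (by rwa [hcc]) h1 x t
  have h3 := congrArg star h
  rw [phiAdj_eq (by rwa [hcc]), phiAdj_eq (by rwa [hcc]), star_smul, star_smul, hcc, star_cross,
    star_star, star_star, ← phiAdj_eq h1, gam_conj, Complex.star_def,
    Complex.conj_conj, ← Complex.exp_conj] at h3
  have h4 : S.theta2 x t (conj z) = conj (S.theta2 x t z) := S.theta_conj 1 x t z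
  rw [h4, map_mul, Complex.conj_I, Complex.conj_conj, neg_mul] at h3
  rw [mul_smul, ← h3, smul_smul, ← Complex.exp_add, add_neg_cancel, Complex.exp_zero, one_smul]

end NZBCSolution

end CMKdV

namespace CMKdV

namespace NZBCSolution

variable (S : NZBCSolution)

theorem a_eq_sc (i j : Fin 3) (z : ℂ) : S.a i j z = S.sc true i j z := rfl
theorem b_eq_sc (i j : Fin 3) (z : ℂ) : S.b i j z = S.sc false i j z := rfl

/-! ### The symmetry exchanging the two sheets of `λ` -/

section Hat

theorem hat_conj (z : ℂ) : S.hat (conj z) = conj (S.hat z) := by simp [hat]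

variable {S} {z : ℂ} {b : Bool}

/-- The map `z ↦ ẑ` keeps `k`, hence the Lax pair, and reverses `λ`. It therefore exchanges the
outer columns and fixes the middle one, up to the factors in `hatFactor`. -/
theorem k_hat (hz : z ≠ 0) : S.k (S.hat z) = S.k z := by
  have := S.q0_ne
  rw [k, k, hat]
  field_simp
  ring

theorem lam_hat (hz : z ≠ 0) : S.lam (S.hat z) = -S.lam z := by
  have := S.q0_ne
  rw [lam, lam, hat]
  field_simp
  ring

theorem gam_hat (hz : z ≠ 0) : S.gam (S.hat z) = z ^ 2 / (S.q0 : ℂ) ^ 2 * S.gam z := by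
  have := S.q0_ne
  rw [gam, gam, hat]
  field_simp
  ring

theorem hat_ne (hz : z ≠ 0) : S.hat z ≠ 0 :=
  div_ne_zero (neg_ne_zero.2 (pow_ne_zero 2 S.q0_ne)) hz

theorem regular_hat (hz : S.Regular z) : S.Regular (S.hat z) := by
  refine ⟨hat_ne hz.1, ?_⟩
  rw [gam_hat hz.1]
  exact mul_ne_zero (div_ne_zero (pow_ne_zero 2 hz.1) (pow_ne_zero 2 S.q0_ne)) hz.2

theorem kap_hat (hz : z ≠ 0) (j : Fin 3) : S.kap j (S.hat z) = S.kap j.rev z := by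
  fin_cases j <;> simp [kap, k_hat hz, lam_hat hz]

theorem theta_hat (hz : z ≠ 0) (j : Fin 3) (x t : ℝ) :
    S.theta j x t (S.hat z) = S.theta j.rev x t z := by
  fin_cases j <;> simp [theta, theta1, theta2, k_hat hz, lam_hat hz]

theorem hat_mem_dom {j : Fin 3} (hz : z ∈ S.dom b j) : S.hat z ∈ S.dom b j.rev := by
  refine ⟨regular_hat hz.1, fun l => ?_⟩
  rw [kap_hat hz.1.1, kap_hat hz.1.1, Fin.rev_rev]
  exact hz.2 _

variable (S) in
/-- The factors relating the Jost columns at `z` and `ẑ`. -/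
def hatFactor (j : Fin 3) (z : ℂ) : ℂ := ![S.qz z, 1, S.qz z] j

theorem Gam_hat (hz : z ≠ 0) (w : C2) (i j : Fin 3) :
    S.hatFactor j z * S.Gam w (S.hat z) i j.rev = S.Gam w z i j := by
  have hq := S.q0_ne
  have hI := Complex.I_sq
  fin_cases i <;> fin_cases j <;> simp [hatFactor, qz, Gam, hat] <;> field_simp <;>
    simp only [hI] <;> ring

theorem IsPhi.hat {j : Fin 3} {φ : ℝ → ℝ → Fin 3 → ℂ} (hz : z ≠ 0)
    (h : S.IsPhi b j.rev (S.hat z) φ) :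
    S.IsPhi b j z (fun x t => S.hatFactor j z • φ x t) := by
  refine ⟨fun x t => ?_, fun x t => ?_, fun t => ?_⟩
  · rw [mulVec_smul, ← k_hat hz]; exact (h.1 x t).const_smul (S.hatFactor j z)
  · rw [mulVec_smul, ← k_hat hz]; exact (h.2.1 x t).const_smul (S.hatFactor j z)
  · have h1 := (h.2.2 t).const_smul (S.hatFactor j z)
    simp only [theta_hat hz, Fin.rev_rev] at h1
    have h2 : (S.hatFactor j z • fun i => S.Gam (S.qEnd b) (S.hat z) i j.rev)
        = fun i => S.Gam (S.qEnd b) z i j := funext fun i => Gam_hat hz _ _ _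
    rw [h2] at h1
    refine h1.congr fun x => ?_
    rw [smul_comm]

theorem phi_hat {j : Fin 3} (hz : z ∈ S.dom b j) (x t : ℝ) :
    S.phi b j x t z = S.hatFactor j z • S.phi b j.rev x t (S.hat z) :=
  congrFun (congrFun ((isPhi_phi hz).unique hz ((isPhi_phi (hat_mem_dom hz)).hat hz.1.1)) x) t

theorem phiAdj_hat {j : Fin 3} (hz : conj z ∈ S.dom b j) (x t : ℝ) :
    S.phiAdj b j x t z = conj (S.hatFactor j (conj z)) • S.phiAdj b j.rev x t (S.hat z) := by
  have h := hat_mem_dom hz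
  rw [hat_conj] at h
  rw [phiAdj_eq hz, phi_hat hz, star_smul, phiAdj_eq h, hat_conj]
  rfl

theorem qz_mul_zq (hz : z ≠ 0) : S.qz z * S.zq z = 1 := by
  have := S.q0_ne
  rw [qz, zq]
  field_simp

theorem conj_qz (z : ℂ) : conj (S.qz (conj z)) = -S.qz z := by simp [qz, neg_div]

theorem C_hat_factor (hz : S.Regular z) (i : Fin 3) :
    (S.C i z)⁻¹ * conj (S.hatFactor i (conj z)) * S.C i.rev (S.hat z) = ![S.zq z, 1, S.zq z] i := by
  have h1 := hz.1
  have h2 := hz.2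
  have hq := S.q0_ne
  have hI := Complex.I_sq
  have e : (S.gam z)⁻¹ * -S.qz z * (z ^ 2 / (S.q0 : ℂ) ^ 2 * S.gam z) = S.zq z := by
    rw [qz, zq]
    field_simp
    rw [hI, neg_neg]
  fin_cases i <;> simp [C, hatFactor, -map_div₀] <;> rw [conj_qz, gam_hat h1, e]

/-- The symmetry `z ↦ ẑ` of the scattering coefficients. -/
theorem sc_hat {i j : Fin 3} (hi : conj z ∈ S.dom b i) (hj : z ∈ S.dom (!b) j) :
    S.sc b i j z = ![S.zq z, 1, S.zq z] i * ![S.qz z, 1, S.qz z] j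
      * S.sc b i.rev j.rev (S.hat z) := by
  have h := C_ne S (regular_hat hj.1) i.rev
  rw [← C_hat_factor hj.1, sc, phiAdj_hat hi, phi_hat hj, sc, smul_dotProduct, dotProduct_smul]
  simp only [smul_eq_mul, hatFactor]
  field_simp

/-- The symmetry `z ↦ z̄` of the scattering coefficients. -/
theorem conj_sc {i j : Fin 3} (hi : z ∈ S.dom b i) (hj : conj z ∈ S.dom (!b) j) :
    conj (S.sc b i j (conj z)) = (S.C i z)⁻¹ * S.C j z * S.sc (!b) j i z := by
  have hCc : ∀ i, S.C i (conj z) = conj (S.C i z) := fun i => by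
    fin_cases i <;> simp [C, gam_conj]
  have hcc : conj (conj z) = z := Complex.conj_conj z
  rw [sc, phiAdj_eq (by rwa [hcc]), hcc, map_mul, map_inv₀, hCc, Complex.conj_conj, mul_assoc, sc,
    mul_inv_cancel_left₀ (C_ne S hi.1 j), phiAdj_eq hj, Bool.not_not, dotProduct_comm]
  congr 1
  simp only [dotProduct, map_sum, map_mul, Pi.star_apply, Complex.star_def, Complex.conj_conj]

end Hat

/-! ### Reflection coefficients as ratios of scattering coefficients at one point -/

section Reflection

variable {S} {z : ℂ}

/-- The lemmas of this section remove all arguments `ẑ` and conjugates from the jump matrices, so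
that the jumps become linear algebra at `z`. They ask only for the columns involved, and so also
serve on the circular arcs where those columns exist. -/
theorem rho3_hat (h2 : conj z ∈ S.dom true 0) (h1 : conj z ∈ S.dom true 1)
    (h : z ∈ S.dom false 1) : S.rho3 (S.hat z) = S.qz z * S.a 0 1 z / S.a 1 1 z := by
  have e1 := sc_hat h2 h
  have e2 := sc_hat h1 h
  simp at e1 e2
  rw [rho3, a_eq_sc, a_eq_sc, a_eq_sc, a_eq_sc, e1, e2, ← mul_assoc, qz_mul_zq h.1.1, one_mul]

theorem rho1_hat (h1 : conj z ∈ S.dom true 1) (h2 : conj z ∈ S.dom true 2)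
    (h : z ∈ S.dom false 2) : S.rho1 (S.hat z) = S.zq z * S.a 1 2 z / S.a 2 2 z := by
  have e1 := sc_hat h1 h
  have e2 := sc_hat h2 h
  have e := qz_mul_zq (S := S) h.1.1
  simp at e1 e2
  rw [mul_comm (S.zq z), e, one_mul] at e2
  rw [rho1, a_eq_sc, a_eq_sc, a_eq_sc, a_eq_sc, e1, e2, ← mul_assoc, mul_comm (S.zq z), e, one_mul]

theorem rho2_hat (h0 : conj z ∈ S.dom true 0) (h2 : conj z ∈ S.dom true 2)
    (h : z ∈ S.dom false 2) : S.rho2 (S.hat z) = S.a 0 2 z / S.a 2 2 z := by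
  have e1 := sc_hat h0 h
  have e2 := sc_hat h2 h
  have e := qz_mul_zq (S := S) h.1.1
  simp at e1 e2
  rw [mul_comm (S.zq z), e, one_mul] at e1 e2
  rw [rho2, a_eq_sc, a_eq_sc, a_eq_sc, a_eq_sc, e1, e2]

theorem star_rho2 (h2 : z ∈ S.dom true 2) (h0 : z ∈ S.dom true 0) (h : conj z ∈ S.dom false 0) :
    star' S.rho2 z = S.b 0 2 z / S.b 0 0 z := by
  have hg := h0.1.2
  have e1 := conj_sc h2 h
  have e2 := conj_sc h0 h
  simp only [C, cons_val, Bool.not_true] at e1 e2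
  rw [inv_mul_cancel₀ hg, one_mul] at e1 e2
  rw [star', rho2, map_div₀, a_eq_sc, a_eq_sc, e1, e2]
  rfl

theorem star_rho2_hat (h0 : z ∈ S.dom true 0) (h2 : z ∈ S.dom true 2) (h : conj z ∈ S.dom false 2) :
    star' S.rho2 (S.hat z) = S.b 2 0 z / S.b 2 2 z := by
  have hg := h0.1.2
  have hcc : conj (conj z) = z := Complex.conj_conj z
  have e1 := conj_sc h0 h
  have e2 := conj_sc h2 h
  simp only [C, cons_val, Bool.not_true] at e1 e2
  rw [inv_mul_cancel₀ hg, one_mul] at e1 e2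
  rw [star', ← hat_conj, rho2_hat (by rwa [hcc]) (by rwa [hcc]) h, map_div₀, a_eq_sc, a_eq_sc, e1,
    e2]
  rfl

theorem star_rho3 (h2 : z ∈ S.dom true 2) (h1 : z ∈ S.dom true 1) (h : conj z ∈ S.dom false 1) :
    S.gam z * star' S.rho3 z = S.b 1 2 z / S.b 1 1 z := by
  have hg := h1.1.2
  have e1 := conj_sc h2 h
  have e2 := conj_sc h1 h
  simp only [C, cons_val, Bool.not_true, mul_one, inv_one, one_mul] at e1 e2
  rw [star', rho3, map_div₀, a_eq_sc, a_eq_sc, e1, e2, b_eq_sc, b_eq_sc]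
  field_simp

theorem star_rho3_hat (h0 : z ∈ S.dom true 0) (h1 : z ∈ S.dom true 1) (h : conj z ∈ S.dom false 1) :
    S.zq z * S.gam z * star' S.rho3 (S.hat z) = -(S.b 1 0 z / S.b 1 1 z) := by
  have hg := h1.1.2
  have hcc : conj (conj z) = z := Complex.conj_conj z
  have e1 := conj_sc h0 h
  have e2 := conj_sc h1 h
  have e := qz_mul_zq (S := S) h0.1.1
  simp only [C, cons_val, Bool.not_true, mul_one, inv_one, one_mul] at e1 e2
  rw [star', ← hat_conj, rho3_hat (by rwa [hcc]) (by rwa [hcc]) h, map_div₀, map_mul, conj_qz,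
    a_eq_sc, a_eq_sc, e1, e2, b_eq_sc, b_eq_sc]
  field_simp
  linear_combination (-S.sc false 1 0 z / S.sc false 1 1 z) * e

end Reflection

/-! ### Auxiliary eigenfunctions in terms of Jost columns -/

section Auxiliary

variable {S} {z : ℂ}

theorem cross_cross_left (u v w : Fin 3 → ℂ) :
    crossProduct (crossProduct u v) w = (w ⬝ᵥ u) • v - (w ⬝ᵥ v) • u := by
  ext i
  fin_cases i <;> simp [cross_apply, dotProduct, Fin.sum_univ_three] <;> ring

theorem phiAdj_one_eq {b : Bool} (h0 : z ∈ S.dom b 0) (h2 : z ∈ S.dom b 2)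
    (h1 : conj z ∈ S.dom b 1) (x t : ℝ) :
    Complex.exp (Complex.I * S.theta2 x t z) • S.phiAdj b 1 x t z
      = (S.gam z)⁻¹ • crossProduct (S.phi b 0 x t z) (S.phi b 2 x t z) := by
  rw [exp_neg_cross_zero_two h0 h2 h1, smul_smul, mul_comm (Complex.exp _),
    inv_mul_cancel_left₀ h0.1.2]

/-- The middle adjoint column is replaced by a cross product of outer columns and the triple product
is expanded. The two pairings that appear are scattering coefficients, and for the outer indices `C
i = γ` cancels the factor `γ⁻¹`. Only outer columns at one end are used, hence validity on the arcs.
-/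
theorem exp_cross_phiAdj {b : Bool} {i : Fin 3} (hi : i = 0 ∨ i = 2) (h0 : z ∈ S.dom (!b) 0)
    (h2 : z ∈ S.dom (!b) 2) (h1 : conj z ∈ S.dom (!b) 1) (h : conj z ∈ S.dom b i) (x t : ℝ) :
    Complex.exp (Complex.I * S.theta2 x t z) •
      crossProduct (S.phiAdj (!b) 1 x t z) (S.phiAdj b i x t z)
      = S.sc b i 0 z • S.phi (!b) 2 x t z - S.sc b i 2 z • S.phi (!b) 0 x t z := by
  have hg := h0.1.2
  have hC : S.C i z = S.gam z := by rcases hi with rfl | rfl <;> rfl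
  rw [← LinearMap.smul_apply, ← map_smul, phiAdj_one_eq h0 h2 h1, map_smul, LinearMap.smul_apply,
    cross_cross_left, phiAdj_dot_phi h h0, phiAdj_dot_phi h h2, hC, smul_sub, smul_smul, smul_smul,
    inv_mul_cancel_left₀ hg, inv_mul_cancel_left₀ hg]

theorem chi1_eq (h0 : z ∈ S.dom false 0) (h2 : z ∈ S.dom false 2) (h1 : conj z ∈ S.dom false 1)
    (h : conj z ∈ S.dom true 2) (x t : ℝ) :
    S.chi1 x t z = S.a 2 0 z • S.PhiMinus 2 x t z - S.a 2 2 z • S.PhiMinus 0 x t z :=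
  exp_cross_phiAdj (b := true) (Or.inr rfl) h0 h2 h1 h x t

theorem chi2_eq (h0 : z ∈ S.dom true 0) (h2 : z ∈ S.dom true 2) (h1 : conj z ∈ S.dom true 1)
    (h : conj z ∈ S.dom false 2) (x t : ℝ) :
    S.chi2 x t z = S.b 2 0 z • S.PhiPlus 2 x t z - S.b 2 2 z • S.PhiPlus 0 x t z :=
  exp_cross_phiAdj (b := false) (Or.inr rfl) h0 h2 h1 h x t

theorem chi3_eq (h0 : z ∈ S.dom true 0) (h2 : z ∈ S.dom true 2) (h1 : conj z ∈ S.dom true 1)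
    (h : conj z ∈ S.dom false 0) (x t : ℝ) :
    S.chi3 x t z = S.b 0 2 z • S.PhiPlus 0 x t z - S.b 0 0 z • S.PhiPlus 2 x t z := by
  have h3 := exp_cross_phiAdj (b := false) (Or.inl rfl) h0 h2 h1 h x t
  rw [← cross_anticomm, smul_neg, neg_eq_iff_eq_neg, neg_sub] at h3
  exact h3

theorem chi4_eq (h0 : z ∈ S.dom false 0) (h2 : z ∈ S.dom false 2) (h1 : conj z ∈ S.dom false 1)
    (h : conj z ∈ S.dom true 0) (x t : ℝ) :
    S.chi4 x t z = S.a 0 2 z • S.PhiMinus 0 x t z - S.a 0 0 z • S.PhiMinus 2 x t z := by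
  have h3 := exp_cross_phiAdj (b := true) (Or.inl rfl) h0 h2 h1 h x t
  rw [← cross_anticomm, smul_neg, neg_eq_iff_eq_neg, neg_sub] at h3
  exact h3

theorem cross_dot (u v w s : Fin 3 → ℂ) : crossProduct u v ⬝ᵥ crossProduct w s
    = (w ⬝ᵥ u) * (s ⬝ᵥ v) - (s ⬝ᵥ u) * (w ⬝ᵥ v) := by
  simp [cross_apply, dotProduct, Fin.sum_univ_three]
  ring

/-- The second row of the inverse scattering matrix by cofactors. -/
theorem phiAdj_one_dot_exp_cross {i j : Fin 3} (h0 : z ∈ S.dom false 0) (h2 : z ∈ S.dom false 2)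
    (h1 : conj z ∈ S.dom false 1) (hi : conj z ∈ S.dom true i) (hj : conj z ∈ S.dom true j) :
    S.phiAdj false 1 0 0 z ⬝ᵥ (Complex.exp (Complex.I * S.theta2 0 0 z) •
      crossProduct (S.phiAdj true i 0 0 z) (S.phiAdj true j 0 0 z))
      = (S.gam z)⁻¹ * S.C i z * S.C j z * (S.a i 0 z * S.a j 2 z - S.a j 0 z * S.a i 2 z) := by
  rw [dotProduct_smul, ← smul_dotProduct, phiAdj_one_eq h0 h2 h1, smul_dotProduct, cross_dot]
  have e := fun (i l : Fin 3) (hi : conj z ∈ S.dom true i) (hl : z ∈ S.dom false l) =>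
    phiAdj_dot_phi (b := true) hi hl 0 0
  simp only [Bool.not_true] at e
  rw [e _ _ hi h0, e _ _ hi h2, e _ _ hj h0, e _ _ hj h2, smul_eq_mul]
  simp only [a_eq_sc]
  ring

/-- A cofactor formula for the middle entry of the inverse, derived from columns rather than from a
product of full matrices, so that it holds on the arc `Sigma4` too. -/
theorem b11_eq (h0 : z ∈ S.dom false 0) (h2 : z ∈ S.dom false 2) (h1 : conj z ∈ S.dom false 1)
    (h0' : conj z ∈ S.dom true 0) (h2' : conj z ∈ S.dom true 2) (h1' : z ∈ S.dom true 1) :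
    S.b 1 1 z = S.a 0 0 z * S.a 2 2 z - S.a 2 0 z * S.a 0 2 z := by
  have h := phiAdj_one_dot_exp_cross h0 h2 h1 h0' h2'
  have hg := h0.1.2
  have e := phiAdj_dot_phi (b := false) h1 h1' 0 0
  rw [Bool.not_false] at e
  rw [exp_cross_zero_two h0' h2' h1', dotProduct_smul, e] at h
  simp only [C, cons_val, smul_eq_mul, one_mul] at h
  rw [b_eq_sc]
  field_simp at h
  exact h

theorem b10_eq (h0 : z ∈ S.dom false 0) (h2 : z ∈ S.dom false 2) (h1 : conj z ∈ S.dom false 1)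
    (h1' : conj z ∈ S.dom true 1) (h2' : conj z ∈ S.dom true 2) (h0' : z ∈ S.dom true 0) :
    S.b 1 0 z = S.a 2 0 z * S.a 1 2 z - S.a 1 0 z * S.a 2 2 z := by
  have h := phiAdj_one_dot_exp_cross h0 h2 h1 h1' h2'
  have hg := h0.1.2
  have e := phiAdj_dot_phi (b := false) h1 h0' 0 0
  rw [Bool.not_false] at e
  rw [exp_cross_one_two h1' h2' h0', dotProduct_neg, e] at h
  simp only [C, cons_val, mul_one, one_mul] at h
  rw [b_eq_sc]
  rw [inv_mul_cancel₀ hg] at h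
  linear_combination -h

theorem b12_eq (h0 : z ∈ S.dom false 0) (h2 : z ∈ S.dom false 2) (h1 : conj z ∈ S.dom false 1)
    (h0' : conj z ∈ S.dom true 0) (h1' : conj z ∈ S.dom true 1) (h2' : z ∈ S.dom true 2) :
    S.b 1 2 z = S.a 1 0 z * S.a 0 2 z - S.a 0 0 z * S.a 1 2 z := by
  have h := phiAdj_one_dot_exp_cross h0 h2 h1 h0' h1'
  have hg := h0.1.2
  have e := phiAdj_dot_phi (b := false) h1 h2' 0 0
  rw [Bool.not_false] at e
  rw [exp_cross_zero_one h0' h1' h2', dotProduct_neg, e] at h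
  simp only [C, cons_val, mul_one, one_mul] at h
  rw [b_eq_sc]
  rw [inv_mul_cancel₀ hg] at h
  linear_combination -h

end Auxiliary

end NZBCSolution

end CMKdV

namespace CMKdV

namespace NZBCSolution

variable (S : NZBCSolution)

/-! ### The scattering relation on the real axis -/

section RealAxis

/-- The matrix of the columns `phi b j`. -/
def phiMat (b : Bool) (x t : ℝ) (z : ℂ) : Matrix (Fin 3) (Fin 3) ℂ :=
  Matrix.of fun i j => S.phi b j x t z i

theorem PhiPlusMat_eq (x t : ℝ) (z : ℂ) : S.PhiPlusMat x t z = S.phiMat true x t z := by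
  ext i j
  fin_cases j <;> rfl

theorem PhiMinusMat_eq (x t : ℝ) (z : ℂ) : S.PhiMinusMat x t z = S.phiMat false x t z := by
  ext i j
  fin_cases j <;> rfl

variable {S} {z : ℂ} {b : Bool}

/-- Biorthogonality of columns and adjoint columns exhibits an explicit left inverse. -/
theorem inv_mul_phiMat (h : z.im = 0) (hz : z ≠ 0) (x t : ℝ) :
    (Matrix.of fun i j => (S.C i z)⁻¹ * S.phiAdj b i x t z j) * S.phiMat b x t z = 1 := by
  ext i j
  have h1 := phiAdj_dot_phi_self (S := S) (b := b) h hz i j x t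
  have hC := S.C_ne (regular_of_im_eq_zero h hz) i
  simp only [Matrix.mul_apply, Matrix.of_apply, phiMat, mul_assoc, ← Finset.mul_sum]
  change _ * (S.phiAdj b i x t z ⬝ᵥ S.phi b j x t z) = _
  rw [h1, Matrix.one_apply]
  split_ifs
  · exact inv_mul_cancel₀ hC
  · exact mul_zero _

theorem phiMat_det_ne (h : z.im = 0) (hz : z ≠ 0) (x t : ℝ) : (S.phiMat b x t z).det ≠ 0 := by
  have h1 := congrArg Matrix.det (inv_mul_phiMat (S := S) (b := b) h hz x t)
  rw [det_mul, det_one] at h1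
  exact right_ne_zero_of_mul_eq_one h1

theorem phiMat_eq (h : z.im = 0) (hz : z ≠ 0) (x t : ℝ) :
    S.phiMat (!b) x t z = S.phiMat b x t z * Matrix.of fun i j => S.sc b i j z := by
  have hr := regular_of_im_eq_zero (S := S) h hz
  have hd := mem_dom_of_im_eq_zero hr h
  have hc : conj z = z := Complex.conj_eq_iff_im.2 h
  have h1 := mul_eq_one_comm.1 (inv_mul_phiMat (S := S) (b := b) h hz x t)
  have h2 : (Matrix.of fun i j => (S.C i z)⁻¹ * S.phiAdj b i x t z j) * S.phiMat (!b) x t z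
      = Matrix.of fun i j => S.sc b i j z := by
    ext i j
    simp only [Matrix.mul_apply, Matrix.of_apply, phiMat, mul_assoc, ← Finset.mul_sum]
    change _ * (S.phiAdj b i x t z ⬝ᵥ S.phi (!b) j x t z) = _
    rw [phiAdj_dot_phi (by rw [hc]; exact hd _ _) (hd _ _), inv_mul_cancel_left₀ (S.C_ne hr i)]
  rw [← h2, ← Matrix.mul_assoc, h1, Matrix.one_mul]

theorem sc_mul_sc (h : z.im = 0) (hz : z ≠ 0) :
    (Matrix.of fun i j => S.sc b i j z) * (Matrix.of fun i j => S.sc (!b) i j z) = 1 := by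
  have h1 := phiMat_eq (S := S) (b := b) h hz 0 0
  have h2 := phiMat_eq (S := S) (b := !b) h hz 0 0
  rw [Bool.not_not, h1, Matrix.mul_assoc] at h2
  have h3 := inv_mul_phiMat (S := S) (b := b) h hz 0 0
  have h4 := congrArg (fun M => (Matrix.of fun i j => (S.C i z)⁻¹ * S.phiAdj b i 0 0 z j) * M) h2
  simp only [← Matrix.mul_assoc, h3, Matrix.one_mul] at h4
  exact h4.symm

theorem PhiMinus_eq (h : z.im = 0) (hz : z ≠ 0) (x t : ℝ) (j : Fin 3) :
    S.PhiMinus j x t z = S.a 0 j z • S.PhiPlus 0 x t z + S.a 1 j z • S.PhiPlus 1 x t z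
      + S.a 2 j z • S.PhiPlus 2 x t z := by
  ext i
  have h1 := congrFun (congrFun (phiMat_eq (S := S) (b := true) h hz x t) i) j
  simp only [Matrix.mul_apply, Fin.sum_univ_three, Matrix.of_apply, phiMat] at h1
  change S.PhiMinus j x t z i = S.PhiPlus 0 x t z i * S.a 0 j z + S.PhiPlus 1 x t z i * S.a 1 j z
    + S.PhiPlus 2 x t z i * S.a 2 j z at h1
  simp only [h1, Pi.add_apply, Pi.smul_apply, smul_eq_mul]
  ring

theorem b_mul_a_apply (h : z.im = 0) (hz : z ≠ 0) (i j : Fin 3) :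
    S.b i 0 z * S.a 0 j z + S.b i 1 z * S.a 1 j z + S.b i 2 z * S.a 2 j z = if i = j then 1 else 0 := by
  have h1 := congrFun (congrFun (sc_mul_sc (S := S) (b := false) h hz) i) j
  rw [Matrix.one_apply, Matrix.mul_apply, Fin.sum_univ_three] at h1
  exact h1

/-- Expanding both `Φ₋` columns in the basis `Φ₊` cancels the component along `PhiPlus 2`; the two
remaining coefficients are the cofactors `b10_eq` and `b11_eq`. -/
theorem chi1_eq_of_real (h : z.im = 0) (hz : z ≠ 0) (x t : ℝ) :
    S.chi1 x t z = S.b 1 0 z • S.PhiPlus 1 x t z - S.b 1 1 z • S.PhiPlus 0 x t z := by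
  have hd := mem_dom_of_im_eq_zero (regular_of_im_eq_zero (S := S) h hz) h
  have hd' : ∀ b j, conj z ∈ S.dom b j := by rw [Complex.conj_eq_iff_im.2 h]; exact hd
  rw [chi1_eq (hd _ _) (hd _ _) (hd' _ _) (hd' _ _), PhiMinus_eq h hz, PhiMinus_eq h hz,
    b10_eq (hd _ _) (hd _ _) (hd' _ _) (hd' _ _) (hd' _ _) (hd _ _),
    b11_eq (hd _ _) (hd _ _) (hd' _ _) (hd' _ _) (hd' _ _) (hd _ _)]
  module

theorem chi4_eq_of_real (h : z.im = 0) (hz : z ≠ 0) (x t : ℝ) :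
    S.chi4 x t z = S.b 1 2 z • S.PhiPlus 1 x t z - S.b 1 1 z • S.PhiPlus 2 x t z := by
  have hd := mem_dom_of_im_eq_zero (regular_of_im_eq_zero (S := S) h hz) h
  have hd' : ∀ b j, conj z ∈ S.dom b j := by rw [Complex.conj_eq_iff_im.2 h]; exact hd
  rw [chi4_eq (hd _ _) (hd _ _) (hd' _ _) (hd' _ _), PhiMinus_eq h hz, PhiMinus_eq h hz,
    b12_eq (hd _ _) (hd _ _) (hd' _ _) (hd' _ _) (hd' _ _) (hd _ _),
    b11_eq (hd _ _) (hd _ _) (hd' _ _) (hd' _ _) (hd' _ _) (hd _ _)]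
  module

end RealAxis

/-! ### The jump conditions -/

section Jump

variable {S} {z : ℂ}

theorem cols_mul_diagonal (c₁ c₂ c₃ : Fin 3 → ℂ) (d : Fin 3 → ℂ) :
    cols c₁ c₂ c₃ * diagonal d = cols (d 0 • c₁) (d 1 • c₂) (d 2 • c₃) := by
  ext i j
  rw [mul_diagonal]
  fin_cases j <;> simp [cols, mul_comm]

theorem cols_mul (c₁ c₂ c₃ : Fin 3 → ℂ) (M : Matrix (Fin 3) (Fin 3) ℂ) :
    cols c₁ c₂ c₃ * M = cols (M 0 0 • c₁ + M 1 0 • c₂ + M 2 0 • c₃)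
      (M 0 1 • c₁ + M 1 1 • c₂ + M 2 1 • c₃) (M 0 2 • c₁ + M 1 2 • c₂ + M 2 2 • c₃) := by
  ext i j
  fin_cases j <;> simp [cols, Matrix.mul_apply, Fin.sum_univ_three, mul_comm]

theorem cols_sub (c₁ c₂ c₃ d₁ d₂ d₃ : Fin 3 → ℂ) :
    cols c₁ c₂ c₃ - cols d₁ d₂ d₃ = cols (c₁ - d₁) (c₂ - d₂) (c₃ - d₃) := by
  ext i j
  fin_cases j <;> simp [cols]

theorem expNegTheta_mul_expTheta (x t : ℝ) : S.expNegTheta x t z * S.expTheta x t z = 1 := by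
  rw [expNegTheta, expTheta, diagonal_mul_diagonal]
  simp only [← Complex.exp_add, neg_add_cancel, Complex.exp_zero, diagonal_one]

/-- Since each `M` is a matrix of unmodified columns times `e^{-iθ}`, the conjugation by `e^{iθ}`
drops out and only an identity between constant combinations of columns remains. -/
theorem mul_jump {M M' N N' : Matrix (Fin 3) (Fin 3) ℂ} {L : ℂ → Matrix (Fin 3) (Fin 3) ℂ}
    {x t : ℝ} (hM : M = N * S.expNegTheta x t z) (hM' : M' = N' * S.expNegTheta x t z)
    (h : N = N' - N' * L z) : M = M' * S.jump L x t z := by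
  rw [jump, hM', Matrix.mul_sub, Matrix.mul_one, Matrix.mul_assoc, ← Matrix.mul_assoc
    (S.expNegTheta x t z), ← Matrix.mul_assoc (S.expNegTheta x t z), expNegTheta_mul_expTheta,
    Matrix.one_mul, ← Matrix.mul_assoc, ← Matrix.sub_mul, ← h, hM]

theorem M1_eq (x t : ℝ) : S.M1 x t z = cols (-((S.b 1 1 z)⁻¹ • S.chi1 x t z)) (S.PhiPlus 1 x t z)
    ((S.a 2 2 z)⁻¹ • S.PhiMinus 2 x t z) * S.expNegTheta x t z := by
  rw [expNegTheta, cols_mul_diagonal, M1, smul_neg, smul_comm _ (S.b 1 1 z)⁻¹,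
    smul_comm _ (S.a 2 2 z)⁻¹]
  rfl

theorem M2_eq (x t : ℝ) : S.M2 x t z = cols (-((S.b 2 2 z)⁻¹ • S.chi2 x t z))
    ((S.a 1 1 z)⁻¹ • S.PhiMinus 1 x t z) (S.PhiPlus 2 x t z) * S.expNegTheta x t z := by
  rw [expNegTheta, cols_mul_diagonal, M2, smul_neg, smul_comm _ (S.b 2 2 z)⁻¹,
    smul_comm _ (S.a 1 1 z)⁻¹]
  rfl

theorem exp_neg_theta_two (x t : ℝ) : Complex.exp (-(Complex.I * S.theta 2 x t z))
    = Complex.exp (Complex.I * S.theta1 x t z) := by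
  simp [theta]

theorem M3_eq (x t : ℝ) : S.M3 x t z = cols (S.PhiPlus 0 x t z)
    ((S.a 1 1 z)⁻¹ • S.PhiMinus 1 x t z) (-((S.b 0 0 z)⁻¹ • S.chi3 x t z)) * S.expNegTheta x t z := by
  rw [expNegTheta, cols_mul_diagonal, M3, smul_neg, smul_comm _ (S.b 0 0 z)⁻¹,
    smul_comm _ (S.a 1 1 z)⁻¹, exp_neg_theta_two]
  rfl

theorem M4_eq (x t : ℝ) : S.M4 x t z = cols ((S.a 0 0 z)⁻¹ • S.PhiMinus 0 x t z)
    (S.PhiPlus 1 x t z) (-((S.b 1 1 z)⁻¹ • S.chi4 x t z)) * S.expNegTheta x t z := by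
  rw [expNegTheta, cols_mul_diagonal, M4, smul_neg, smul_comm _ (S.b 1 1 z)⁻¹,
    smul_comm _ (S.a 0 0 z)⁻¹, exp_neg_theta_two]
  rfl

/-- Both matrices share the middle column, and `χ₂`, `χ₃` lie in the span of `PhiPlus 0` and
`PhiPlus 2`. Hence the trivial middle row and column of `L₂`. -/
theorem jump2 (h0 : z ∈ S.dom true 0) (h2 : z ∈ S.dom true 2) (h1 : conj z ∈ S.dom true 1)
    (h0' : conj z ∈ S.dom false 0) (h2' : conj z ∈ S.dom false 2)
    (hb0 : S.b 0 0 z ≠ 0) (hb2 : S.b 2 2 z ≠ 0) (x t : ℝ) :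
    S.M3 x t z = S.M2 x t z * S.jump S.L2 x t z := by
  refine mul_jump (M3_eq x t) (M2_eq x t) ?_
  rw [cols_mul, cols_sub, L2, star_rho2 h2 h0 h0', star_rho2_hat h0 h2 h2', chi2_eq h0 h2 h1 h2',
    chi3_eq h0 h2 h1 h0']
  congr 1 <;> ext i <;> simp <;> field_simp <;> ring

/-- As on the opposite arc, now in the span of `PhiMinus 0` and `PhiMinus 2`. The formula `b11_eq`
supplies the determinant of the change of basis. -/
theorem jump4 (h0 : z ∈ S.dom false 0) (h2 : z ∈ S.dom false 2) (h1 : z ∈ S.dom true 1)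
    (h0' : conj z ∈ S.dom true 0) (h2' : conj z ∈ S.dom true 2) (h1' : conj z ∈ S.dom false 1)
    (hb1 : S.b 1 1 z ≠ 0) (ha2 : S.a 2 2 z ≠ 0) (ha0 : S.a 0 0 z ≠ 0) (x t : ℝ) :
    S.M1 x t z = S.M4 x t z * S.jump S.L4 x t z := by
  have e := b11_eq h0 h2 h1' h0' h2' h1
  refine mul_jump (M1_eq x t) (M4_eq x t) ?_
  rw [cols_mul, cols_sub, L4, rho2_hat h0' h2' h2, rho2, chi1_eq h0 h2 h1' h2',
    chi4_eq h0 h2 h1' h0']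
  congr 1 <;> ext i <;> simp <;> field_simp <;> rw [e] <;> ring

/-- All columns are written in the basis `Φ₊`, and the entries of `L₁` as ratios of entries of `A`
and `B`; comparison of coefficients finishes. -/
theorem jump1 (h : z.im = 0) (hz : z ≠ 0)
    (hb1 : S.b 1 1 z ≠ 0) (ha2 : S.a 2 2 z ≠ 0) (hb2 : S.b 2 2 z ≠ 0) (ha1 : S.a 1 1 z ≠ 0)
    (x t : ℝ) : S.M1 x t z = S.M2 x t z * S.jump S.L1 x t z := by
  have hd := mem_dom_of_im_eq_zero (regular_of_im_eq_zero (S := S) h hz) h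
  have hd' : ∀ b j, conj z ∈ S.dom b j := by rw [Complex.conj_eq_iff_im.2 h]; exact hd
  have r3 := rho3_hat (hd' _ _) (hd' _ _) (hd false 1)
  have r1 := rho1_hat (hd' _ _) (hd' _ _) (hd false 2)
  have r2 := rho2_hat (hd' _ _) (hd' _ _) (hd false 2)
  have s2 := star_rho2_hat (hd _ _) (hd _ _) (hd' false 2)
  have s3 := star_rho3_hat (hd _ _) (hd true 1) (hd' false 1)
  have e := qz_mul_zq (S := S) hz
  -- The sign comes from the `i` in `zq`.
  have ez : z ^ 2 / (S.q0 : ℂ) ^ 2 = -(S.zq z * S.zq z) := by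
    have := S.q0_ne
    have hI := Complex.I_sq
    rw [zq]
    field_simp
    rw [hI]
  have e3 : S.zq z * S.rho3 (S.hat z) = S.a 0 1 z / S.a 1 1 z := by
    rw [r3]; linear_combination (S.a 0 1 z / S.a 1 1 z) * e
  have e1 : S.qz z * S.rho1 (S.hat z) = S.a 1 2 z / S.a 2 2 z := by
    rw [r1]; linear_combination (S.a 1 2 z / S.a 2 2 z) * e
  have e13 : S.rho1 (S.hat z) * S.rho3 (S.hat z)
      = S.a 1 2 z / S.a 2 2 z * (S.a 0 1 z / S.a 1 1 z) := by
    rw [r1, r3]; linear_combination (S.a 1 2 z / S.a 2 2 z * (S.a 0 1 z / S.a 1 1 z)) * e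
  have e33 : z ^ 2 / (S.q0 : ℂ) ^ 2 * S.gam z * star' S.rho3 (S.hat z) * S.rho3 (S.hat z)
      = S.b 1 0 z / S.b 1 1 z * (S.a 0 1 z / S.a 1 1 z) := by
    rw [ez, ← e3]
    linear_combination (-S.zq z * S.rho3 (S.hat z)) * s3
  have s3' : S.gam z * S.zq z * star' S.rho3 (S.hat z) = -(S.b 1 0 z / S.b 1 1 z) := by
    rw [mul_comm (S.gam z), s3]
  refine mul_jump (M1_eq x t) (M2_eq x t) ?_
  rw [cols_mul, cols_sub, L1, l1, l2, l3, e33, s3, s3', e13, e3, e1, r2, s2, rho3,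
    chi1_eq_of_real h hz, chi2_eq (hd _ _) (hd _ _) (hd' _ _) (hd' _ _), PhiMinus_eq h hz,
    PhiMinus_eq h hz]
  congr 1 <;> ext i <;> simp <;> field_simp <;> ring

theorem jump3 (h : z.im = 0) (hz : z ≠ 0)
    (hb0 : S.b 0 0 z ≠ 0) (ha1 : S.a 1 1 z ≠ 0) (hb1 : S.b 1 1 z ≠ 0) (ha0 : S.a 0 0 z ≠ 0)
    (x t : ℝ) : S.M3 x t z = S.M4 x t z * S.jump S.L3 x t z := by
  have hd := mem_dom_of_im_eq_zero (regular_of_im_eq_zero (S := S) h hz) h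
  have hd' : ∀ b j, conj z ∈ S.dom b j := by rw [Complex.conj_eq_iff_im.2 h]; exact hd
  have r3 := rho3_hat (hd' _ _) (hd' _ _) (hd false 1)
  have s2 := star_rho2 (hd _ _) (hd _ _) (hd' false 0)
  have s3 := star_rho3 (hd _ _) (hd true 1) (hd' false 1)
  have e := qz_mul_zq (S := S) hz
  have e3 : S.zq z * S.rho3 (S.hat z) = S.a 0 1 z / S.a 1 1 z := by
    rw [r3]; linear_combination (S.a 0 1 z / S.a 1 1 z) * e
  have s3' : S.gam z * S.rho2 z * star' S.rho3 z = S.b 1 2 z / S.b 1 1 z * S.rho2 z := by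
    rw [← s3]; ring
  have s3'' : S.gam z * star' S.rho2 z * S.rho2 z * star' S.rho3 z
      = S.b 1 2 z / S.b 1 1 z * (S.b 0 2 z / S.b 0 0 z) * S.rho2 z := by
    rw [← s3, ← s2]; ring
  have e33 : S.zq z * S.rho3 (S.hat z) * S.gam z * star' S.rho3 z * S.rho2 z
      = S.a 0 1 z / S.a 1 1 z * (S.b 1 2 z / S.b 1 1 z) * S.rho2 z := by
    rw [← s3, ← e3]; ring
  refine mul_jump (M3_eq x t) (M4_eq x t) ?_
  rw [cols_mul, cols_sub, L3, l4, l5, e33, s3', s3'', s3, e3, s2, rho1, rho2, rho3,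
    chi4_eq_of_real h hz, chi3_eq (hd _ _) (hd _ _) (hd' _ _) (hd' _ _), PhiMinus_eq h hz,
    PhiMinus_eq h hz]
  congr 1 <;> ext i <;> simp <;> field_simp <;> ring

/-- After clearing denominators the first combination is the entry `(1, 0)` of `B A = 1`, and the
second is a combination of the entries `(1, 0)` and `(1, 2)`. -/
theorem l6_l7_eq_zero (h : z.im = 0) (hz : z ≠ 0)
    (ha0 : S.a 0 0 z ≠ 0) (ha2 : S.a 2 2 z ≠ 0) (hb1 : S.b 1 1 z ≠ 0) :
    S.l6 z = 0 ∧ S.l7 z = 0 := by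
  have hd := mem_dom_of_im_eq_zero (regular_of_im_eq_zero (S := S) h hz) h
  have hd' : ∀ b j, conj z ∈ S.dom b j := by rw [Complex.conj_eq_iff_im.2 h]; exact hd
  have r1 := rho1_hat (hd' _ _) (hd' _ _) (hd false 2)
  have r2 := rho2_hat (hd' _ _) (hd' _ _) (hd false 2)
  have s3 := star_rho3 (hd _ _) (hd true 1) (hd' false 1)
  have s3h := star_rho3_hat (hd _ _) (hd true 1) (hd' false 1)
  have e := qz_mul_zq (S := S) hz
  have e1 : S.qz z * S.rho1 (S.hat z) = S.a 1 2 z / S.a 2 2 z := by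
    rw [r1]; linear_combination (S.a 1 2 z / S.a 2 2 z) * e
  have m0 := b_mul_a_apply (S := S) h hz 1 0
  have m2 := b_mul_a_apply (S := S) h hz 1 2
  rw [if_neg (by decide)] at m0 m2
  constructor
  · rw [l6, s3h, s3, rho1, rho2]
    field_simp
    linear_combination m0
  · rw [l7, e1, s3, r2, rho1, rho2]
    field_simp
    linear_combination (S.a 0 2 z) * m0 - S.a 0 0 z * m2

end Jump

end NZBCSolution

end CMKdV

/-! ### Sectional meromorphy and boundary values -/

namespace CMKdV

/-- Holomorphic on `D` and continuous on `W`. -/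
structure HolCont (D W : Set ℂ) (F : ℂ → ℂ) : Prop where
  diff : DifferentiableOn ℂ F D
  cont : ContinuousOn F W

namespace HolCont

variable {D W : Set ℂ} {F G : ℂ → ℂ}

theorem mul (hF : HolCont D W F) (hG : HolCont D W G) : HolCont D W fun z => F z * G z :=
  ⟨hF.diff.mul hG.diff, hF.cont.mul hG.cont⟩

theorem sub (hF : HolCont D W F) (hG : HolCont D W G) : HolCont D W fun z => F z - G z :=
  ⟨hF.diff.sub hG.diff, hF.cont.sub hG.cont⟩

theorem neg (hF : HolCont D W F) : HolCont D W fun z => -F z := ⟨hF.diff.neg, hF.cont.neg⟩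

theorem const (c : ℂ) : HolCont D W fun _ => c := ⟨differentiableOn_const c, continuousOn_const⟩

theorem cexp (hF : HolCont D W F) : HolCont D W fun z => Complex.exp (F z) :=
  ⟨hF.diff.cexp, hF.cont.cexp⟩

theorem congr (hF : HolCont D W F) (hDW : D ⊆ W) (h : ∀ z ∈ W, G z = F z) : HolCont D W G :=
  ⟨hF.diff.congr fun z hz => h z (hDW hz), hF.cont.congr h⟩

theorem inv (hF : HolCont D W F) (hDW : D ⊆ W) (h : ∀ z ∈ W, F z ≠ 0) :
    HolCont D W fun z => (F z)⁻¹ :=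
  ⟨hF.diff.inv fun z hz => h z (hDW hz), hF.cont.inv₀ h⟩

theorem dot {u v : ℂ → Fin 3 → ℂ} (hu : ∀ i, HolCont D W fun z => u z i)
    (hv : ∀ i, HolCont D W fun z => v z i) : HolCont D W fun z => u z ⬝ᵥ v z :=
  ⟨DifferentiableOn.fun_sum fun i _ => ((hu i).mul (hv i)).diff,
    continuousOn_finsetSum _ fun i _ => ((hu i).mul (hv i)).cont⟩

theorem cross {u v : ℂ → Fin 3 → ℂ} (hu : ∀ i, HolCont D W fun z => u z i)
    (hv : ∀ i, HolCont D W fun z => v z i) (i : Fin 3) :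
    HolCont D W fun z => crossProduct (u z) (v z) i := by
  simp only [cross_apply]
  fin_cases i
  · exact ((hu 1).mul (hv 2)).sub ((hu 2).mul (hv 1))
  · exact ((hu 2).mul (hv 0)).sub ((hu 0).mul (hv 2))
  · exact ((hu 0).mul (hv 1)).sub ((hu 1).mul (hv 0))

end HolCont

namespace NZBCSolution

variable {S : NZBCSolution} {D W : Set ℂ} {b : Bool}

theorem holCont_of_regular {F : ℂ → ℂ} (hDW : D ⊆ W) (hW : ∀ z ∈ W, S.Regular z)
    (hF : DifferentiableOn ℂ F {z | S.Regular z}) : HolCont D W F :=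
  ⟨hF.mono fun z hz => hW z (hDW hz), hF.continuousOn.mono hW⟩

theorem differentiableOn_theta (j : Fin 3) (x t : ℝ) :
    DifferentiableOn ℂ (S.theta j x t) {z | S.Regular z} := by
  have hl := S.differentiableOn_lam
  have hk := S.differentiableOn_k
  have h1 : DifferentiableOn ℂ (S.theta1 x t) {z | S.Regular z} := by
    unfold theta1
    fun_prop
  fin_cases j
  · exact h1
  · change DifferentiableOn ℂ (S.theta2 x t) _
    unfold theta2
    fun_prop
  · exact h1.neg

theorem holCont_phi (hD : IsOpen D) (hDW : D ⊆ W) {j : Fin 3} (hW : ∀ z ∈ W, z ∈ S.dom b j)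
    (x t : ℝ) (i : Fin 3) : HolCont D W fun z => S.phi b j x t z i := by
  have h1 : HolCont D W fun z => S.mu b j x t z i :=
    ⟨differentiableOn_pi.1 (differentiableOn_mu x t hD fun z hz => hW z (hDW hz)) i,
      continuousOn_pi.1 ((continuousOn_mu b j x t).mono hW) i⟩
  have h2 : HolCont D W (S.theta j x t) :=
    holCont_of_regular hDW (fun z hz => (hW z hz).1) (differentiableOn_theta j x t)
  refine (((HolCont.const Complex.I).mul h2).cexp.mul h1).congr hDW fun z _ => ?_
  rw [mu, Pi.smul_apply, smul_eq_mul, ← mul_assoc, ← Complex.exp_add, add_neg_cancel,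
    Complex.exp_zero, one_mul]

theorem holCont_star {F : ℂ → ℂ} (hD : IsOpen D)
    (h : HolCont (conj ⁻¹' D) (conj ⁻¹' W) F) : HolCont D W fun z => conj (F (conj z)) := by
  refine ⟨fun z hz => ?_, ?_⟩
  · have h1 : DifferentiableAt ℂ F (conj z) := by
      refine (h.diff (conj z) ?_).differentiableAt
        ((hD.preimage Complex.continuous_conj).mem_nhds ?_) <;>
      simpa using hz
    have h2 := h1.conj_conj
    rw [Complex.conj_conj] at h2
    exact h2.differentiableWithinAt
  · exact Complex.continuous_conj.comp_continuousOn
      (h.cont.comp Complex.continuous_conj.continuousOn fun z hz => by simpa using hz)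

theorem holCont_phiAdj (hD : IsOpen D) (hDW : D ⊆ W) {j : Fin 3}
    (hW : ∀ z ∈ W, conj z ∈ S.dom b j) (x t : ℝ) (i : Fin 3) :
    HolCont D W fun z => S.phiAdj b j x t z i := by
  have h := holCont_phi (S := S) (b := b) (j := j) (hD.preimage Complex.continuous_conj)
    (Set.preimage_mono hDW) (fun z hz => by simpa using hW _ hz) x t i
  exact (holCont_star hD h).congr hDW fun z hz => by rw [phiAdj_eq (hW z hz)]; rfl

theorem differentiableOn_C (i : Fin 3) : DifferentiableOn ℂ (S.C i) {z | S.Regular z} := by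
  have hg := S.differentiableOn_gam
  fin_cases i
  · exact hg
  · exact differentiableOn_const 1
  · exact hg

theorem holCont_sc (hD : IsOpen D) (hDW : D ⊆ W) {i j : Fin 3}
    (hi : ∀ z ∈ W, conj z ∈ S.dom b i) (hj : ∀ z ∈ W, z ∈ S.dom (!b) j) :
    HolCont D W (S.sc b i j) :=
  ((holCont_of_regular hDW (fun z hz => (hj z hz).1) (differentiableOn_C i)).inv hDW
    fun z hz => C_ne S (hj z hz).1 i).mul
    (HolCont.dot (holCont_phiAdj hD hDW hi 0 0) (holCont_phi hD hDW hj 0 0))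

theorem holCont_exp_theta (hDW : D ⊆ W) (hW : ∀ z ∈ W, S.Regular z) (j : Fin 3) (x t : ℝ) :
    HolCont D W fun z => Complex.exp (Complex.I * S.theta j x t z) :=
  ((HolCont.const _).mul (holCont_of_regular hDW hW (differentiableOn_theta j x t))).cexp

theorem holCont_exp_neg_theta (hDW : D ⊆ W) (hW : ∀ z ∈ W, S.Regular z) (j : Fin 3) (x t : ℝ) :
    HolCont D W fun z => Complex.exp (-(Complex.I * S.theta j x t z)) :=
  ((HolCont.const _).mul (holCont_of_regular hDW hW (differentiableOn_theta j x t))).neg.cexp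

/-- The regular points of the closure. -/
def regClosure (S : NZBCSolution) (D : Set ℂ) : Set ℂ := {z | z ∈ closure D ∧ S.Regular z}

/-- It suffices that each column be a vector holomorphic in `D` and continuous up to the regular
boundary, divided by `f`, `g` or `1`. -/
theorem sectionallyMeromorphic_of {M : ℝ → ℝ → ℂ → Matrix (Fin 3) (Fin 3) ℂ} {f g : ℂ → ℂ}
    (hD : IsOpen D) (hDr : D ⊆ S.regClosure D) (hf : HolCont D (S.regClosure D) f)
    (hg : HolCont D (S.regClosure D) g)
    (hM : ∀ x t j, ∃ h : ℂ → ℂ, (h = f ∨ h = g ∨ h = 1) ∧ ∀ i, ∃ F, HolCont D (S.regClosure D) F ∧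
      ∀ z, M x t z i j = (h z)⁻¹ * F z) : S.SectionallyMeromorphic M f g D := by
  have han : ∀ {F : ℂ → ℂ}, HolCont D (S.regClosure D) F → ∀ z ∈ D, AnalyticAt ℂ F z :=
    fun hF z hz => hF.diff.analyticAt (hD.mem_nhds hz)
  intro x t
  have key : ∀ i j, ∃ h F : ℂ → ℂ, (∀ z, f z ≠ 0 → g z ≠ 0 → h z ≠ 0) ∧
      HolCont D (S.regClosure D) h ∧ HolCont D (S.regClosure D) F ∧
      (fun z => M x t z i j) = fun z => (h z)⁻¹ * F z := by
    intro i j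
    obtain ⟨h, hh, hF⟩ := hM x t j
    obtain ⟨F, hF, he⟩ := hF i
    refine ⟨h, F, ?_, ?_, hF, funext he⟩
    · rcases hh with rfl | rfl | rfl
      · exact fun z h1 _ => h1
      · exact fun z _ h1 => h1
      · exact fun z _ _ => one_ne_zero
    · rcases hh with rfl | rfl | rfl
      · exact hf
      · exact hg
      · exact HolCont.const 1
  refine ⟨fun i j z hz => ?_, fun i j z hz hfz hgz => ?_, fun z hz hr hfz hgz => ?_⟩
  · obtain ⟨h, F, -, hh, hF, e⟩ := key i j
    rw [e]
    exact (han hh z hz).meromorphicAt.inv.mul (han hF z hz).meromorphicAt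
  · obtain ⟨h, F, h0, hh, hF, e⟩ := key i j
    rw [e]
    exact ((han hh z hz).inv (h0 z hfz hgz)).mul (han hF z hz)
  · refine tendsto_pi_nhds.2 fun i => tendsto_pi_nhds.2 fun j => ?_
    obtain ⟨h, F, h0, hh, hF, e⟩ := key i j
    have h1 := (((hh.cont z ⟨hz, hr⟩).mono hDr).inv₀ (h0 z hfz hgz)).mul
      ((hF.cont z ⟨hz, hr⟩).mono hDr)
    have h2 : ContinuousWithinAt (fun z => M x t z i j) D z := by rw [e]; exact h1
    exact h2

section Regions

variable (S)

theorem D1_sub : S.D1 ⊆ S.regClosure S.D1 := fun _ hz => ⟨subset_closure hz, D1_regular hz⟩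
theorem D2_sub : S.D2 ⊆ S.regClosure S.D2 := fun _ hz => ⟨subset_closure hz, D2_regular hz⟩
theorem D3_sub : S.D3 ⊆ S.regClosure S.D3 := fun _ hz => ⟨subset_closure hz, D3_regular hz⟩
theorem D4_sub : S.D4 ⊆ S.regClosure S.D4 := fun _ hz => ⟨subset_closure hz, D4_regular hz⟩

variable {S} {z : ℂ}

theorem holCont_b11_D1 : HolCont S.D1 (S.regClosure S.D1) (S.b 1 1) :=
  holCont_sc (b := false) S.isOpen_D1 S.D1_sub
    (fun _ hz => mem_dom_false_1 (S.regular_conj hz.2) (by simpa using (closure_D1 hz.1).2))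
    (fun _ hz => mem_dom_true_1 hz.2 (closure_D1 hz.1).2)

theorem holCont_a22_D1 : HolCont S.D1 (S.regClosure S.D1) (S.a 2 2) :=
  holCont_sc (b := true) S.isOpen_D1 S.D1_sub
    (fun _ hz => mem_dom_true_2 (S.regular_conj hz.2) (by simpa using (closure_D1 hz.1).1)
      (by simpa using (closure_D1 hz.1).2))
    (fun _ hz => mem_dom_false_2 hz.2 (closure_D1 hz.1).1 (closure_D1 hz.1).2)

theorem holCont_b22_D2 : HolCont S.D2 (S.regClosure S.D2) (S.b 2 2) :=
  holCont_sc (b := false) S.isOpen_D2 S.D2_sub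
    (fun _ hz => mem_dom_false_2 (S.regular_conj hz.2) (by simpa using (closure_D2 hz.1).1)
      (by simpa using (closure_D2 hz.1).2))
    (fun _ hz => mem_dom_true_2 hz.2 (closure_D2 hz.1).1 (closure_D2 hz.1).2)

theorem holCont_a11_D2 : HolCont S.D2 (S.regClosure S.D2) (S.a 1 1) :=
  holCont_sc (b := true) S.isOpen_D2 S.D2_sub
    (fun _ hz => mem_dom_true_1 (S.regular_conj hz.2) (by simpa using (closure_D2 hz.1).2))
    (fun _ hz => mem_dom_false_1 hz.2 (closure_D2 hz.1).2)

theorem holCont_b00_D3 : HolCont S.D3 (S.regClosure S.D3) (S.b 0 0) :=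
  holCont_sc (b := false) S.isOpen_D3 S.D3_sub
    (fun _ hz => mem_dom_false_0 (S.regular_conj hz.2) (by simpa using (closure_D3 hz.1).1)
      (by simpa using (closure_D3 hz.1).2))
    (fun _ hz => mem_dom_true_0 hz.2 (closure_D3 hz.1).1 (closure_D3 hz.1).2)

theorem holCont_a11_D3 : HolCont S.D3 (S.regClosure S.D3) (S.a 1 1) :=
  holCont_sc (b := true) S.isOpen_D3 S.D3_sub
    (fun _ hz => mem_dom_true_1 (S.regular_conj hz.2) (by simpa using (closure_D3 hz.1).2))
    (fun _ hz => mem_dom_false_1 hz.2 (closure_D3 hz.1).2)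

theorem holCont_a00_D4 : HolCont S.D4 (S.regClosure S.D4) (S.a 0 0) :=
  holCont_sc (b := true) S.isOpen_D4 S.D4_sub
    (fun _ hz => mem_dom_true_0 (S.regular_conj hz.2) (by simpa using (closure_D4 hz.1).1)
      (by simpa using (closure_D4 hz.1).2))
    (fun _ hz => mem_dom_false_0 hz.2 (closure_D4 hz.1).1 (closure_D4 hz.1).2)

theorem holCont_b11_D4 : HolCont S.D4 (S.regClosure S.D4) (S.b 1 1) :=
  holCont_sc (b := false) S.isOpen_D4 S.D4_sub
    (fun _ hz => mem_dom_false_1 (S.regular_conj hz.2) (by simpa using (closure_D4 hz.1).2))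
    (fun _ hz => mem_dom_true_1 hz.2 (closure_D4 hz.1).2)

theorem holCont_mu (hD : IsOpen D) (hDW : D ⊆ W) {j : Fin 3} (hW : ∀ z ∈ W, z ∈ S.dom b j)
    (x t : ℝ) (i : Fin 3) : HolCont D W fun z => S.mu b j x t z i :=
  (holCont_exp_neg_theta hDW (fun z hz => (hW z hz).1) j x t).mul (holCont_phi hD hDW hW x t i)

theorem holCont_cross (hD : IsOpen D) (hDW : D ⊆ W) (hr : ∀ z ∈ W, S.Regular z) {b' : Bool}
    {j l : Fin 3} (hj : ∀ z ∈ W, conj z ∈ S.dom b j) (hl : ∀ z ∈ W, conj z ∈ S.dom b' l)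
    (x t : ℝ) (i : Fin 3) : HolCont D W fun z => (Complex.exp (Complex.I * S.theta 1 x t z) •
      crossProduct (S.phiAdj b j x t z) (S.phiAdj b' l x t z)) i :=
  (holCont_exp_theta hDW hr 1 x t).mul
    (HolCont.cross (holCont_phiAdj hD hDW hj x t) (holCont_phiAdj hD hDW hl x t) i)

theorem sectionallyMeromorphic_M1 :
    S.SectionallyMeromorphic S.M1 (S.b 1 1) (S.a 2 2) S.D1 := by
  refine sectionallyMeromorphic_of S.isOpen_D1 S.D1_sub holCont_b11_D1 holCont_a22_D1
    fun x t j => ?_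
  fin_cases j
  · refine ⟨S.b 1 1, Or.inl rfl, fun i => ⟨fun z => -(S.m1 x t z i), ?_, fun z => by
      simp [M1, cols]⟩⟩
    exact ((holCont_exp_neg_theta S.D1_sub (fun _ hz => hz.2) 0 x t).mul
      (holCont_cross (b := false) (b' := true) (j := 1) (l := 2) S.isOpen_D1 S.D1_sub
        (fun _ hz => hz.2)
        (fun _ hz => mem_dom_false_1 (S.regular_conj hz.2) (by simpa using (closure_D1 hz.1).2))
        (fun _ hz => mem_dom_true_2 (S.regular_conj hz.2) (by simpa using (closure_D1 hz.1).1)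
          (by simpa using (closure_D1 hz.1).2)) x t i)).neg
  · refine ⟨1, Or.inr (Or.inr rfl), fun i => ⟨fun z => S.muPlus 1 x t z i, ?_, fun z => by
      simp [M1, cols]⟩⟩
    exact holCont_mu (b := true) S.isOpen_D1 S.D1_sub
      (fun _ hz => mem_dom_true_1 hz.2 (closure_D1 hz.1).2) x t i
  · refine ⟨S.a 2 2, Or.inr (Or.inl rfl), fun i => ⟨fun z => S.muMinus 2 x t z i, ?_, fun z => by
      simp [M1, cols]⟩⟩
    exact holCont_mu (b := false) S.isOpen_D1 S.D1_sub
      (fun _ hz => mem_dom_false_2 hz.2 (closure_D1 hz.1).1 (closure_D1 hz.1).2) x t i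

theorem sectionallyMeromorphic_M2 :
    S.SectionallyMeromorphic S.M2 (S.b 2 2) (S.a 1 1) S.D2 := by
  refine sectionallyMeromorphic_of S.isOpen_D2 S.D2_sub holCont_b22_D2 holCont_a11_D2
    fun x t j => ?_
  fin_cases j
  · refine ⟨S.b 2 2, Or.inl rfl, fun i => ⟨fun z => -(S.m2 x t z i), ?_, fun z => by
      simp [M2, cols]⟩⟩
    exact ((holCont_exp_neg_theta S.D2_sub (fun _ hz => hz.2) 0 x t).mul
      (holCont_cross (b := true) (b' := false) (j := 1) (l := 2) S.isOpen_D2 S.D2_sub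
        (fun _ hz => hz.2)
        (fun _ hz => mem_dom_true_1 (S.regular_conj hz.2) (by simpa using (closure_D2 hz.1).2))
        (fun _ hz => mem_dom_false_2 (S.regular_conj hz.2) (by simpa using (closure_D2 hz.1).1)
          (by simpa using (closure_D2 hz.1).2)) x t i)).neg
  · refine ⟨S.a 1 1, Or.inr (Or.inl rfl), fun i => ⟨fun z => S.muMinus 1 x t z i, ?_, fun z => by
      simp [M2, cols]⟩⟩
    exact holCont_mu (b := false) S.isOpen_D2 S.D2_sub
      (fun _ hz => mem_dom_false_1 hz.2 (closure_D2 hz.1).2) x t i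
  · refine ⟨1, Or.inr (Or.inr rfl), fun i => ⟨fun z => S.muPlus 2 x t z i, ?_, fun z => by
      simp [M2, cols]⟩⟩
    exact holCont_mu (b := true) S.isOpen_D2 S.D2_sub
      (fun _ hz => mem_dom_true_2 hz.2 (closure_D2 hz.1).1 (closure_D2 hz.1).2) x t i

theorem sectionallyMeromorphic_M3 :
    S.SectionallyMeromorphic S.M3 (S.b 0 0) (S.a 1 1) S.D3 := by
  refine sectionallyMeromorphic_of S.isOpen_D3 S.D3_sub holCont_b00_D3 holCont_a11_D3
    fun x t j => ?_
  fin_cases j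
  · refine ⟨1, Or.inr (Or.inr rfl), fun i => ⟨fun z => S.muPlus 0 x t z i, ?_, fun z => by
      simp [M3, cols]⟩⟩
    exact holCont_mu (b := true) S.isOpen_D3 S.D3_sub
      (fun _ hz => mem_dom_true_0 hz.2 (closure_D3 hz.1).1 (closure_D3 hz.1).2) x t i
  · refine ⟨S.a 1 1, Or.inr (Or.inl rfl), fun i => ⟨fun z => S.muMinus 1 x t z i, ?_, fun z => by
      simp [M3, cols]⟩⟩
    exact holCont_mu (b := false) S.isOpen_D3 S.D3_sub
      (fun _ hz => mem_dom_false_1 hz.2 (closure_D3 hz.1).2) x t i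
  · refine ⟨S.b 0 0, Or.inl rfl, fun i => ⟨fun z => -(S.m3 x t z i), ?_, fun z => by
      simp [M3, cols]⟩⟩
    exact ((holCont_exp_theta S.D3_sub (fun _ hz => hz.2) 0 x t).mul
      (holCont_cross (b := false) (b' := true) (j := 0) (l := 1) S.isOpen_D3 S.D3_sub
        (fun _ hz => hz.2)
        (fun _ hz => mem_dom_false_0 (S.regular_conj hz.2) (by simpa using (closure_D3 hz.1).1)
          (by simpa using (closure_D3 hz.1).2))
        (fun _ hz => mem_dom_true_1 (S.regular_conj hz.2) (by simpa using (closure_D3 hz.1).2))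
        x t i)).neg

theorem sectionallyMeromorphic_M4 :
    S.SectionallyMeromorphic S.M4 (S.b 1 1) (S.a 0 0) S.D4 := by
  refine sectionallyMeromorphic_of S.isOpen_D4 S.D4_sub holCont_b11_D4 holCont_a00_D4
    fun x t j => ?_
  fin_cases j
  · refine ⟨S.a 0 0, Or.inr (Or.inl rfl), fun i => ⟨fun z => S.muMinus 0 x t z i, ?_, fun z => by
      simp [M4, cols]⟩⟩
    exact holCont_mu (b := false) S.isOpen_D4 S.D4_sub
      (fun _ hz => mem_dom_false_0 hz.2 (closure_D4 hz.1).1 (closure_D4 hz.1).2) x t i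
  · refine ⟨1, Or.inr (Or.inr rfl), fun i => ⟨fun z => S.muPlus 1 x t z i, ?_, fun z => by
      simp [M4, cols]⟩⟩
    exact holCont_mu (b := true) S.isOpen_D4 S.D4_sub
      (fun _ hz => mem_dom_true_1 hz.2 (closure_D4 hz.1).2) x t i
  · refine ⟨S.b 1 1, Or.inl rfl, fun i => ⟨fun z => -(S.m4 x t z i), ?_, fun z => by
      simp [M4, cols]⟩⟩
    exact ((holCont_exp_theta S.D4_sub (fun _ hz => hz.2) 0 x t).mul
      (holCont_cross (b := true) (b' := false) (j := 0) (l := 1) S.isOpen_D4 S.D4_sub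
        (fun _ hz => hz.2)
        (fun _ hz => mem_dom_true_0 (S.regular_conj hz.2) (by simpa using (closure_D4 hz.1).1)
          (by simpa using (closure_D4 hz.1).2))
        (fun _ hz => mem_dom_false_1 (S.regular_conj hz.2) (by simpa using (closure_D4 hz.1).2))
        x t i)).neg

end Regions

end NZBCSolution

end CMKdV

namespace CMKdV

namespace NZBCSolution

variable {S : NZBCSolution}

/-! ### Limits of Jost columns along the imaginary axis at infinity -/

section HighEnergy

variable (S) in
/-- The parameters `ζ = s ≥ 0` of the points `z = σ / s` on a ray near infinity. -/
def ray : Set ℂ := Complex.ofReal '' Set.Icc 0 (1 / (2 * S.q0))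

theorem isCompact_ray : IsCompact S.ray := isCompact_Icc.image Complex.continuous_ofReal

/-- The length `1 / (2 q₀)` of the ray keeps `γ = 1 - q₀² s²` at least `3/4`. -/
theorem sq_le_of_mem_ray {s : ℝ} (hs : s ∈ Set.Icc 0 (1 / (2 * S.q0))) :
    S.q0 ^ 2 * s ^ 2 ≤ 1 / 4 := by
  have h0 := S.q0_pos
  have h1 : S.q0 * s ≤ 1 / 2 := by
    calc S.q0 * s ≤ S.q0 * (1 / (2 * S.q0)) := mul_le_mul_of_nonneg_left hs.2 h0.le
      _ = 1 / 2 := by field_simp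
  have h2 : 0 ≤ S.q0 * s := mul_nonneg h0.le hs.1
  nlinarith

theorem gam_ray_ne {σ ζ : ℂ} (hσ : σ ^ 2 = -1) (hζ : ζ ∈ S.ray) : S.gam (σ / ζ) ≠ 0 := by
  obtain ⟨s, hs, rfl⟩ := hζ
  have h := sq_le_of_mem_ray hs
  have e : S.gam (σ / s) = ((1 - S.q0 ^ 2 * s ^ 2 : ℝ) : ℂ) := by
    rw [gam, div_pow, hσ, div_div_eq_mul_div]
    push_cast
    ring
  rw [e]
  exact Complex.ofReal_ne_zero.2 (by linarith)

theorem continuousOn_gam_ray (σ : ℂ) : ContinuousOn (fun ζ => S.gam (σ / ζ)) S.ray := by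
  simp only [gam, div_pow, div_div_eq_mul_div]
  fun_prop

/-- At `ζ = 0` the quotient `σ / ζ` is `0` by convention, and the entries of `Gam` with a division
by `z` are then `0`, which is their limit as `z → ∞`. The value at `0` thus represents the point at
infinity. -/
theorem continuousOn_Gam_ray (σ : ℂ) (w : C2) (i j : Fin 3) :
    ContinuousOn (fun ζ => S.Gam w (σ / ζ) i j) S.ray := by
  fin_cases i <;> fin_cases j <;> simp [Gam, div_div_eq_mul_div] <;> fun_prop

theorem continuousOn_GamInv_ray {σ : ℂ} (hσ : σ ^ 2 = -1) (w : C2) (i j : Fin 3) :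
    ContinuousOn (fun ζ => S.GamInv w (σ / ζ) i j) S.ray := by
  have h1 := S.continuousOn_gam_ray σ
  have h2 : ∀ ζ ∈ S.ray, S.gam (σ / ζ) ≠ 0 := fun ζ hζ => gam_ray_ne hσ hζ
  fin_cases i <;> fin_cases j <;> simp only [GamInv, div_div_eq_mul_div] <;>
    simp [-div_eq_zero_iff] <;>
    first
      | exact continuousOn_const
      | exact ContinuousOn.div (by fun_prop) h1 h2
      | exact h1.inv₀ h2

theorem continuousOn_pert_ray {σ : ℂ} (hσ : σ ^ 2 = -1) (b : Bool) (t y : ℝ) (i j : Fin 3) :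
    ContinuousOn (fun ζ => S.pert b t y (σ / ζ) i j) S.ray := by
  simp only [pert, Matrix.smul_apply, Matrix.mul_apply, smul_eq_mul]
  refine ContinuousOn.mul continuousOn_const ?_
  refine continuousOn_finsetSum _ fun l _ => ContinuousOn.mul ?_ (continuousOn_Gam_ray _ _ _ _)
  exact continuousOn_finsetSum _ fun m _ => (continuousOn_GamInv_ray hσ _ _ _).mul_const _

theorem exists_bound_ray {σ : ℂ} (hσ : σ ^ 2 = -1) (b : Bool) : ∃ c, 0 ≤ c ∧ ∀ ζ ∈ S.ray,
    4 * (mnorm (S.GamInv (S.qEnd b) (σ / ζ)) * mnorm (S.Gam (S.qEnd b) (σ / ζ))) ≤ c := by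
  obtain ⟨c, hc⟩ := isCompact_ray.exists_bound_of_continuousOn
    (((continuousOn_mnorm fun i j => continuousOn_GamInv_ray (S := S) hσ (S.qEnd b) i j).mul
      (continuousOn_mnorm fun i j => continuousOn_Gam_ray (S := S) σ (S.qEnd b) i j)).const_mul 4)
  exact ⟨|c|, abs_nonneg c, fun ζ hζ =>
    (Real.le_norm_self _).trans ((hc ζ hζ).trans (le_abs_self c))⟩

/-- Behaviour of the propagators along a ray to infinity: those with `κ l` are damped, the others
tend to the identity. -/
structure RayData (S : NZBCSolution) (b : Bool) (j : Fin 3) (σ : ℂ) (κ : Fin 3 → Bool) : Prop where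
  sq : σ ^ 2 = -1
  mem : ∀ ζ ∈ S.ray, ζ ≠ 0 → σ / ζ ∈ S.dom b j
  free : ∀ l, κ l = false → ∃ c : ℂ, ∀ ζ, S.expo b j l (σ / ζ) = c * ζ
  damp : ∀ l, κ l = true → ∀ ζ ∈ S.ray, ζ ≠ 0 → 1 / (2 * ‖ζ‖) ≤ (S.expo b j l (σ / ζ)).re

variable (S) in
/-- The propagators along a ray. -/
def rayProp (b : Bool) (j : Fin 3) (σ : ℂ) (κ : Fin 3 → Bool) (l : Fin 3) (s : ℝ) (ζ : ℂ) : ℂ :=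
  if κ l = true ∧ ζ = 0 then 0 else Complex.exp (S.expo b j l (σ / ζ) * s)

variable {b : Bool} {j : Fin 3} {σ : ℂ} {κ : Fin 3 → Bool}

theorem rayProp_of_ne (l : Fin 3) (s : ℝ) {ζ : ℂ} (hζ : ζ ≠ 0) :
    S.rayProp b j σ κ l s ζ = Complex.exp (S.expo b j l (σ / ζ) * s) :=
  if_neg fun h => hζ h.2

theorem norm_rayProp_le_one (R : S.RayData b j σ κ) (l : Fin 3) {s : ℝ} (hs : s < 0) {ζ : ℂ}
    (hζ : ζ ∈ S.ray) : ‖S.rayProp b j σ κ l s ζ‖ ≤ 1 := by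
  by_cases h0 : ζ = 0
  · subst h0
    cases hκ : κ l
    · obtain ⟨c, hc⟩ := R.free l hκ
      rw [rayProp, if_neg (by simp [hκ]), hc]
      simp
    · simp [rayProp, hκ]
  · rw [rayProp_of_ne l s h0, Complex.norm_exp, Real.exp_le_one_iff, Complex.re_mul_ofReal]
    exact mul_nonpos_of_nonneg_of_nonpos (S.expo_re_nonneg (R.mem ζ hζ h0) l) hs.le

/-- From `a ≤ e^a` an exponential decay gives a bound linear in `‖ζ‖`, enough for continuity of the
damped propagators at `ζ = 0`. -/
theorem norm_rayProp_le (R : S.RayData b j σ κ) {l : Fin 3} (hκ : κ l = true) {s : ℝ} (hs : s < 0)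
    {ζ : ℂ} (hζ : ζ ∈ S.ray) : ‖S.rayProp b j σ κ l s ζ‖ ≤ 2 * ‖ζ‖ / -s := by
  by_cases h0 : ζ = 0
  · subst h0
    simp [rayProp, hκ]
  · have h1 := norm_pos_iff.2 h0
    have h2 := R.damp l hκ ζ hζ h0
    rw [rayProp_of_ne l s h0, Complex.norm_exp, Complex.re_mul_ofReal]
    set r := (S.expo b j l (σ / ζ)).re
    have h3 : 0 < -s / (2 * ‖ζ‖) := div_pos (neg_pos.2 hs) (by positivity)
    have h4 : r * s ≤ -(-s / (2 * ‖ζ‖)) := by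
      have h5 := mul_le_mul_of_nonpos_right h2 hs.le
      refine h5.trans (le_of_eq ?_)
      ring
    have h6 : -s / (2 * ‖ζ‖) ≤ Real.exp (-s / (2 * ‖ζ‖)) := by
      linarith [Real.add_one_le_exp (-s / (2 * ‖ζ‖))]
    calc Real.exp (r * s) ≤ Real.exp (-(-s / (2 * ‖ζ‖))) := Real.exp_le_exp.2 h4
      _ = (Real.exp (-s / (2 * ‖ζ‖)))⁻¹ := Real.exp_neg _
      _ ≤ (-s / (2 * ‖ζ‖))⁻¹ := inv_anti₀ h3 h6
      _ = 2 * ‖ζ‖ / -s := inv_div _ _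

theorem continuousWithinAt_rayProp (R : S.RayData b j σ κ) (l : Fin 3) {s : ℝ} (hs : s < 0) {ζ : ℂ}
    (hζ : ζ ∈ S.ray) : ContinuousWithinAt (fun p : ℝ × ℂ => S.rayProp b j σ κ l p.1 p.2)
      (Set.univ ×ˢ S.ray) (s, ζ) := by
  cases hκ : κ l
  · obtain ⟨c, hc⟩ := R.free l hκ
    simp only [rayProp, hκ, hc]
    have h : Continuous fun p : ℝ × ℂ => Complex.exp (c * p.2 * p.1) := by fun_prop
    simpa using h.continuousWithinAt
  · by_cases h0 : ζ = 0
    · subst h0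
      have e : S.rayProp b j σ κ l s 0 = 0 := by simp [rayProp, hκ]
      refine squeeze_zero_norm' (a := fun p : ℝ × ℂ => 2 * ‖p.2‖ / -p.1) ?_ ?_ |> fun h => by
        simpa only [ContinuousWithinAt, e] using h
      · have h1 : ∀ᶠ p : ℝ × ℂ in 𝓝 (s, 0), p.1 < 0 :=
          (continuous_fst.tendsto (s, (0 : ℂ))).eventually (gt_mem_nhds hs)
        filter_upwards [mem_nhdsWithin_of_mem_nhds h1, self_mem_nhdsWithin] with p hp hp2
        exact norm_rayProp_le R hκ hp hp2.2
      · have h2 : ContinuousAt (fun p : ℝ × ℂ => 2 * ‖p.2‖ / -p.1) (s, 0) :=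
          ContinuousAt.div (by fun_prop) (by fun_prop) (neg_ne_zero.2 hs.ne)
        have h3 := h2.tendsto.mono_left (nhdsWithin_le_nhds (s := Set.univ ×ˢ S.ray))
        simpa using h3
    · have h1 : ContinuousAt (fun p : ℝ × ℂ => Complex.exp (S.expo b j l (σ / p.2) * p.1))
          (s, ζ) := by
        have hr := (R.mem ζ hζ h0).1
        have ho : {w | S.Regular w} ∈ 𝓝 (σ / ζ) := by
          have h1 : ContinuousAt S.gam (σ / ζ) := by
            unfold gam
            have := pow_ne_zero 2 hr.1
            exact ContinuousAt.add (by fun_prop) (ContinuousAt.div (by fun_prop) (by fun_prop) this)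
          filter_upwards [isOpen_ne.mem_nhds hr.1, h1.eventually_ne hr.2] with w h2 h3
          exact ⟨h2, h3⟩
        have h2 : ContinuousAt (S.expo b j l) (σ / ζ) :=
          (S.differentiableOn_expo b j l).continuousOn.continuousAt ho
        have h3 : ContinuousAt (fun p : ℝ × ℂ => σ / p.2) (s, ζ) :=
          ContinuousAt.div (by fun_prop) (by fun_prop) h0
        have h4 : ContinuousAt (fun p : ℝ × ℂ => S.expo b j l (σ / p.2)) (s, ζ) :=
          ContinuousAt.comp (g := S.expo b j l) (f := fun p : ℝ × ℂ => σ / p.2) h2 h3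
        have h5 : ContinuousAt (fun p : ℝ × ℂ => (p.1 : ℂ)) (s, ζ) := by fun_prop
        exact (h4.mul h5).cexp
      refine (h1.congr ?_).continuousWithinAt
      have h2 : ∀ᶠ p : ℝ × ℂ in 𝓝 (s, ζ), p.2 ≠ 0 :=
        (continuous_snd.continuousAt (x := (s, ζ))).eventually_ne h0
      filter_upwards [h2] with p hp
      rw [rayProp_of_ne _ _ hp]

/-- The Volterra data along a ray to infinity. -/
def rayKernel (R : S.RayData b j σ κ) (t c : ℝ) (hc0 : 0 ≤ c) (hc : ∀ ζ ∈ S.ray,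
    4 * (mnorm (S.GamInv (S.qEnd b) (σ / ζ)) * mnorm (S.Gam (S.qEnd b) (σ / ζ))) ≤ c) :
    TailKernel 3 where
  g y := c * ‖S.q (sg b * y) t - S.qEnd b‖
  e := S.rayProp b j σ κ
  B y ζ := S.pert b t y (σ / ζ)
  W := S.ray
  D := ∅
  isOpen_D := isOpen_empty
  D_subset := Set.empty_subset _
  hg := (S.tailIntegrable_q b t).const_mul hc0
  e_le l _ hs _ hζ := norm_rayProp_le_one R l hs hζ
  e_cont l _ hs _ hζ := continuousWithinAt_rayProp R l hs hζ
  e_diff _ _ := differentiableOn_empty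
  B_le y ζ hζ v := by
    refine (S.norm_pert_mulVec_le b t y (σ / ζ) v).trans ?_
    gcongr
    exact hc ζ hζ
  B_cont ζ _ i j := S.continuous_pert b t (σ / ζ) i j
  B_contOn y i j := continuousOn_pert_ray R.sq b t y i j
  B_diff _ _ _ := differentiableOn_empty

/-- At infinity, the perturbation couples only the two blocks. -/
theorem pert_zero_block (b : Bool) (t y : ℝ) {i l : Fin 3} (h : (i = 2) ↔ (l = 2)) :
    S.pert b t y 0 i l = 0 := by
  fin_cases i <;> fin_cases l <;> simp at h <;>
    simp [pert, GamInv, Gam, Qmat]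

/-- For fixed `ζ ≠ 0` the ray propagators are genuine exponentials, so the slice solves the Jost
equation with the single parameter value `σ / ζ`, and uniqueness applies. -/
theorem mu_eq_of_ray_isSol (R : S.RayData b j σ κ) {t c : ℝ} {hc0 : 0 ≤ c} {hc : ∀ ζ ∈ S.ray,
    4 * (mnorm (S.GamInv (S.qEnd b) (σ / ζ)) * mnorm (S.Gam (S.qEnd b) (σ / ζ))) ≤ c}
    {u : ℝ → ℂ → Fin 3 → ℂ} (hu : (rayKernel R t c hc0 hc).IsSol u (Pi.single j 1))
    {ζ : ℂ} (hζ : ζ ∈ S.ray) (h0 : ζ ≠ 0) (x : ℝ) :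
    S.mu b j x t (σ / ζ) = S.Gam (S.qEnd b) (σ / ζ) *ᵥ u (sg b * x) ζ := by
  have hW : {σ / ζ} ⊆ S.dom b j := by rintro _ rfl; exact R.mem ζ hζ h0
  have hc' : ∀ z ∈ ({σ / ζ} : Set ℂ),
      4 * (mnorm (S.GamInv (S.qEnd b) z) * mnorm (S.Gam (S.qEnd b) z)) ≤ c := by
    rintro _ rfl; exact hc ζ hζ
  have he : ∀ l s, S.rayProp b j σ κ l s ζ = Complex.exp (S.expo b j l (σ / ζ) * s) :=
    fun l s => rayProp_of_ne l s h0
  have hsol : (S.jostKernel b j t {σ / ζ} ∅ isOpen_empty (Set.empty_subset _) hW c hc0 hc').IsSol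
      (fun y _ => u y ζ) (Pi.single j 1) :=
    { cont := ((hu.cont_x ζ hζ).comp continuous_fst).continuousOn
      diff := fun x => differentiableOn_empty
      cont_x := fun _ _ => hu.cont_x ζ hζ
      integrable := by
        rintro _ rfl x i
        have := hu.integrable ζ hζ x i
        simp only [rayKernel, he] at this
        exact this
      eq := by
        rintro _ rfl x i
        have := hu.eq ζ hζ x i
        simp only [rayKernel, he] at this
        exact this
      tendsto := fun _ _ => hu.tendsto ζ hζ }
  exact mu_eq_of_isSol hsol rfl x

/-- The limit of a Jost column along a ray to infinity. -/
theorem tendsto_mu_ray (R : S.RayData b j σ κ) (hκ : ∀ l, κ l = true ↔ ¬ ((l = 2) ↔ (j = 2)))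
    (x t : ℝ) : Tendsto (fun s : ℝ => S.mu b j x t (σ / s)) (𝓝[>] 0)
      (𝓝 fun i => S.Gam (S.qEnd b) 0 i j) := by
  obtain ⟨c, hc0, hc⟩ := exists_bound_ray (S := S) R.sq b
  obtain ⟨u, hu⟩ := (rayKernel R t c hc0 hc).exists_isSol (Pi.single j 1)
  have hz : (0 : ℂ) ∈ S.ray := ⟨0, ⟨le_rfl, by have := S.q0_pos; positivity⟩, by simp⟩
  -- At infinity a damped component has zero propagator and zero boundary value. An undamped one is
  -- driven only by components of the other block, all damped, so it keeps its boundary value.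
  have hdamp : ∀ l, κ l = true → ∀ y, u y 0 l = 0 := by
    intro l hl y
    rw [hu.eq 0 hz y l]
    have h1 : l ≠ j := by
      rintro rfl
      exact (hκ l).1 hl Iff.rfl
    have e : ∀ s, (rayKernel R t c hc0 hc).e l s 0 = 0 := fun s => by
      simp [rayKernel, rayProp, hl]
    simp [e, h1]
  have hu0 : u (sg b * x) 0 = Pi.single j 1 := by
    ext l
    cases hl : κ l
    · rw [hu.eq 0 hz _ l]
      have hlj : (l = 2) ↔ (j = 2) := by
        by_contra h
        have := (hκ l).2 h
        rw [hl] at this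
        exact Bool.false_ne_true this
      have hB : ∀ y, ((rayKernel R t c hc0 hc).B y 0 *ᵥ u y 0) l = 0 := by
        intro y
        rw [mulVec, dotProduct]
        refine Finset.sum_eq_zero fun m _ => ?_
        by_cases hm : (m = 2) ↔ (j = 2)
        · have : (rayKernel R t c hc0 hc).B y 0 = S.pert b t y 0 := by simp [rayKernel]
          rw [this, pert_zero_block b t y (hlj.trans hm.symm), zero_mul]
        · rw [hdamp m ((hκ m).2 hm), mul_zero]
      simp [hB]
    · rw [hdamp l hl, Pi.single_eq_of_ne]
      rintro rfl
      exact (hκ l).1 hl Iff.rfl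
  have hmap : Tendsto (fun s : ℝ => (s : ℂ)) (𝓝[>] 0) (𝓝[S.ray] 0) := by
    refine tendsto_nhdsWithin_iff.2 ⟨?_, ?_⟩
    · exact (Complex.continuous_ofReal.tendsto' 0 0 (by simp)).mono_left nhdsWithin_le_nhds
    · have h1 : Set.Ioo (0 : ℝ) (1 / (2 * S.q0)) ∈ 𝓝[>] (0 : ℝ) :=
        Ioo_mem_nhdsGT (by have := S.q0_pos; positivity)
      filter_upwards [h1] with s hs
      exact ⟨s, ⟨hs.1.le, hs.2.le⟩, rfl⟩
  have hcu : ContinuousWithinAt (fun ζ => u (sg b * x) ζ) S.ray 0 :=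
    (hu.cont.comp (f := fun w : ℂ => (sg b * x, w)) (by fun_prop) (fun w hw => ⟨trivial, hw⟩)) 0 hz
  have hlim : ContinuousWithinAt (fun ζ => S.Gam (S.qEnd b) (σ / ζ) *ᵥ u (sg b * x) ζ) S.ray 0 := by
    refine continuousWithinAt_pi.2 fun i => ?_
    simp only [mulVec, dotProduct]
    exact tendsto_finsetSum _ fun l _ => (continuousOn_Gam_ray σ _ i l 0 hz).mul
      (continuousWithinAt_pi.1 hcu l)
  have h2 := Tendsto.comp hlim hmap
  simp only [hu0, div_zero, mulVec_single_one] at h2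
  refine h2.congr' ?_
  have h1 : Set.Ioo (0 : ℝ) (1 / (2 * S.q0)) ∈ 𝓝[>] (0 : ℝ) :=
    Ioo_mem_nhdsGT (by have := S.q0_pos; positivity)
  filter_upwards [h1] with s hs
  exact (mu_eq_of_ray_isSol R hu ⟨s, ⟨hs.1.le, hs.2.le⟩, rfl⟩
    (Complex.ofReal_ne_zero.2 hs.1.ne') x).symm

end HighEnergy

end NZBCSolution

end CMKdV

namespace CMKdV

namespace NZBCSolution

variable {S : NZBCSolution}

/-! ### The denominators do not vanish identically -/

section Denominators

theorem im_I_mul_div (r s : ℝ) : ((r : ℂ) * Complex.I / s).im = r / s := by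
  rw [Complex.div_ofReal_im]
  simp

theorem norm_I_mul_div {r s : ℝ} (hr : ‖(r : ℂ)‖ = 1) (hs : 0 < s) :
    ‖(r : ℂ) * Complex.I / s‖ = 1 / s := by
  rw [norm_div, norm_mul, hr, Complex.norm_I, Complex.norm_real, Real.norm_of_nonneg hs.le, one_mul]

theorem q0_lt_of_mem_ray {s : ℝ} (h0 : 0 < s) (hs : s ≤ 1 / (2 * S.q0)) : S.q0 < 1 / s := by
  have hq := S.q0_pos
  rw [lt_div_iff₀ h0]
  calc S.q0 * s ≤ S.q0 * (1 / (2 * S.q0)) := mul_le_mul_of_nonneg_left hs hq.le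
    _ = 1 / 2 := by field_simp
    _ < 1 := by norm_num

theorem regular_ray {r s : ℝ} (hr : ‖(r : ℂ)‖ = 1) (h0 : 0 < s) (hs : s ≤ 1 / (2 * S.q0)) :
    S.Regular ((r : ℂ) * Complex.I / s) := by
  have h := q0_lt_of_mem_ray h0 hs
  rw [← norm_I_mul_div hr h0] at h
  exact regular_of_norm_ne (norm_pos_iff.1 (S.q0_pos.trans h)) h.ne'

theorem ray_pos {s : ℝ} (hs : s ∈ Set.Icc 0 (1 / (2 * S.q0))) (h0 : (s : ℂ) ≠ 0) : 0 < s :=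
  lt_of_le_of_ne hs.1 fun h => h0 (by rw [← h, Complex.ofReal_zero])

theorem sg_mul_I_sq (b : Bool) : ((sg b : ℂ) * Complex.I) ^ 2 = -1 := by
  rw [mul_pow, Complex.I_sq, pow_two, ofReal_sg_mul_self, one_mul]

/-- Relative to the middle exponent, `λ - k = q₀²/z` is linear in `ζ` and so harmless at infinity,
while `-λ - k = -z` is large with the damping sign. -/
theorem rayData_one (b : Bool) :
    S.RayData b 1 ((sg b : ℂ) * Complex.I) ![false, false, true] where
  sq := sg_mul_I_sq b
  mem := by
    rintro _ ⟨s, hs, rfl⟩ h0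
    have h1 := ray_pos hs h0
    have hr := regular_ray (S := S) (norm_sg b) h1 hs.2
    cases b
    · refine mem_dom_false_1 hr ?_
      rw [im_I_mul_div]
      exact div_nonpos_of_nonpos_of_nonneg (by simp [sg]) h1.le
    · refine mem_dom_true_1 hr ?_
      rw [im_I_mul_div]
      simp [sg, h1.le]
  free l hl := by
    fin_cases l
    · refine ⟨sg b * Complex.I * S.q0 ^ 2 / (sg b * Complex.I), fun ζ => ?_⟩
      simp only [expo, kap, lam, k, Fin.zero_eta, cons_val, div_div_eq_mul_div]
      ring
    · exact ⟨0, fun ζ => by simp [expo]⟩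
    · simp at hl
  damp l hl := by
    rintro _ ⟨s, hs, rfl⟩ h0
    have h1 := ray_pos hs h0
    fin_cases l
    · simp at hl
    · simp at hl
    · have e : S.expo b 1 2 ((sg b : ℂ) * Complex.I / s) = ((1 / s : ℝ) : ℂ) := by
        have h2 := ofReal_sg_mul_self b
        have hI := Complex.I_sq
        simp only [expo, kap, lam, k, cons_val]
        push_cast
        linear_combination (-Complex.I ^ 2 / s) * h2 - (1 / s) * hI
      change _ ≤ (S.expo b 1 2 _).re
      rw [e, Complex.ofReal_re, Complex.norm_real, Real.norm_of_nonneg h1.le]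
      gcongr
      linarith

/-- Relative to `-λ` the differences are `2λ = z + q₀²/z` and `k + λ = z`, both large with the
damping sign on the ray opposite to that of the middle column. -/
theorem rayData_two (b : Bool) :
    S.RayData b 2 ((sg (!b) : ℂ) * Complex.I) ![true, true, false] where
  sq := sg_mul_I_sq _
  mem := by
    rintro _ ⟨s, hs, rfl⟩ h0
    have h1 := ray_pos hs h0
    have hr := regular_ray (S := S) (norm_sg (!b)) h1 hs.2
    have hn : S.q0 ≤ ‖((sg (!b) : ℂ) * Complex.I / s)‖ := by
      rw [norm_I_mul_div (norm_sg _) h1]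
      exact (q0_lt_of_mem_ray h1 hs.2).le
    cases b
    · refine mem_dom_false_2 hr hn ?_
      rw [im_I_mul_div]
      simp [sg, h1.le]
    · refine mem_dom_true_2 hr hn ?_
      rw [im_I_mul_div]
      exact div_nonpos_of_nonpos_of_nonneg (by simp [sg]) h1.le
  free l hl := by
    fin_cases l
    · simp at hl
    · simp at hl
    · exact ⟨0, fun ζ => by simp [expo]⟩
  damp l hl := by
    rintro _ ⟨s, hs, rfl⟩ h0
    have h1 := ray_pos hs h0
    have h2 : (sg b : ℂ) * sg (!b) = -1 := by cases b <;> simp [sg]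
    have hI := Complex.I_sq
    have hle : 1 / (2 * s) ≤ 1 / s := by
      gcongr
      linarith
    rw [Complex.norm_real, Real.norm_of_nonneg h1.le]
    fin_cases l
    · have e : S.expo b 2 0 ((sg (!b) : ℂ) * Complex.I / s)
          = ((1 / s - S.q0 ^ 2 * s : ℝ) : ℂ) := by
        have h3 : ((sg (!b) : ℂ) * Complex.I)⁻¹ = -(sg (!b) * Complex.I) :=
          inv_eq_of_mul_eq_one_right (by linear_combination (-1 : ℂ) * sg_mul_I_sq (!b))
        have h4 : (S.q0 : ℂ) ^ 2 / ((sg (!b) : ℂ) * Complex.I / s)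
            = -(S.q0 ^ 2 * s * (sg (!b) * Complex.I)) := by
          rw [div_div_eq_mul_div, div_eq_mul_inv, h3]
          ring
        simp only [expo, kap, lam, cons_val, h4]
        push_cast
        linear_combination (Complex.I ^ 2 / s - S.q0 ^ 2 * s * Complex.I ^ 2) * h2
          + (-1 / s + S.q0 ^ 2 * s) * hI
      rw [Fin.zero_eta, e, Complex.ofReal_re]
      -- On this ray the exponent is `1/s - q₀² s`, and `q₀² s² ≤ 1/4` leaves at least `1/(2s)`.
      have h5 := sq_le_of_mem_ray hs
      rw [le_sub_iff_add_le, div_add' _ _ _ (by positivity), div_le_div_iff₀ (by positivity) h1]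
      nlinarith
    · have e : S.expo b 2 1 ((sg (!b) : ℂ) * Complex.I / s) = ((1 / s : ℝ) : ℂ) := by
        simp only [expo, kap, lam, k, cons_val]
        push_cast
        linear_combination (Complex.I ^ 2 / s) * h2 - (1 / s) * hI
      rw [Fin.mk_one, e, Complex.ofReal_re]
      exact hle
    · simp at hl

theorem tendsto_mu_one (b : Bool) : Tendsto
    (fun s : ℝ => S.mu b 1 0 0 ((sg b : ℂ) * Complex.I / s)) (𝓝[>] 0)
    (𝓝 fun i => S.Gam (S.qEnd b) 0 i 1) :=
  tendsto_mu_ray (rayData_one b) (by decide) 0 0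

theorem tendsto_mu_two (b : Bool) : Tendsto
    (fun s : ℝ => S.mu b 2 0 0 ((sg (!b) : ℂ) * Complex.I / s)) (𝓝[>] 0)
    (𝓝 fun i => S.Gam (S.qEnd b) 0 i 2) :=
  tendsto_mu_ray (rayData_two b) (by decide) 0 0

theorem mu_zero (b : Bool) (j : Fin 3) (z : ℂ) : S.mu b j 0 0 z = S.phi b j 0 0 z := by
  rw [mu, theta_eq]
  simp

theorem sc_eq_mu {b : Bool} {i j : Fin 3} {z : ℂ} (hi : conj z ∈ S.dom b i) :
    S.sc b i j z = (S.C i z)⁻¹ * (star (S.mu b i 0 0 (conj z)) ⬝ᵥ S.mu (!b) j 0 0 z) := by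
  rw [sc, phiAdj_eq hi, mu_zero, mu_zero]

/-- The parallel boundary values enter here: both are phases times the same vector, so the pairing
is a product of phases, where nonparallel vectors might be orthogonal. -/
theorem Gam_dot_one : star (fun i => S.Gam S.qMinus 0 i 1) ⬝ᵥ (fun i => S.Gam S.qPlus 0 i 1) ≠ 0 := by
  have hq := S.q0_ne
  have hs : S.qvec 0 * conj (S.qvec 0) + S.qvec 1 * conj (S.qvec 1) = (S.q0 : ℂ) ^ 2 :=
    (norm_sq_eq S.qvec).symm
  have e : star (fun i => S.Gam S.qMinus 0 i 1) ⬝ᵥ (fun i => S.Gam S.qPlus 0 i 1)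
      = Complex.exp (Complex.I * S.phaseMinus) * conj (Complex.exp (Complex.I * S.phasePlus)) := by
    simp only [dotProduct, Fin.sum_univ_three, Pi.star_apply, Gam, Matrix.of_apply, cons_val,
      Complex.star_def, map_div₀, map_neg, Complex.conj_conj, Complex.conj_ofReal, map_zero, qMinus,
      qPlus, PiLp.smul_apply, smul_eq_mul, map_mul]
    field_simp
    linear_combination (Complex.exp (Complex.I * S.phaseMinus)
      * conj (Complex.exp (Complex.I * S.phasePlus))) * hs
  rw [e]
  exact mul_ne_zero (Complex.exp_ne_zero _) ((map_ne_zero _).2 (Complex.exp_ne_zero _))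

theorem Gam_dot_two : star (fun i => S.Gam S.qPlus 0 i 2) ⬝ᵥ (fun i => S.Gam S.qMinus 0 i 2) ≠ 0 := by
  simp [dotProduct, Fin.sum_univ_three, Gam]

theorem tendsto_star_dot {X : Type*} {l : Filter X} {f g : X → Fin 3 → ℂ} {u v : Fin 3 → ℂ}
    (hf : Tendsto f l (𝓝 u)) (hg : Tendsto g l (𝓝 v)) :
    Tendsto (fun x => star (f x) ⬝ᵥ g x) l (𝓝 (star u ⬝ᵥ v)) :=
  tendsto_finsetSum _ fun i _ => (((continuous_star.tendsto u).comp hf).apply_nhds i).mul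
    (hg.apply_nhds i)

theorem conj_ray (s : ℝ) : conj ((sg true : ℂ) * Complex.I / s) = (sg false : ℂ) * Complex.I / s := by
  simp [sg]

theorem eventually_mem_D1 :
    ∀ᶠ s : ℝ in 𝓝[>] 0, (sg true : ℂ) * Complex.I / s ∈ S.D1 := by
  have h1 : Set.Ioo (0 : ℝ) (1 / (2 * S.q0)) ∈ 𝓝[>] (0 : ℝ) :=
    Ioo_mem_nhdsGT (by have := S.q0_pos; positivity)
  filter_upwards [h1] with s hs
  refine ⟨?_, ?_⟩
  · rw [norm_I_mul_div (norm_sg _) hs.1]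
    exact q0_lt_of_mem_ray hs.1 hs.2.le
  · rw [im_I_mul_div]
    have := hs.1
    simp [sg, this]

/-- Up to the nonzero factor `C⁻¹` the coefficient is a pairing of two columns, whose limit along
the ray is nonzero. -/
theorem exists_b11_ne : ∃ z ∈ S.D1, S.b 1 1 z ≠ 0 := by
  have h := (tendsto_star_dot (tendsto_mu_one (S := S) false)
    (tendsto_mu_one true)).eventually_ne Gam_dot_one
  obtain ⟨s, h1, h2⟩ := (h.and eventually_mem_D1).exists
  refine ⟨_, h2, ?_⟩
  have hr := D1_regular h2
  rw [b_eq_sc, sc_eq_mu (mem_dom_false_1 (S.regular_conj hr) (by rw [Complex.conj_im]; exact neg_nonpos.2 h2.2.le)), conj_ray]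
  exact mul_ne_zero (inv_ne_zero (C_ne S hr 1)) h1

theorem exists_a22_ne : ∃ z ∈ S.D1, S.a 2 2 z ≠ 0 := by
  have h := (tendsto_star_dot (tendsto_mu_two (S := S) true)
    (tendsto_mu_two false)).eventually_ne Gam_dot_two
  obtain ⟨s, h1, h2⟩ := (h.and eventually_mem_D1).exists
  refine ⟨_, h2, ?_⟩
  have hr := D1_regular h2
  rw [a_eq_sc, sc_eq_mu (mem_dom_true_2 (S.regular_conj hr) (by simpa using h2.1.le)
    (by rw [Complex.conj_im]; exact neg_nonpos.2 h2.2.le)), conj_ray]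
  exact mul_ne_zero (inv_ne_zero (C_ne S hr 2)) h1

theorem conj_mem_D2 {z : ℂ} (h : z ∈ S.D1) : conj z ∈ S.D2 :=
  ⟨by simpa using h.1, by simpa using h.2⟩

theorem norm_hat_lt {z : ℂ} (h : S.q0 < ‖z‖) : ‖S.hat z‖ < S.q0 := by
  have h0 := S.q0_pos
  rw [hat, norm_div, norm_neg, norm_pow, Complex.norm_real, Real.norm_of_nonneg h0.le,
    div_lt_iff₀ (h0.trans h)]
  nlinarith

theorem im_hat (z : ℂ) : (S.hat z).im = z.im * (S.q0 ^ 2 / Complex.normSq z) := by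
  rw [hat, neg_div, Complex.neg_im, im_q_div, neg_neg]

theorem hat_factor_pos {z : ℂ} (h : S.q0 < ‖z‖) : 0 < S.q0 ^ 2 / Complex.normSq z := by
  have h0 := S.q0_pos
  have h1 := h0.trans h
  rw [Complex.normSq_eq_norm_sq]
  positivity

theorem hat_mem_D4 {z : ℂ} (h : z ∈ S.D1) : S.hat z ∈ S.D4 :=
  ⟨norm_hat_lt h.1, by rw [im_hat]; exact mul_pos h.2 (hat_factor_pos h.1)⟩

theorem hat_mem_D3 {z : ℂ} (h : z ∈ S.D2) : S.hat z ∈ S.D3 :=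
  ⟨norm_hat_lt h.1, by rw [im_hat]; exact mul_neg_of_neg_of_pos h.2 (hat_factor_pos h.1)⟩

/-- No further asymptotics are needed: conjugation carries nonvanishing from `D1` to `D2`, and `z ↦
ẑ` carries it from `D1` to `D4` and from `D2` to `D3`. -/
theorem exists_b22_ne : ∃ z ∈ S.D2, S.b 2 2 z ≠ 0 := by
  obtain ⟨z, hz, h⟩ := exists_a22_ne (S := S)
  have hz2 := conj_mem_D2 hz
  have hr := D2_regular hz2
  refine ⟨_, hz2, fun h0 => h ?_⟩
  have e := conj_sc (b := true) (i := 2) (j := 2) (z := conj z) (mem_dom_true_2 hr hz2.1.le hz2.2.le)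
    (by rw [Complex.conj_conj]; exact mem_dom_false_2 (D1_regular hz) hz.1.le hz.2.le)
  rw [Complex.conj_conj, Bool.not_true, ← b_eq_sc, h0, mul_zero, map_eq_zero] at e
  exact e

theorem exists_a11_ne : ∃ z ∈ S.D2, S.a 1 1 z ≠ 0 := by
  obtain ⟨z, hz, h⟩ := exists_b11_ne (S := S)
  have hz2 := conj_mem_D2 hz
  have hr := D2_regular hz2
  refine ⟨_, hz2, fun h0 => h ?_⟩
  have e := conj_sc (b := false) (i := 1) (j := 1) (z := conj z) (mem_dom_false_1 hr hz2.2.le)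
    (by rw [Complex.conj_conj]; exact mem_dom_true_1 (D1_regular hz) hz.2.le)
  rw [Complex.conj_conj, Bool.not_false, ← a_eq_sc, h0, mul_zero, map_eq_zero] at e
  exact e

theorem exists_b00_ne : ∃ z ∈ S.D3, S.b 0 0 z ≠ 0 := by
  obtain ⟨z, hz, h⟩ := exists_b22_ne (S := S)
  have hr := D2_regular hz
  refine ⟨_, hat_mem_D3 hz, fun h0 => h ?_⟩
  rw [b_eq_sc, sc_hat (mem_dom_false_2 (S.regular_conj hr) (by simpa using hz.1.le)
    (by simpa using hz.2.le)) (mem_dom_true_2 hr hz.1.le hz.2.le)]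
  exact mul_eq_zero_of_right _ h0

theorem exists_a11_ne' : ∃ z ∈ S.D3, S.a 1 1 z ≠ 0 := by
  obtain ⟨z, hz, h⟩ := exists_a11_ne (S := S)
  have hr := D2_regular hz
  refine ⟨_, hat_mem_D3 hz, fun h0 => h ?_⟩
  rw [a_eq_sc, sc_hat (mem_dom_true_1 (S.regular_conj hr) (by simpa using hz.2.le))
    (mem_dom_false_1 hr hz.2.le)]
  exact mul_eq_zero_of_right _ h0

theorem exists_a00_ne : ∃ z ∈ S.D4, S.a 0 0 z ≠ 0 := by
  obtain ⟨z, hz, h⟩ := exists_a22_ne (S := S)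
  have hr := D1_regular hz
  refine ⟨_, hat_mem_D4 hz, fun h0 => h ?_⟩
  rw [a_eq_sc, sc_hat (mem_dom_true_2 (S.regular_conj hr) (by simpa using hz.1.le)
    (by simpa using hz.2.le)) (mem_dom_false_2 hr hz.1.le hz.2.le)]
  exact mul_eq_zero_of_right _ h0

theorem exists_b11_ne' : ∃ z ∈ S.D4, S.b 1 1 z ≠ 0 := by
  obtain ⟨z, hz, h⟩ := exists_b11_ne (S := S)
  have hr := D1_regular hz
  refine ⟨_, hat_mem_D4 hz, fun h0 => h ?_⟩
  rw [b_eq_sc, sc_hat (mem_dom_false_1 (S.regular_conj hr) (by simpa using hz.2.le))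
    (mem_dom_true_1 hr hz.2.le)]
  exact mul_eq_zero_of_right _ h0

end Denominators

end NZBCSolution

end CMKdV


end

/-! ### Assembly -/

theorem mainTheorem7 (S : CMKdV.NZBCSolution) :
    -- the Jost functions and their adjoints are well defined
    (∀ (j : Fin 3) (z : ℂ), S.Regular z →
      (z ∈ S.domPlus j → ∃! φ, S.IsPhiPlus j z φ) ∧
      (z ∈ S.domMinus j → ∃! φ, S.IsPhiMinus j z φ) ∧
      (conj z ∈ S.domPlus j → ∃! φ, S.IsPhiPlusAdj j z φ) ∧
      (conj z ∈ S.domMinus j → ∃! φ, S.IsPhiMinusAdj j z φ)) ∧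
    -- on the real axis `A` is the scattering matrix and `B` its inverse
    (∀ z : ℂ, z.im = 0 → z ≠ 0 →
      (∀ x t, (S.PhiPlusMat x t z).det ≠ 0 ∧
        S.PhiMinusMat x t z = S.PhiPlusMat x t z * S.A z) ∧
      S.A z * S.B z = 1) ∧
    -- the denominators in the four regions
    CMKdV.NZBCSolution.GoodDenominators (S.b 1 1) (S.a 2 2) S.D1 ∧
    CMKdV.NZBCSolution.GoodDenominators (S.b 2 2) (S.a 1 1) S.D2 ∧
    CMKdV.NZBCSolution.GoodDenominators (S.b 0 0) (S.a 1 1) S.D3 ∧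
    CMKdV.NZBCSolution.GoodDenominators (S.b 1 1) (S.a 0 0) S.D4 ∧
    -- sectional meromorphy and boundary values
    S.SectionallyMeromorphic S.M1 (S.b 1 1) (S.a 2 2) S.D1 ∧
    S.SectionallyMeromorphic S.M2 (S.b 2 2) (S.a 1 1) S.D2 ∧
    S.SectionallyMeromorphic S.M3 (S.b 0 0) (S.a 1 1) S.D3 ∧
    S.SectionallyMeromorphic S.M4 (S.b 1 1) (S.a 0 0) S.D4 ∧
    -- the jump conditions
    (∀ x t, ∀ z ∈ S.Sigma1, S.Regular z →
      S.b 1 1 z ≠ 0 → S.a 2 2 z ≠ 0 → S.b 2 2 z ≠ 0 → S.a 1 1 z ≠ 0 →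
      S.M1 x t z = S.M2 x t z * S.jump S.L1 x t z) ∧
    (∀ x t, ∀ z ∈ S.Sigma2, S.Regular z →
      S.b 0 0 z ≠ 0 → S.a 1 1 z ≠ 0 → S.b 2 2 z ≠ 0 →
      S.M3 x t z = S.M2 x t z * S.jump S.L2 x t z) ∧
    (∀ x t, ∀ z ∈ S.Sigma3, S.Regular z →
      S.b 0 0 z ≠ 0 → S.a 1 1 z ≠ 0 → S.b 1 1 z ≠ 0 → S.a 0 0 z ≠ 0 →
      S.M3 x t z = S.M4 x t z * S.jump S.L3 x t z) ∧
    (∀ x t, ∀ z ∈ S.Sigma4, S.Regular z →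
      S.b 1 1 z ≠ 0 → S.a 2 2 z ≠ 0 → S.a 0 0 z ≠ 0 →
      S.M1 x t z = S.M4 x t z * S.jump S.L4 x t z) ∧
    -- the two combinations of reflection coefficients that drop out of `L₄`
    (∀ z : ℂ, z.im = 0 → z ≠ 0 → S.a 0 0 z ≠ 0 → S.a 2 2 z ≠ 0 → S.b 1 1 z ≠ 0 →
      S.l6 z = 0 ∧ S.l7 z = 0) := by
  have hreal : ∀ {z : ℂ}, z.im = 0 → z ≠ 0 → S.A z * S.B z = 1 := fun h hz =>
    CMKdV.NZBCSolution.sc_mul_sc (b := true) h hz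
  refine ⟨fun j z hr => ⟨fun h => ?_, fun h => ?_, fun h => ?_, fun h => ?_⟩,
    fun z h hz => ⟨fun x t => ⟨?_, ?_⟩, hreal h hz⟩,
    ⟨?_, ?_, ?_, ?_⟩, ⟨?_, ?_, ?_, ?_⟩, ⟨?_, ?_, ?_, ?_⟩, ⟨?_, ?_, ?_, ?_⟩,
    CMKdV.NZBCSolution.sectionallyMeromorphic_M1, CMKdV.NZBCSolution.sectionallyMeromorphic_M2,
    CMKdV.NZBCSolution.sectionallyMeromorphic_M3, CMKdV.NZBCSolution.sectionallyMeromorphic_M4,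
    fun x t z hz hr h1 h2 h3 h4 => ?_, fun x t z hz hr h1 h2 h3 => ?_,
    fun x t z hz hr h1 h2 h3 h4 => ?_, fun x t z hz hr h1 h2 h3 => ?_,
    fun z h hz h1 h2 h3 => CMKdV.NZBCSolution.l6_l7_eq_zero h hz h1 h2 h3⟩
  · exact CMKdV.NZBCSolution.existsUnique_isPhi (b := true)
      (CMKdV.NZBCSolution.mem_dom_of_domPlus hr h)
  · exact CMKdV.NZBCSolution.existsUnique_isPhi (b := false)
      (CMKdV.NZBCSolution.mem_dom_of_domMinus hr h)
  · exact CMKdV.NZBCSolution.existsUnique_isPhiAdj (b := true)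
      (CMKdV.NZBCSolution.mem_dom_of_domPlus (S.regular_conj hr) h)
  · exact CMKdV.NZBCSolution.existsUnique_isPhiAdj (b := false)
      (CMKdV.NZBCSolution.mem_dom_of_domMinus (S.regular_conj hr) h)
  · rw [CMKdV.NZBCSolution.PhiPlusMat_eq]
    exact CMKdV.NZBCSolution.phiMat_det_ne h hz x t
  · rw [CMKdV.NZBCSolution.PhiPlusMat_eq, CMKdV.NZBCSolution.PhiMinusMat_eq]
    exact CMKdV.NZBCSolution.phiMat_eq (b := true) h hz x t
  · exact CMKdV.NZBCSolution.holCont_b11_D1.diff.analyticOnNhd S.isOpen_D1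
  · exact CMKdV.NZBCSolution.holCont_a22_D1.diff.analyticOnNhd S.isOpen_D1
  · exact CMKdV.NZBCSolution.exists_b11_ne
  · exact CMKdV.NZBCSolution.exists_a22_ne
  · exact CMKdV.NZBCSolution.holCont_b22_D2.diff.analyticOnNhd S.isOpen_D2
  · exact CMKdV.NZBCSolution.holCont_a11_D2.diff.analyticOnNhd S.isOpen_D2
  · exact CMKdV.NZBCSolution.exists_b22_ne
  · exact CMKdV.NZBCSolution.exists_a11_ne
  · exact CMKdV.NZBCSolution.holCont_b00_D3.diff.analyticOnNhd S.isOpen_D3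
  · exact CMKdV.NZBCSolution.holCont_a11_D3.diff.analyticOnNhd S.isOpen_D3
  · exact CMKdV.NZBCSolution.exists_b00_ne
  · exact CMKdV.NZBCSolution.exists_a11_ne'
  · exact CMKdV.NZBCSolution.holCont_b11_D4.diff.analyticOnNhd S.isOpen_D4
  · exact CMKdV.NZBCSolution.holCont_a00_D4.diff.analyticOnNhd S.isOpen_D4
  · exact CMKdV.NZBCSolution.exists_b11_ne'
  · exact CMKdV.NZBCSolution.exists_a00_ne
  -- The two closures meet only on the real axis, where all columns exist.
  · have c1 := CMKdV.NZBCSolution.closure_D1 hz.1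
    have c2 := CMKdV.NZBCSolution.closure_D2 hz.2
    exact CMKdV.NZBCSolution.jump1 (le_antisymm c2.2 c1.2) hr.1 h1 h2 h3 h4 x t
  -- On the arc the bounds from both closures hold at once, and together they supply exactly the
  -- columns that the jump needs.
  · have c2 := CMKdV.NZBCSolution.closure_D2 hz.1
    have c3 := CMKdV.NZBCSolution.closure_D3 hz.2
    have hr' := S.regular_conj hr
    exact CMKdV.NZBCSolution.jump2 (CMKdV.NZBCSolution.mem_dom_true_0 hr c3.1 c3.2)
      (CMKdV.NZBCSolution.mem_dom_true_2 hr c2.1 c2.2)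
      (CMKdV.NZBCSolution.mem_dom_true_1 hr' (by simpa using c2.2))
      (CMKdV.NZBCSolution.mem_dom_false_0 hr' (by simpa using c3.1) (by simpa using c3.2))
      (CMKdV.NZBCSolution.mem_dom_false_2 hr' (by simpa using c2.1) (by simpa using c2.2))
      h1 h3 x t
  · have c3 := CMKdV.NZBCSolution.closure_D3 hz.1
    have c4 := CMKdV.NZBCSolution.closure_D4 hz.2
    exact CMKdV.NZBCSolution.jump3 (le_antisymm c3.2 c4.2) hr.1 h1 h2 h3 h4 x t
  · have c4 := CMKdV.NZBCSolution.closure_D4 hz.1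
    have c1 := CMKdV.NZBCSolution.closure_D1 hz.2
    have hr' := S.regular_conj hr
    exact CMKdV.NZBCSolution.jump4 (CMKdV.NZBCSolution.mem_dom_false_0 hr c4.1 c4.2)
      (CMKdV.NZBCSolution.mem_dom_false_2 hr c1.1 c1.2)
      (CMKdV.NZBCSolution.mem_dom_true_1 hr c1.2)
      (CMKdV.NZBCSolution.mem_dom_true_0 hr' (by simpa using c4.1) (by simpa using c4.2))
      (CMKdV.NZBCSolution.mem_dom_true_2 hr' (by simpa using c1.1) (by simpa using c1.2))
      (CMKdV.NZBCSolution.mem_dom_false_1 hr' (by simpa using c1.2)) h1 h2 h3 x t
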